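/- **Setting.** Write $Z(\theta)=\mathrm{diag}(1,e^{i\theta})$, let $C^kZ(\theta)$ be the $(k+1)$-qubit gate that multiplies $|1\dots1\rangle$ by $e^{i\theta}$ and fixes the other basis states, and put $T=Z(\pi/4)$, $S=Z(\pi/2)$, $CZ=C^1Z(\pi)$, $CCZ=C^2Z(\pi)$, $K=SH$. Logical operators are implemented up to a global phase. *Codes.* The 5-qubit code has stabilizer generators $XZZXI, IXZZX, XIXZZ, ZXIXZ$; its logical $|\bar0\rangle$ is the normalized projection of $|00000\rangle$ to the code space, and $|\bar1\rangle=X^{\otimes5}|\bar0\rangle$. The 5'-qubit code is its image under $K_1Y_3K_5$. The 15-qubit Reed–Muller code (RM) has as its logical $|\bar l\rangle$, $l\in\{0,1\}$, the uniform superposition of the 16 words $l\cdot(1,\dots,1)+\sum_{i=0}^{3}a_iv_i \bmod 2$, where $v_i\in\mathbb F_2^{15}$ consists of the $i$-th binary digits of $1,\dots,15$. The *non-uniform* code is obtained by encoding a logical qubit in the 5'-qubit code, then encoding its qubits 1, 3, 5 in RM and leaving its qubits 2, 4 unencoded; the *uniform* code by encoding all five qubits in RM. *Error correction and fault tolerance.*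 An error-correction procedure measures finitely many commuting signed Pauli strings that fix the code and applies a Pauli string depending only on the outcome (the syndrome). It corrects an error operator if, for every syndrome, every encoded state is restored up to a scalar independent of the state. Physical circuits consist of the gates $X,Y,Z,H,K,S,S^\dagger,T,T^\dagger,CNOT,CZ,CCZ$. A single fault is an arbitrary operator inserted once, either on one qubit at any time (including the input), or on all the qubits of a gate right after that gate. A circuit on $m$ code blocks is a fault-tolerant implementation of an $m$-qubit logical gate $G$, with respect to a given procedure, if without faults it acts on encoded states as $G$ and if, after any single fault, applying the procedure to each block at the end yields the encoded output of $G$ up to a scalar independent of the encoded state, for all syndromes. **Statement.** 1. $\{K,T,S,CZ,CCZ\}$ is universal: for every $n$, each unitary on $n$ qubits is a limit of circuits on these $n$ qubits over this set, up to global phases. 2. The 5'-qubit code and RM each have orthonormal logical bases and a procedure that corrects an arbitrary error on any one qubit. 3. On the 5'-qubit code the bitwise operator $Z_3K^{\otimes5}$ implements the logical $K$. For all $k\ge0$ and $\theta\in\mathbb R$, the logical $C^kZ(\theta)$ on $k+1$ blocks is implemented by coupling only the qubits 1, 3, 5 of each block: in each block apply $CNOT_{1\to3}$ and then $CNOT_{3\to5}$,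 apply a physical $C^kZ(\theta)$ to the fifth qubits of the blocks, and undo the $CNOT$s. The gates $CNOT,T,S,CZ,CCZ$ have transversal implementations on RM. 4. The non-uniform code has 47 physical qubits and an orthonormal logical basis, and there is one error-correction procedure that corrects an arbitrary error on any one physical qubit and with respect to which each of the logical gates $K,T,S,CZ,CCZ$ has a fault-tolerant implementation. 5. The uniform code has 75 physical qubits, and the same holds for it. -/

import Mathlib

open Matrix

namespace ConcatFT

/-! ### Registers of qubits, states and operators -/

/-- A (not necessarily normalized) state of a register whose qubits are indexed by `ι`. -/
abbrev State (ι : Type) := (ι → Fin 2) → ℂ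

/-- Operators on the register indexed by `ι`, as matrices in the computational basis. -/
abbrev Op (ι : Type) := Matrix (ι → Fin 2) (ι → Fin 2) ℂ

section Operators

variable {ι κ : Type} [Fintype ι] [DecidableEq ι] [Fintype κ]

/-- The tensor product `⨂ i, A i` of single-qubit operators. -/
def localOp (A : ι → Matrix (Fin 2) (Fin 2) ℂ) : Op ι :=
  fun x y => ∏ i, A i (x i) (y i)

/-- The operator `G` applied to the qubits `e 0, e 1, …` of the register, the identity being
applied to all the other qubits. -/
def applyAt (e : κ ↪ ι) (G : Op κ) : Op ι :=
  fun x y => if ∀ i, i ∉ Finset.univ.map e → x i = y i then G (x ∘ e) (y ∘ e) else 0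

/-- `F` is an arbitrary operator acting only on the qubits in `A`. -/
def SupportedOn (A : Finset ι) (F : Op ι) : Prop :=
  ∃ G : Op A, F = applyAt (Function.Embedding.subtype (· ∈ A)) G

/-- The tensor product of operators on `m` blocks, each block being a copy of the register `ι`. -/
def blockOp {m : ℕ} (A : Fin m → Op ι) : Op (Fin m × ι) :=
  fun x y => ∏ j, A j (fun i => x (j, i)) (fun i => y (j, i))

/-- A transversal (bitwise) operator on `m` blocks: the tensor product over the positions `i` of
operators `A i`, where `A i` acts on the `i`-th qubits of the blocks. -/
def Transversal {m : ℕ} (V : Op (Fin m × ι)) : Prop :=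
  ∃ A : ι → Op (Fin m), V = fun x y => ∏ i, A i (fun j => x (j, i)) (fun j => y (j, i))

end Operators

/-! ### Gates and circuits -/

noncomputable section

/-- Pauli `X`. -/
def xMat : Matrix (Fin 2) (Fin 2) ℂ := !![0, 1; 1, 0]

/-- Pauli `Y`. -/
def yMat : Matrix (Fin 2) (Fin 2) ℂ := !![0, -Complex.I; Complex.I, 0]

/-- Pauli `Z`. -/
def zMat : Matrix (Fin 2) (Fin 2) ℂ := !![1, 0; 0, -1]

/-- The Hadamard gate. -/
def hMat : Matrix (Fin 2) (Fin 2) ℂ := ((1 / Real.sqrt 2 : ℝ) : ℂ) • !![1, 1; 1, -1]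

/-- `Z(θ) = diag(1, exp(iθ))`. -/
def phaseMat (θ : ℝ) : Matrix (Fin 2) (Fin 2) ℂ := !![1, 0; 0, Complex.exp (θ * Complex.I)]

/-- `K = S H`, where `S = Z(π/2)`. -/
def kMat : Matrix (Fin 2) (Fin 2) ℂ := phaseMat (Real.pi / 2) * hMat

/-- `C^k Z(θ)` on `k + 1` qubits: the phase `exp(iθ)` on `|1…1⟩`, and `1` on the other basis
states. -/
def ctrlPhase (k : ℕ) (θ : ℝ) : Op (Fin (k + 1)) :=
  Matrix.diagonal fun x => if ∀ j, x j = 1 then Complex.exp (θ * Complex.I) else 1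

/-- The controlled-NOT gate; qubit `0` is the control and qubit `1` the target. -/
def cnotOp : Op (Fin 2) :=
  fun x y => if x 0 = y 0 ∧ x 1 = y 1 + y 0 then 1 else 0

/-- Names of elementary gates; `Gate k` are those acting on `k` qubits. -/
inductive Gate : ℕ → Type
  | X : Gate 1
  | Y : Gate 1
  | Z : Gate 1
  | H : Gate 1
  | K : Gate 1
  | S : Gate 1
  | Sdg : Gate 1
  | T : Gate 1
  | Tdg : Gate 1
  | CNOT : Gate 2
  | CZ : Gate 2
  | CCZ : Gate 3

/-- The unitary operator of an elementary gate. -/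
def Gate.op : {k : ℕ} → Gate k → Op (Fin k)
  | _, .X => localOp fun _ => xMat
  | _, .Y => localOp fun _ => yMat
  | _, .Z => localOp fun _ => zMat
  | _, .H => localOp fun _ => hMat
  | _, .K => localOp fun _ => kMat
  | _, .S => ctrlPhase 0 (Real.pi / 2)
  | _, .Sdg => ctrlPhase 0 (-(Real.pi / 2))
  | _, .T => ctrlPhase 0 (Real.pi / 4)
  | _, .Tdg => ctrlPhase 0 (-(Real.pi / 4))
  | _, .CNOT => cnotOp
  | _, .CZ => ctrlPhase 1 Real.pi
  | _, .CCZ => ctrlPhase 2 Real.pi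

/-- The gate library `{K, T, S, CZ, CCZ}`. -/
def Gate.InLibrary : {k : ℕ} → Gate k → Prop
  | _, .K => True
  | _, .T => True
  | _, .S => True
  | _, .CZ => True
  | _, .CCZ => True
  | _, _ => False

/-- An elementary gate together with the (distinct) qubits of a register it is applied to. -/
structure PlacedGate (ι : Type) where
  /-- number of qubits of the gate -/
  arity : ℕ
  /-- the gate -/
  gate : Gate arity
  /-- where it is applied -/
  wires : Fin arity ↪ ι

/-- A circuit; the head of the list is applied first. -/
abbrev Circuit (ι : Type) := List (PlacedGate ι)

section Circuits

variable {ι : Type} [Fintype ι] [DecidableEq ι]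

/-- The operator of a gate placed in a register. -/
def PlacedGate.op (g : PlacedGate ι) : Op ι := applyAt g.wires g.gate.op

/-- The qubits a placed gate acts on. -/
def PlacedGate.qubits (g : PlacedGate ι) : Finset ι := Finset.univ.map g.wires

/-- The operator computed by a circuit. -/
def Circuit.eval : Circuit ι → Op ι
  | [] => 1
  | g :: c => Circuit.eval c * g.op

/-- `F` is a possible single fault occurring right after the initial part `c₁` of a circuit: an
arbitrary error on one qubit of the register (before the first gate this is an error of the input),
or an arbitrary error on all the qubits of the gate that has just been applied. -/
def IsFault (c₁ : Circuit ι) (F : Op ι) : Prop :=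
  (∃ q : ι, SupportedOn {q} F) ∨ ∃ g ∈ c₁.getLast?, SupportedOn g.qubits F

end Circuits

/-- Universality of the library: for every `n`, every unitary on `n` qubits is, up to global
phases, a limit of circuits on these `n` qubits over the library. -/
def LibraryUniversal : Prop :=
  ∀ (n : ℕ) (U : Op (Fin n)), U ∈ Matrix.unitaryGroup (Fin n → Fin 2) ℂ →
    U ∈ closure {V : Op (Fin n) | ∃ (c : Circuit (Fin n)) (z : ℂ),
      (∀ g ∈ c, g.gate.InLibrary) ∧ ‖z‖ = 1 ∧ V = z • Circuit.eval c}

/-! ### Codes with one logical qubit -/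

/-- A pair of states `|0̄⟩, |1̄⟩` of the register `ι`, the logical basis of a code. -/
abbrev Enc (ι : Type) := Fin 2 → State ι

/-- A code with one logical qubit and `n` physical qubits, given by its logical basis. -/
structure Code where
  /-- number of physical qubits -/
  n : ℕ
  /-- logical basis states -/
  ket : Enc (Fin n)

section Codes

variable {ι : Type} [Fintype ι] [DecidableEq ι]

/-- The two states of the logical basis are orthonormal. -/
def IsEncoding (C : Enc ι) : Prop :=
  ∀ l l' : Fin 2, star (C l) ⬝ᵥ C l' = if l = l' then 1 else 0

/-- The encoding of `m` logical qubits into `m` blocks of the code. -/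
def blockEnc (m : ℕ) (C : Enc ι) : Matrix (Fin m × ι → Fin 2) (Fin m → Fin 2) ℂ :=
  fun x l => ∏ j, C (l j) (fun i => x (j, i))

/-- On encoded states of `m` blocks the physical operator `V` acts as the logical operator `G`,
up to a global phase. -/
def Implements (C : Enc ι) {m : ℕ} (V : Op (Fin m × ι)) (G : Op (Fin m)) : Prop :=
  ∃ z : ℂ, ‖z‖ = 1 ∧ V * blockEnc m C = z • (blockEnc m C * G)

/-- The logical operator `G` has a transversal implementation on the code. -/
def HasTransversal (C : Enc ι) {m : ℕ} (G : Op (Fin m)) : Prop :=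
  ∃ V : Op (Fin m × ι), Transversal V ∧ Implements C V G

/-! ### Stabilizers and error correction -/

/-- Labels of the single-qubit Pauli operators. -/
inductive Pauli : Type
  | I
  | X
  | Y
  | Z

/-- The matrix of a Pauli label. -/
def Pauli.mat : Pauli → Matrix (Fin 2) (Fin 2) ℂ
  | .I => 1
  | .X => xMat
  | .Y => yMat
  | .Z => zMat

/-- The tensor product of Pauli operators given by a string of labels. -/
def pauliOp (P : ι → Pauli) : Op ι := localOp fun i => (P i).mat

/-- A stabilizer error-correction procedure for a code: commuting signed Pauli operators that fix
the code are measured, and a Pauli correction depending only on the syndrome is applied. -/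
structure Decoder (C : Enc ι) where
  /-- number of measured operators -/
  r : ℕ
  /-- signs of the measured operators -/
  sign : Fin r → ℤˣ
  /-- the measured Pauli strings -/
  gen : Fin r → ι → Pauli
  commutes : ∀ i j, Commute (pauliOp (gen i)) (pauliOp (gen j))
  fixes : ∀ i l, (((sign i : ℤ) : ℂ) • pauliOp (gen i)) *ᵥ C l = C l
  /-- the correction applied for each syndrome -/
  correction : (Fin r → Fin 2) → ι → Pauli

/-- The (Kraus) operator of the procedure for the outcome `s`: the projection onto the joint
eigenspace in which the `i`-th measured operator has the eigenvalue `(-1)^(s i)`, followed by the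
correction. -/
def Decoder.recover {C : Enc ι} (D : Decoder C) (s : Fin D.r → Fin 2) : Op ι :=
  pauliOp (D.correction s) *
    (List.ofFn fun i => (1 / 2 : ℂ) •
      (1 + ((-1) ^ (s i : ℕ) * ((D.sign i : ℤ) : ℂ)) • pauliOp (D.gen i))).prod

/-- The procedure corrects the error `F`: whatever the outcome, every encoded state is restored,
up to a scalar that does not depend on the encoded state. -/
def Decoder.Corrects {C : Enc ι} (D : Decoder C) (F : Op ι) : Prop :=
  ∀ s, ∃ z : ℂ, ∀ l, (D.recover s * F) *ᵥ C l = z • C l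

/-- The procedure corrects an arbitrary error on an arbitrary single qubit. -/
def Decoder.CorrectsSingleErrors {C : Enc ι} (D : Decoder C) : Prop :=
  ∀ (q : ι) (F : Op ι), SupportedOn {q} F → D.Corrects F

/-- The circuit `c` on `m` blocks implements the logical gate `G`, and does so fault-tolerantly:
if one fault occurs anywhere (in the input or during the circuit), then error correction of each of
the blocks at the end leaves exactly the encoded output of `G`, whatever the syndromes. -/
def Decoder.FTImplements {C : Enc ι} (D : Decoder C) {m : ℕ} (c : Circuit (Fin m × ι))
    (G : Op (Fin m)) : Prop :=
  Implements C c.eval G ∧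
    ∀ c₁ c₂ : Circuit (Fin m × ι), c = c₁ ++ c₂ → ∀ F, IsFault c₁ F →
      ∀ s : Fin m → Fin D.r → Fin 2, ∃ z : ℂ,
        blockOp (fun j => D.recover (s j)) * (c₂.eval * F * c₁.eval) * blockEnc m C =
          z • (blockEnc m C * G)

/-- There is one error-correction procedure that corrects every single-qubit error and with
respect to which every gate of the library has a fault-tolerant implementation. -/
def SupportsFTLibrary (C : Enc ι) : Prop :=
  ∃ D : Decoder C, D.CorrectsSingleErrors ∧
    ∀ (m : ℕ) (g : Gate m), g.InLibrary →
      ∃ c : Circuit (Fin m × ι), D.FTImplements c g.op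

end Codes

/-! ### The codes -/

/-- The projection `(1 + P) / 2` for a Pauli string `P`. -/
def pauliProj {n : ℕ} (P : Fin n → Pauli) : Op (Fin n) := (1 / 2 : ℂ) • (1 + pauliOp P)

/-- The `5`-qubit code with stabilizer generators `XZZXI, IXZZX, XIXZZ, ZXIXZ`: its logical `|0⟩`
is the normalized projection of `|00000⟩` to the code space, and its logical `|1⟩` is
`X^{⊗5}` applied to the logical `|0⟩`. -/
def fiveCode : Code where
  n := 5
  ket l :=
    (localOp fun _ => xMat ^ (l : ℕ)) *ᵥ
      (((4 : ℂ) • (pauliProj ![.X, .Z, .Z, .X, .I] * pauliProj ![.I, .X, .Z, .Z, .X] *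
        pauliProj ![.X, .I, .X, .Z, .Z] * pauliProj ![.Z, .X, .I, .X, .Z])) *ᵥ Pi.single 0 1)

/-- The `5'`-qubit code: the image of the `5`-qubit code under `K₁ Y₃ K₅`
(the qubits are numbered `1, …, 5`; qubit `j` has the index `j - 1`). -/
def fivePrimeCode : Code where
  n := 5
  ket l := localOp ![kMat, 1, yMat, 1, kMat] *ᵥ fiveCode.ket l

/-- The `15`-qubit Reed–Muller code: the logical `|l⟩` is the uniform superposition of the
sixteen words `l + a₀ v₀ + a₁ v₁ + a₂ v₂ + a₃ v₃` modulo `2`, where `vᵢ` consists of the `i`-th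
binary digits of the numbers `1, …, 15`. -/
def rmCode : Code where
  n := 15
  ket l x := if ∃ a : Fin 4 → Fin 2, ∀ j : Fin 15,
      (x j : ℕ) = ((l : ℕ) + ∑ i : Fin 4, (a i : ℕ) * (((j : ℕ) + 1) / 2 ^ (i : ℕ) % 2)) % 2
    then 1 / 4 else 0

/-- A bare, unencoded qubit. -/
def bareQubit : Code where
  n := 1
  ket l := Pi.single (fun _ => l) 1

/-- The register of the concatenation in which qubit `q` of `C` is encoded by `c q`. -/
abbrev ConcatReg (C : Code) (c : Fin C.n → Code) : Type := Σ q : Fin C.n, Fin (c q).n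

/-- The (possibly non-uniform) concatenation: the logical qubit is encoded by `C`, and then each
qubit `q` of `C` is encoded by `c q`. -/
def concat (C : Code) (c : Fin C.n → Code) : Enc (ConcatReg C c) :=
  fun l x => ∑ y : Fin C.n → Fin 2, C.ket l y * ∏ q, (c q).ket (y q) (fun i => x ⟨q, i⟩)

/-- Second level of the non-uniform code: the qubits `1, 3, 5` are encoded by the Reed–Muller
code, and the qubits `2, 4` are left unencoded. -/
def nonUniformLevel : Fin fivePrimeCode.n → Code := ![rmCode, bareQubit, rmCode, bareQubit, rmCode]

/-- Second level of the uniform code: all qubits are encoded by the Reed–Muller code. -/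
def uniformLevel : Fin fivePrimeCode.n → Code := fun _ => rmCode

/-- The controlled-NOT gate on qubits of a block of the `5'`-qubit code. -/
def cnotFive (e : Fin 2 ↪ Fin 5) : Op (Fin 5) := applyAt e cnotOp

/-- The staircase: a controlled-NOT from qubit `1` to qubit `3` and then one from `3` to `5`. -/
def staircase : Op (Fin 5) :=
  cnotFive ⟨![2, 4], by decide⟩ * cnotFive ⟨![0, 2], by decide⟩

/-- The inverse staircase. -/
def staircaseInv : Op (Fin 5) :=
  cnotFive ⟨![0, 2], by decide⟩ * cnotFive ⟨![2, 4], by decide⟩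

/-- The embedding that selects the fifth qubit of each of `m` blocks. -/
def lastQubits (m : ℕ) : Fin m ↪ Fin m × Fin 5 := ⟨fun j => (j, 4), fun _ _ h => (Prod.ext_iff.1 h).1⟩

/-- The circuit for `C^k Z(θ)` on `k + 1` blocks of the `5'`-qubit code: a staircase in each block,
a physical `C^k Z(θ)` on the fifth qubits, and the inverse staircase in each block. -/
def phaseCircuit (k : ℕ) (θ : ℝ) : Op (Fin (k + 1) × Fin 5) :=
  blockOp (fun _ => staircaseInv) * applyAt (lastQubits (k + 1)) (ctrlPhase k θ) *
    blockOp (fun _ => staircase)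

end

end ConcatFT

open ConcatFT

/-!
The codes are stabilizer codes of distance 3, and everything about error correction and fault
tolerance follows from one fact about such codes: the measured operators can be taken to be all
signed Pauli strings that fix the code, and a family of Pauli errors can be corrected as soon as
the quotient of any two of them that have the same syndrome acts on the code as a scalar
(`exists_decoder`). That the two small codes have distance 3, in the form that a Pauli string on
two qubits that commutes with the stabilizer acts trivially, is checked directly
(`fivePrimeEnc_eq_one`, `rmEnc_eq_one`).

For a concatenated code the relevant errors (`concatErrors`) are those that are arbitrary on one of
the inner codes and touch at most one qubit of each of the other Reed–Muller blocks. A Pauli string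
that preserves an inner code acts on it as a logical Pauli operator, so the quotient of two errors
with the same syndrome is a Pauli string on the outer code which lives on at most two qubits; hence
one decoder corrects all these errors (`exists_decoder_concat`).

A single fault in a circuit spreads only to the qubits that are joined to it by gates. If each gate
of a circuit acts within one fibre of a map `f`, then the errors at the end are supported on one
fibre (`Decoder.ftImplements_of_isLocal`). The logical `K` of the outer code is bitwise, so it can be
implemented inside the inner codes, one by one, without any care about what happens inside
(`ftImplements_K`): every single-qubit gate has some circuit on the Reed–Muller code, which may
decode, apply the gate and encode again (`rmEnc_exists_circuit`). The diagonal gates of the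
outer code couple only the qubits that are encoded by the Reed–Muller code, and use gates that are
bitwise there, so a fault stays at one position of the Reed–Muller blocks (`ftImplements_phase`).
Encoded gates are composed by `applyAt_liftWires_mul_innerEnc`.

The library is universal because the closure of its circuits, up to phases, is a closed group of
unitaries, whose one-parameter subgroups form a real vector space by the Lie product formula
(`tendsto_exp_mul_exp_pow`). The product `T H T H` is a rotation by an angle which is an irrational
multiple of `π`, since twice its cosine is not an algebraic integer (`irrational_rotationAngle`).
This gives the generator `i Z` of a one-parameter subgroup on every qubit; conjugation by `H`, `S`
and `CZ` gives `i P` for all Pauli strings `P` (`pauliOp_mem_lieSpace`), and these span the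
skew-adjoint operators. Every unitary operator is a phase times the exponential of one of these.
-/


set_option linter.unusedSectionVars false

namespace ConcatFT

/-! ### Tensor products along a partition of the qubits -/

section Tensor

/-- The tensor product `⨂ q, A q` of a family of matrices, indexed by tuples of indices. -/
def tensor {Q : Type*} [Fintype Q] {R S : Q → Type*} (A : ∀ q, Matrix (R q) (S q) ℂ) :
    Matrix (∀ q, R q) (∀ q, S q) ℂ :=
  fun x y => ∏ q, A q (x q) (y q)

variable {Q : Type*} [Fintype Q] [DecidableEq Q]

theorem tensor_mul {R S T : Q → Type*} [∀ q, Fintype (S q)] (A : ∀ q, Matrix (R q) (S q) ℂ)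
    (B : ∀ q, Matrix (S q) (T q) ℂ) : tensor A * tensor B = tensor fun q => A q * B q := by
  ext x z
  simp only [tensor, Matrix.mul_apply, Finset.prod_univ_sum, Fintype.piFinset_univ,
    Finset.prod_mul_distrib]

theorem tensor_one {R : Q → Type*} [∀ q, DecidableEq (R q)] :
    tensor (fun q => (1 : Matrix (R q) (R q) ℂ)) = 1 := by
  ext x z
  simp only [tensor, Matrix.one_apply, funext_iff, Finset.prod_ite_zero]
  simp

theorem tensor_smul {R S : Q → Type*} (z : Q → ℂ) (A : ∀ q, Matrix (R q) (S q) ℂ) :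
    tensor (fun q => z q • A q) = (∏ q, z q) • tensor A := by
  ext x y
  simp [tensor, Finset.prod_mul_distrib]

theorem tensor_conjTranspose {R S : Q → Type*} (A : ∀ q, Matrix (R q) (S q) ℂ) :
    (tensor A)ᴴ = tensor fun q => (A q)ᴴ := by
  ext x y
  simp [tensor, Matrix.conjTranspose_apply]

variable {ι : Type} {R : Q → Type}

/-- Basis states of a register partitioned into pieces `R q`, as tuples of basis states of the
pieces. -/
def split (φ : (Σ q, R q) ≃ ι) : (ι → Fin 2) ≃ ∀ q, R q → Fin 2 where
  toFun x q r := x (φ ⟨q, r⟩)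
  invFun y i := y (φ.symm i).1 (φ.symm i).2
  left_inv x := by ext i; simp
  right_inv y := by
    funext q r
    have h : ∀ p : Σ q, R q, p = ⟨q, r⟩ → y p.1 p.2 = y q r := by rintro _ rfl; rfl
    exact h _ (φ.symm_apply_apply _)

/-- The tensor product, over the pieces of a partitioned register, of matrices whose rows are
indexed by the basis states of the pieces. -/
def tensorOn (φ : (Σ q, R q) ≃ ι) {S : Q → Type*} (A : ∀ q, Matrix (R q → Fin 2) (S q) ℂ) :
    Matrix (ι → Fin 2) (∀ q, S q) ℂ :=
  (tensor A).submatrix (split φ) id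

/-- The tensor product of operators on the pieces of a partitioned register. -/
def opOn (φ : (Σ q, R q) ≃ ι) (A : ∀ q, Op (R q)) : Op ι :=
  (tensor A).submatrix (split φ) (split φ)

variable [∀ q, Fintype (R q)] [∀ q, DecidableEq (R q)] [Fintype ι] [DecidableEq ι]

theorem opOn_mul (φ : (Σ q, R q) ≃ ι) (A B : ∀ q, Op (R q)) :
    opOn φ A * opOn φ B = opOn φ fun q => A q * B q := by
  rw [opOn, opOn, Matrix.submatrix_mul_equiv, tensor_mul]; rfl

theorem opOn_one (φ : (Σ q, R q) ≃ ι) : opOn φ (fun q => (1 : Op (R q))) = 1 := by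
  rw [opOn, tensor_one, Matrix.submatrix_one_equiv]

theorem opOn_mul_tensorOn (φ : (Σ q, R q) ≃ ι) {S : Q → Type*} (A : ∀ q, Op (R q))
    (B : ∀ q, Matrix (R q → Fin 2) (S q) ℂ) :
    opOn φ A * tensorOn φ B = tensorOn φ fun q => A q * B q := by
  rw [opOn, tensorOn, Matrix.submatrix_mul_equiv, tensor_mul]; rfl

theorem tensorOn_mul_tensor (φ : (Σ q, R q) ≃ ι) {S T : Q → Type*} [∀ q, Fintype (S q)]
    (A : ∀ q, Matrix (R q → Fin 2) (S q) ℂ) (B : ∀ q, Matrix (S q) (T q) ℂ) :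
    tensorOn φ A * tensor B = tensorOn φ fun q => A q * B q := by
  rw [tensorOn, tensorOn, ← tensor_mul]; rfl

theorem tensorOn_smul (φ : (Σ q, R q) ≃ ι) {S : Q → Type*} (z : Q → ℂ)
    (A : ∀ q, Matrix (R q → Fin 2) (S q) ℂ) :
    tensorOn φ (fun q => z q • A q) = (∏ q, z q) • tensorOn φ A := by
  rw [tensorOn, tensorOn, tensor_smul]; rfl

theorem tensorOn_conjTranspose_mul (φ : (Σ q, R q) ≃ ι) {S : Q → Type*}
    (A : ∀ q, Matrix (R q → Fin 2) (S q) ℂ) :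
    (tensorOn φ A)ᴴ * tensorOn φ A = tensor fun q => (A q)ᴴ * A q := by
  rw [tensorOn, Matrix.conjTranspose_submatrix, Matrix.submatrix_mul_equiv,
    tensor_conjTranspose, tensor_mul]; rfl

theorem localOp_eq_opOn (φ : (Σ q, R q) ≃ ι) (A : ι → Matrix (Fin 2) (Fin 2) ℂ) :
    localOp A = opOn φ fun q => localOp fun r => A (φ ⟨q, r⟩) := by
  ext x y
  simp only [localOp, opOn, tensor, Matrix.submatrix_apply, split, Equiv.coe_fn_mk]
  rw [← Fintype.prod_equiv φ _ _ (fun _ => rfl), Fintype.prod_sigma]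

/-- The qubits of a piece of a partitioned register. -/
def piece (φ : (Σ q, R q) ≃ ι) (q : Q) : R q ↪ ι :=
  ⟨fun r => φ ⟨q, r⟩, fun a b h => by simpa using h⟩

theorem applyAt_piece (φ : (Σ q, R q) ≃ ι) (q : Q) (G : Op (R q)) :
    applyAt (piece φ q) G = opOn φ (Function.update (fun q => (1 : Op (R q))) q G) := by
  ext x y
  have h : (∀ i, i ∉ Finset.univ.map (piece φ q) → x i = y i) ↔
      ∀ q' ∈ Finset.univ.erase q, split φ x q' = split φ y q' := by
    constructor
    · intro h q' hq'
      funext r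
      refine h (φ ⟨q', r⟩) ?_
      simp only [Finset.mem_map, Finset.mem_univ, true_and, not_exists]
      intro s hs
      have := φ.injective hs
      simp only [Sigma.mk.injEq] at this
      exact (Finset.ne_of_mem_erase hq') this.1.symm
    · intro h i hi
      obtain ⟨⟨q', r⟩, rfl⟩ := φ.surjective i
      refine congrFun (h q' (Finset.mem_erase.2 ⟨?_, Finset.mem_univ _⟩)) r
      rintro rfl
      exact hi (Finset.mem_map.2 ⟨r, Finset.mem_univ _, rfl⟩)
  simp only [applyAt, opOn, tensor, Matrix.submatrix_apply]
  rw [← Finset.mul_prod_erase _ _ (Finset.mem_univ q), Function.update_self,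
    Finset.prod_congr rfl (g := fun q' => if split φ x q' = split φ y q' then (1 : ℂ) else 0)
      (fun q' hq' => by rw [Function.update_of_ne (Finset.ne_of_mem_erase hq'), Matrix.one_apply]),
    Finset.prod_ite_zero]
  simp only [Finset.prod_const_one, h, mul_ite, mul_one, mul_zero]
  rfl

end Tensor

/-! ### Operators on a part of a register -/

section ApplyAt

variable {ι κ : Type} [Fintype ι] [DecidableEq ι] [Fintype κ] [DecidableEq κ]

theorem forall_notMem_map_iff (e : κ ↪ ι) (x y : ι → Fin 2) :
    (∀ i, i ∉ Finset.univ.map e → x i = y i) ↔ y = Function.extend e (y ∘ e) x := by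
  constructor
  · intro h
    ext i
    by_cases hi : ∃ k, e k = i
    · obtain ⟨k, rfl⟩ := hi
      rw [e.injective.extend_apply]; rfl
    · rw [Function.extend_apply' _ _ _ hi, h i (by simpa using hi)]
  · intro h i hi
    rw [h, Function.extend_apply' _ _ _ (by simpa using hi)]

theorem extend_comp_embedding {α : Type*} (e : κ ↪ ι) (u : κ → α) (x : ι → α) :
    Function.extend e u x ∘ e = u := by
  ext k; exact congrArg _ rfl |>.trans (e.injective.extend_apply _ _ _)

theorem applyAt_mul_apply {α : Type*} (e : κ ↪ ι) (V : Op κ) (M : Matrix (ι → Fin 2) α ℂ)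
    (x : ι → Fin 2) (a : α) :
    (applyAt e V * M) x a = ∑ u, V (x ∘ e) u * M (Function.extend e u x) a := by
  simp only [Matrix.mul_apply, applyAt, ite_mul, zero_mul]
  rw [← Finset.sum_filter]
  refine Finset.sum_nbij' (fun y => y ∘ e) (fun u => Function.extend e u x) ?_ ?_ ?_ ?_ ?_
  · simp
  · intro u _
    simp only [Finset.mem_filter, Finset.mem_univ, true_and]
    rw [forall_notMem_map_iff, extend_comp_embedding]
  · intro y hy
    simp only [Finset.mem_filter, Finset.mem_univ, true_and] at hy
    exact ((forall_notMem_map_iff e x y).1 hy).symm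
  · intro u _
    exact extend_comp_embedding e u x
  · intro y hy
    simp only [Finset.mem_filter, Finset.mem_univ, true_and] at hy
    rw [← (forall_notMem_map_iff e x y).1 hy]

theorem mul_applyAt_apply {α : Type*} (e : κ ↪ ι) (V : Op κ) (M : Matrix α (ι → Fin 2) ℂ)
    (x : ι → Fin 2) (a : α) :
    (M * applyAt e V) a x = ∑ u, M a (Function.extend e u x) * V u (x ∘ e) := by
  have h := applyAt_mul_apply e Vᵀ Mᵀ x a
  have ht : applyAt e Vᵀ = (applyAt e V)ᵀ := by
    ext y z
    simp only [applyAt, Matrix.transpose_apply, eq_comm]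
  rw [ht, ← Matrix.transpose_mul] at h
  simpa [mul_comm] using h

theorem applyAt_one (e : κ ↪ ι) : applyAt e (1 : Op κ) = 1 := by
  ext x y
  simp only [applyAt, Matrix.one_apply]
  rw [← ite_and]
  congr 1
  simp only [eq_iff_iff]
  constructor
  · rintro ⟨h, h'⟩
    rw [forall_notMem_map_iff] at h
    rw [h, ← h']
    ext i
    by_cases hi : ∃ k, e k = i
    · obtain ⟨k, rfl⟩ := hi
      rw [e.injective.extend_apply]; rfl
    · rw [Function.extend_apply' _ _ _ hi]
  · rintro rfl
    simp

theorem applyAt_mul (e : κ ↪ ι) (A B : Op κ) : applyAt e (A * B) = applyAt e A * applyAt e B := by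
  ext x z
  rw [applyAt_mul_apply]
  simp only [applyAt, Matrix.mul_apply, extend_comp_embedding]
  have h (u : κ → Fin 2) : (∀ i, i ∉ Finset.univ.map e → Function.extend e u x i = z i) ↔
      ∀ i, i ∉ Finset.univ.map e → x i = z i := by
    refine forall_congr' fun i => imp_congr_right fun hi => ?_
    rw [Function.extend_apply' _ _ _ (by simpa using hi)]
  simp only [h]
  split_ifs <;> simp

/-- Application to a part of a register, as a linear map. -/
def applyAtLinear (e : κ ↪ ι) : Op κ →ₗ[ℂ] Op ι where
  toFun := applyAt e
  map_add' A B := by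
    ext x y
    simp only [applyAt, Matrix.add_apply]
    split_ifs <;> simp
  map_smul' z A := by
    ext x y
    simp only [applyAt, Matrix.smul_apply, RingHom.id_apply]
    split_ifs <;> simp

theorem applyAt_smul (e : κ ↪ ι) (z : ℂ) (A : Op κ) : applyAt e (z • A) = z • applyAt e A :=
  (applyAtLinear e).map_smul z A

theorem applyAt_localOp (e : κ ↪ ι) (A : κ → Matrix (Fin 2) (Fin 2) ℂ) :
    applyAt e (localOp A) = localOp (Function.extend e A 1) := by
  ext x y
  simp only [applyAt, localOp]
  rw [← Finset.prod_mul_prod_compl (Finset.univ.map e), Finset.prod_map]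
  simp only [e.injective.extend_apply, Function.comp]
  rw [Finset.prod_congr rfl (s₁ := (Finset.univ.map e)ᶜ)
      (g := fun i => if x i = y i then (1 : ℂ) else 0) (fun i hi => by
        rw [Function.extend_apply' _ _ _ (by simpa using hi), Pi.one_apply, Matrix.one_apply]),
    Finset.prod_ite_zero]
  simp only [Finset.mem_compl, Finset.prod_const_one, mul_ite, mul_one, mul_zero]

theorem applyAt_applyAt {μ : Type} [Fintype μ] (e : κ ↪ ι) (f : μ ↪ κ) (G : Op μ) :
    applyAt e (applyAt f G) = applyAt (f.trans e) G := by
  ext x y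
  simp only [applyAt]
  rw [← ite_and]
  have : ((∀ i, i ∉ Finset.univ.map e → x i = y i) ∧
      ∀ i, i ∉ Finset.univ.map f → (x ∘ e) i = (y ∘ e) i) ↔
      ∀ i, i ∉ Finset.univ.map (f.trans e) → x i = y i := by
    constructor
    · rintro ⟨h, h'⟩ i hi
      by_cases hi' : ∃ k, e k = i
      · obtain ⟨k, rfl⟩ := hi'
        exact h' k (by simpa using hi)
      · exact h i (by simpa using hi')
    · intro h
      refine ⟨fun i hi => h i ?_, fun k hk => h (e k) (by simpa using hk)⟩
      simp only [Finset.mem_map, Finset.mem_univ, true_and, not_exists] at hi ⊢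
      exact fun m => hi (f m)
  simp only [this]
  rfl

end ApplyAt

/-! ### Pauli strings -/

namespace Pauli

/-- Whether a Pauli operator flips the qubit. -/
def flip : Pauli → Fin 2
  | I => 0
  | X => 1
  | Y => 1
  | Z => 0

/-- The nonzero entry of a Pauli operator in the given row. -/
def phase : Pauli → Fin 2 → GaussianInt
  | I, _ => 1
  | X, _ => 1
  | Y, 0 => ⟨0, -1⟩
  | Y, _ => ⟨0, 1⟩
  | Z, 0 => 1
  | Z, _ => -1

instance : DecidableEq Pauli
  | I, I | X, X | Y, Y | Z, Z => isTrue rfl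
  | I, X | I, Y | I, Z | X, I | X, Y | X, Z | Y, I | Y, X | Y, Z | Z, I | Z, X | Z, Y =>
    isFalse fun h => Pauli.noConfusion h

instance : Fintype Pauli := ⟨{I, X, Y, Z}, fun p => by cases p <;> decide⟩

instance : One Pauli := ⟨I⟩

/-- Multiplication of Pauli operators up to phases. -/
instance : Mul Pauli where
  mul
    | I, p => p
    | p, I => p
    | X, X | Y, Y | Z, Z => I
    | X, Y | Y, X => Z
    | X, Z | Z, X => Y
    | Y, Z | Z, Y => X

/-- The sign `±1` in `P Q = ± Q P`. -/
def commSign (P Q : Pauli) : ℤˣ := if P = 1 ∨ Q = 1 ∨ P = Q then 1 else -1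

theorem commSign_mul (P Q R : Pauli) : commSign P (Q * R) = commSign P Q * commSign P R := by
  revert P Q R; decide

theorem eq_one_of_commSign (P : Pauli) (h : ∀ Q, commSign Q P = 1) : P = 1 := by
  revert P; decide

theorem mat_one : (1 : Pauli).mat = 1 := rfl

theorem mat_apply (P : Pauli) (a b : Fin 2) :
    P.mat a b = if b = a + P.flip then ((P.phase a : GaussianInt) : ℂ) else 0 := by
  cases P <;> fin_cases a <;> fin_cases b <;>
    simp [mat, xMat, yMat, zMat, flip, phase, GaussianInt.toComplex_def]

theorem flip_mul (P Q : Pauli) : (P * Q).flip = P.flip + Q.flip := by revert P Q; decide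

theorem mat_mul_apply (P Q : Pauli) (a b : Fin 2) :
    (P.mat * Q.mat) a b =
      if b = a + P.flip + Q.flip then
        ((P.phase a * Q.phase (a + P.flip) : GaussianInt) : ℂ) else 0 := by
  rw [Matrix.mul_apply, Finset.sum_eq_single (a + P.flip)]
  · simp only [mat_apply, if_true, mul_ite, mul_zero, GaussianInt.toComplex_mul]
  · intro c _ hc
    rw [mat_apply, if_neg hc, zero_mul]
  · simp

theorem mat_mul (P Q : Pauli) : ∃ z : ℂ, P.mat * Q.mat = z • (P * Q).mat := by
  have h : ∀ P Q : Pauli, ∀ a, P.phase a * Q.phase (a + P.flip) =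
      P.phase 0 * Q.phase P.flip * star ((P * Q).phase 0) * (P * Q).phase a := by decide
  refine ⟨((P.phase 0 * Q.phase P.flip * star ((P * Q).phase 0) : GaussianInt) : ℂ), ?_⟩
  ext a b
  rw [mat_mul_apply, h, Matrix.smul_apply, mat_apply, flip_mul, add_assoc,
    GaussianInt.toComplex_mul, smul_eq_mul, mul_ite, mul_zero]

theorem mat_comm (P Q : Pauli) : P.mat * Q.mat = ((commSign P Q : ℤ) : ℂ) • (Q.mat * P.mat) := by
  have h : ∀ P Q : Pauli, ∀ a, P.phase a * Q.phase (a + P.flip) =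
      ((commSign P Q : ℤ) : GaussianInt) * (Q.phase a * P.phase (a + Q.flip)) := by decide
  ext a b
  rw [Matrix.smul_apply, mat_mul_apply, mat_mul_apply, h, GaussianInt.toComplex_mul, map_intCast,
    smul_eq_mul, mul_ite, mul_zero, add_right_comm]

theorem mat_sq (P : Pauli) : P.mat * P.mat = 1 := by
  have h : ∀ P : Pauli, ∀ a, P.phase a * P.phase (a + P.flip) = 1 ∧ a + P.flip + P.flip = a := by
    decide
  ext a b
  rw [mat_mul_apply, (h P a).1, (h P a).2, Matrix.one_apply, map_one]
  simp only [eq_comm]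

/-- The coefficient of a Pauli operator in the expansion of a `2 × 2` matrix. -/
noncomputable def coeff (A : Matrix (Fin 2) (Fin 2) ℂ) : Pauli → ℂ
  | I => (A 0 0 + A 1 1) / 2
  | X => (A 0 1 + A 1 0) / 2
  | Y => Complex.I * (A 0 1 - A 1 0) / 2
  | Z => (A 0 0 - A 1 1) / 2

theorem sum_coeff (A : Matrix (Fin 2) (Fin 2) ℂ) : ∑ P, coeff A P • P.mat = A := by
  have : (Finset.univ : Finset Pauli) = {I, X, Y, Z} := rfl
  rw [this]
  ext a b
  fin_cases a <;> fin_cases b <;>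
    simp [Matrix.sum_apply, coeff, mat, xMat, yMat, zMat] <;> ring_nf <;> simp <;> ring

theorem coeff_one (P : Pauli) : coeff 1 P = if P = 1 then 1 else 0 := by
  cases P <;> simp [coeff] <;> rfl

end Pauli

section Strings

variable {ι κ : Type} [Fintype ι] [DecidableEq ι] [Fintype κ] [DecidableEq κ]

theorem localOp_mul (A B : ι → Matrix (Fin 2) (Fin 2) ℂ) :
    localOp A * localOp B = localOp fun i => A i * B i :=
  tensor_mul A B

theorem localOp_one : localOp (fun _ : ι => (1 : Matrix (Fin 2) (Fin 2) ℂ)) = 1 :=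
  tensor_one

theorem localOp_smul (z : ι → ℂ) (A : ι → Matrix (Fin 2) (Fin 2) ℂ) :
    localOp (fun i => z i • A i) = (∏ i, z i) • localOp A :=
  tensor_smul z A

theorem pauliOp_one : pauliOp (1 : ι → Pauli) = 1 := localOp_one

theorem pauliOp_mul (P Q : ι → Pauli) : ∃ z : ℂ, pauliOp P * pauliOp Q = z • pauliOp (P * Q) := by
  choose z hz using fun i => Pauli.mat_mul (P i) (Q i)
  refine ⟨∏ i, z i, ?_⟩
  rw [pauliOp, pauliOp, localOp_mul, pauliOp, ← localOp_smul]
  simp only [hz, Pi.mul_apply]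

theorem pauliOp_sq (P : ι → Pauli) : pauliOp P * pauliOp P = 1 := by
  rw [pauliOp, localOp_mul]
  simp only [Pauli.mat_sq]
  exact localOp_one

/-- The sign `±1` in `P Q = ± Q P` for Pauli strings. -/
def commSign (P Q : ι → Pauli) : ℤˣ := ∏ i, Pauli.commSign (P i) (Q i)

theorem commSign_mul (P Q R : ι → Pauli) : commSign P (Q * R) = commSign P Q * commSign P R := by
  simp only [commSign, Pi.mul_apply, Pauli.commSign_mul, Finset.prod_mul_distrib]

theorem pauliOp_comm (P Q : ι → Pauli) :
    pauliOp P * pauliOp Q = ((commSign P Q : ℤ) : ℂ) • (pauliOp Q * pauliOp P) := by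
  simp only [pauliOp, localOp_mul, commSign]
  have : ((((∏ i, Pauli.commSign (P i) (Q i) : ℤˣ)) : ℤ) : ℂ) =
      ∏ i, ((Pauli.commSign (P i) (Q i) : ℤ) : ℂ) := by
    push_cast; rfl
  rw [this, ← localOp_smul]
  simp only [← Pauli.mat_comm]

theorem pauliOp_mulVec_apply (P : ι → Pauli) (v : State ι) (x : ι → Fin 2) :
    (pauliOp P *ᵥ v) x =
      (∏ i, (((P i).phase (x i) : GaussianInt) : ℂ)) * v fun i => x i + (P i).flip := by
  simp only [Matrix.mulVec, dotProduct, pauliOp, localOp, Pauli.mat_apply, Finset.prod_ite_zero]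
  simp only [Finset.mem_univ, true_imp_iff, ← funext_iff (f := _) (g := fun i => x i + (P i).flip),
    ite_mul, zero_mul, Finset.sum_ite_eq', if_true]

/-- The span of the Pauli strings that are trivial outside `A`. -/
def pauliSpan (A : Set ι) : Submodule ℂ (Op ι) :=
  Submodule.span ℂ {M | ∃ P : ι → Pauli, (∀ i, i ∉ A → P i = 1) ∧ M = pauliOp P}

theorem pauliSpan_mono {A B : Set ι} (h : A ⊆ B) : pauliSpan A ≤ pauliSpan B :=
  Submodule.span_mono fun _ ⟨P, hP, hM⟩ => ⟨P, fun i hi => hP i fun h' => hi (h h'), hM⟩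

theorem pauliSpan_mul_mem {A : Set ι} {M N : Op ι} (hM : M ∈ pauliSpan A) (hN : N ∈ pauliSpan A) :
    M * N ∈ pauliSpan A := by
  have h := Submodule.mul_mem_mul hM hN
  rw [pauliSpan, Submodule.span_mul_span] at h
  refine Submodule.span_le.2 ?_ h
  rintro _ ⟨_, ⟨P, hP, rfl⟩, _, ⟨Q, hQ, rfl⟩, rfl⟩
  obtain ⟨z, hz⟩ := pauliOp_mul P Q
  simp only [hz]
  refine Submodule.smul_mem _ _ (Submodule.subset_span ⟨_, fun i hi => ?_, rfl⟩)
  rw [Pi.mul_apply, hP i hi, hQ i hi]; rfl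

theorem commute_of_mem_pauliSpan {A : Set ι} {M N : Op ι} (hM : M ∈ pauliSpan A)
    (hN : N ∈ pauliSpan Aᶜ) : Commute M N := by
  induction hM using Submodule.span_induction with
  | zero => exact Commute.zero_left _
  | add _ _ _ _ h₁ h₂ => exact h₁.add_left h₂
  | smul z _ _ h => exact h.smul_left z
  | mem _ h =>
    obtain ⟨P, hP, rfl⟩ := h
    induction hN using Submodule.span_induction with
    | zero => exact Commute.zero_right _
    | add _ _ _ _ h₁ h₂ => exact h₁.add_right h₂
    | smul z _ _ h => exact h.smul_right z
    | mem _ h =>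
      obtain ⟨Q, hQ, rfl⟩ := h
      have : commSign P Q = 1 := Finset.prod_eq_one fun i _ => by
        by_cases hi : i ∈ A
        · rw [hQ i (by simpa using hi)]; simp [Pauli.commSign]
        · rw [hP i hi]; simp [Pauli.commSign]
      rw [Commute, SemiconjBy, pauliOp_comm, this]; simp

theorem localOp_mem_pauliSpan {A : Set ι} (B : ι → Matrix (Fin 2) (Fin 2) ℂ)
    (hB : ∀ i, i ∉ A → B i = 1) : localOp B ∈ pauliSpan A := by
  have : localOp B = ∑ P : ι → Pauli, (∏ i, Pauli.coeff (B i) (P i)) • pauliOp P := by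
    ext x y
    simp only [localOp, Matrix.sum_apply, Matrix.smul_apply, pauliOp, smul_eq_mul,
      ← Finset.prod_mul_distrib]
    rw [← Fintype.piFinset_univ, ← Finset.prod_univ_sum (fun _ => Finset.univ)
      (fun i p => Pauli.coeff (B i) p * p.mat (x i) (y i))]
    refine Finset.prod_congr rfl fun i _ => ?_
    conv_lhs => rw [← Pauli.sum_coeff (B i)]
    simp [Matrix.sum_apply]
  rw [this]
  refine Submodule.sum_mem _ fun P _ => ?_
  by_cases hP : ∀ i, i ∉ A → P i = 1
  · exact Submodule.smul_mem _ _ (Submodule.subset_span ⟨P, hP, rfl⟩)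
  · push Not at hP
    obtain ⟨i, hi, hP⟩ := hP
    rw [Finset.prod_eq_zero (Finset.mem_univ i), zero_smul]
    · exact Submodule.zero_mem _
    · rw [hB i hi, Pauli.coeff_one, if_neg hP]

theorem applyAt_mem_pauliSpan (e : κ ↪ ι) (G : Op κ) : applyAt e G ∈ pauliSpan (Set.range e) := by
  change applyAtLinear e G ∈ _
  rw [Matrix.matrix_eq_sum_single G]
  simp only [map_sum]
  refine Submodule.sum_mem _ fun x _ => Submodule.sum_mem _ fun y _ => ?_
  have : Matrix.single x y (G x y) =
      G x y • localOp fun k => Matrix.single (x k) (y k) (1 : ℂ) := by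
    ext u v
    simp only [Matrix.single_apply, Matrix.smul_apply, localOp, Finset.prod_ite_zero,
      Finset.prod_const_one, smul_eq_mul, mul_ite, mul_one, mul_zero, funext_iff, forall_and,
      Finset.mem_univ, true_imp_iff]
  rw [this, map_smul]
  refine Submodule.smul_mem _ _ ?_
  change applyAt e _ ∈ _
  rw [applyAt_localOp]
  refine localOp_mem_pauliSpan _ fun i hi => ?_
  rw [Function.extend_apply' _ _ _ (by simpa using hi)]; rfl

theorem SupportedOn.mem_pauliSpan {A : Finset ι} {F : Op ι} (h : SupportedOn A F) :
    F ∈ pauliSpan (A : Set ι) := by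
  obtain ⟨G, rfl⟩ := h
  refine pauliSpan_mono ?_ (applyAt_mem_pauliSpan _ G)
  rintro _ ⟨a, rfl⟩
  exact a.2

end Strings

/-! ### Stabilizers and the existence of error-correction procedures -/

section Decoding

variable {ι : Type} [Fintype ι] [DecidableEq ι]

/-- The signed Pauli string `σ P` fixes the code `C`. -/
def Stabilizes (C : Enc ι) (σ : ℤˣ) (P : ι → Pauli) : Prop :=
  ∀ l, (((σ : ℤ) : ℂ) • pauliOp P) *ᵥ C l = C l

/-- `P` commutes with every Pauli string that fixes the code up to a sign. -/
def InNormalizer (C : Enc ι) (P : ι → Pauli) : Prop :=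
  ∀ σ Q, Stabilizes C σ Q → commSign Q P = 1

theorem units_mul_self_cast (σ : ℤˣ) : ((σ : ℤ) : ℂ) * ((σ : ℤ) : ℂ) = 1 := by
  rw [← Int.cast_mul, ← Units.val_mul, Int.units_mul_self]; simp

theorem Stabilizes.mulVec {C : Enc ι} {σ : ℤˣ} {P : ι → Pauli} (h : Stabilizes C σ P) (l : Fin 2) :
    pauliOp P *ᵥ C l = ((σ : ℤ) : ℂ) • C l := by
  conv_rhs => rw [← h l, Matrix.smul_mulVec, smul_smul, units_mul_self_cast, one_smul]

theorem Stabilizes.commute {C : Enc ι} (hC : C 0 ≠ 0) {σ τ : ℤˣ} {P Q : ι → Pauli}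
    (hP : Stabilizes C σ P) (hQ : Stabilizes C τ Q) : Commute (pauliOp P) (pauliOp Q) := by
  rcases Int.units_eq_one_or (commSign P Q) with h | h
  · rw [Commute, SemiconjBy, pauliOp_comm, h]; simp
  · exfalso
    have h₁ := congrArg (· *ᵥ C 0) (pauliOp_comm P Q)
    simp only [h, Matrix.smul_mulVec, ← Matrix.mulVec_mulVec, hP.mulVec, hQ.mulVec,
      Matrix.mulVec_smul, smul_smul] at h₁
    have h₂ : (((σ : ℤ) : ℂ) * ((τ : ℤ) : ℂ)) ≠ 0 := by
      simp
    rw [← sub_eq_zero, ← sub_smul] at h₁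
    rcases smul_eq_zero.1 h₁ with h₃ | h₃
    · apply h₂
      push_cast at h₃
      linear_combination h₃ / 2
    · exact hC h₃

theorem IsEncoding.ne_zero {C : Enc ι} (hC : IsEncoding C) (l : Fin 2) : C l ≠ 0 := by
  intro h
  have := hC l l
  simp [h] at this

theorem list_prod_mulVec_eq_self {v : State ι} (L : List (Op ι)) (h : ∀ M ∈ L, M *ᵥ v = v) :
    L.prod *ᵥ v = v := by
  induction L with
  | nil => simp
  | cons M L ih =>
    rw [List.prod_cons, ← Matrix.mulVec_mulVec, ih fun N hN => h N (List.mem_cons_of_mem _ hN),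
      h M List.mem_cons_self]

theorem list_prod_mulVec_eq_zero {v : State ι} (L : List (Op ι))
    (h : ∀ M ∈ L, M *ᵥ v = v ∨ M *ᵥ v = 0) (h' : ∃ M ∈ L, M *ᵥ v = 0) : L.prod *ᵥ v = 0 := by
  induction L with
  | nil => simp at h'
  | cons M L ih =>
    rw [List.prod_cons, ← Matrix.mulVec_mulVec]
    by_cases hL : ∃ N ∈ L, N *ᵥ v = 0
    · rw [ih (fun N hN => h N (List.mem_cons_of_mem _ hN)) hL, Matrix.mulVec_zero]
    · rw [list_prod_mulVec_eq_self L fun N hN =>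
        (h N (List.mem_cons_of_mem _ hN)).resolve_right fun h₀ => hL ⟨N, hN, h₀⟩]
      obtain ⟨N, hN, h₀⟩ := h'
      rcases List.mem_cons.1 hN with rfl | hN
      · exact h₀
      · exact absurd ⟨N, hN, h₀⟩ hL

/-- The measured projections act on `E |ψ⟩`, for a Pauli error `E` and an encoded state `ψ`, by
`1` or `0`, according to whether the outcome is the syndrome of `E`. -/
theorem syndromeProj_mulVec {C : Enc ι} {σ : ℤˣ} {P : ι → Pauli} (h : Stabilizes C σ P)
    (E : ι → Pauli) (b : Fin 2) (l : Fin 2) :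
    ((1 / 2 : ℂ) • (1 + ((-1) ^ (b : ℕ) * ((σ : ℤ) : ℂ)) • pauliOp P)) *ᵥ (pauliOp E *ᵥ C l) =
      if (-1) ^ (b : ℕ) * commSign P E = 1 then pauliOp E *ᵥ C l else 0 := by
  have h₁ : pauliOp P *ᵥ (pauliOp E *ᵥ C l) =
      (((commSign P E : ℤ) : ℂ) * ((σ : ℤ) : ℂ)) • (pauliOp E *ᵥ C l) := by
    rw [Matrix.mulVec_mulVec, pauliOp_comm, Matrix.smul_mulVec, ← Matrix.mulVec_mulVec, h.mulVec,
      Matrix.mulVec_smul, smul_smul]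
  have h₂ : ((-1) ^ (b : ℕ) * ((σ : ℤ) : ℂ)) * (((commSign P E : ℤ) : ℂ) * ((σ : ℤ) : ℂ)) =
      (((-1) ^ (b : ℕ) * commSign P E : ℤˣ) : ℤ) := by
    push_cast
    linear_combination ((-1) ^ (b : ℕ) * ((commSign P E : ℤ) : ℂ)) * units_mul_self_cast σ
  rw [Matrix.smul_mulVec, Matrix.add_mulVec, Matrix.smul_mulVec, h₁, smul_smul, h₂,
    Matrix.one_mulVec]
  rcases Int.units_eq_one_or ((-1) ^ (b : ℕ) * commSign P E) with h₃ | h₃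
  · rw [h₃, if_pos rfl, Units.val_one, Int.cast_one, one_smul, ← two_smul ℂ, smul_smul]
    norm_num
  · rw [h₃, if_neg (by decide)]
    simp

/-- A set of Pauli errors is correctable if the product of any two of them that cannot be
distinguished by the stabilizer acts trivially on the code. The procedure measures the whole
stabilizer, and applies some error of the set that has the observed syndrome. -/
theorem exists_decoder {C : Enc ι} (hC : IsEncoding C) (𝓔 : Set (ι → Pauli))
    (h : ∀ E ∈ 𝓔, ∀ E' ∈ 𝓔, InNormalizer C (E * E') →
      ∃ z : ℂ, ∀ l, pauliOp (E * E') *ᵥ C l = z • C l) :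
    ∃ D : Decoder C, ∀ E ∈ 𝓔, D.Corrects (pauliOp E) := by
  classical
  let J := {p : ℤˣ × (ι → Pauli) // Stabilizes C p.1 p.2}
  let e : Fin (Fintype.card J) ≃ J := (Fintype.equivFin J).symm
  let Syn (s : Fin (Fintype.card J) → Fin 2) (E : ι → Pauli) : Prop :=
    ∀ i, (-1) ^ (s i : ℕ) * commSign (e i).1.2 E = 1
  let D : Decoder C :=
    { r := Fintype.card J
      sign := fun i => (e i).1.1
      gen := fun i => (e i).1.2
      commutes := fun i j => (e i).2.commute (hC.ne_zero 0) (e j).2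
      fixes := fun i => (e i).2
      correction := fun s => if hs : ∃ E ∈ 𝓔, Syn s E then hs.choose else 1 }
  refine ⟨D, fun E hE s => ?_⟩
  by_cases hs : Syn s E
  · have hs' : ∃ E ∈ 𝓔, Syn s E := ⟨E, hE, hs⟩
    have hcorr : D.correction s = hs'.choose := dif_pos hs'
    obtain ⟨hE', hsE'⟩ := hs'.choose_spec
    rw [← hcorr] at hE' hsE'
    have hn : InNormalizer C (D.correction s * E) := by
      intro σ Q hQ
      obtain ⟨i, hi⟩ := e.surjective ⟨(σ, Q), hQ⟩
      have h₁ := hs i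
      have h₂ := hsE' i
      rw [hi] at h₁ h₂
      rw [commSign_mul]
      have h₃ : commSign Q (D.correction s) = commSign Q E :=
        mul_left_cancel (h₂.trans h₁.symm)
      rw [h₃, Int.units_mul_self]
    obtain ⟨z, hz⟩ := h _ hE' _ hE hn
    obtain ⟨w, hw⟩ := pauliOp_mul (D.correction s) E
    refine ⟨w * z, fun l => ?_⟩
    rw [Decoder.recover, ← Matrix.mulVec_mulVec, ← Matrix.mulVec_mulVec,
      list_prod_mulVec_eq_self, Matrix.mulVec_mulVec, hw, Matrix.smul_mulVec, hz, smul_smul]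
    intro M hM
    obtain ⟨i, rfl⟩ := (List.mem_ofFn' _ _).1 hM
    rw [syndromeProj_mulVec (e i).2, if_pos (hs i)]
  · refine ⟨0, fun l => ?_⟩
    rw [Decoder.recover, ← Matrix.mulVec_mulVec, ← Matrix.mulVec_mulVec,
      list_prod_mulVec_eq_zero, Matrix.mulVec_zero, zero_smul]
    · intro M hM
      obtain ⟨i, rfl⟩ := (List.mem_ofFn' _ _).1 hM
      rw [syndromeProj_mulVec (e i).2]
      split_ifs <;> simp
    · obtain ⟨i, hi⟩ := not_forall.1 hs
      refine ⟨_, (List.mem_ofFn' _ _).2 ⟨i, rfl⟩, ?_⟩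
      rw [syndromeProj_mulVec (e i).2, if_neg hi]

theorem Decoder.correctsSingleErrors {C : Enc ι} (D : Decoder C)
    (h : ∀ (q : ι) (P : ι → Pauli), (∀ i, i ≠ q → P i = 1) → D.Corrects (pauliOp P)) :
    D.CorrectsSingleErrors := by
  intro q F hF
  replace hF := hF.mem_pauliSpan
  induction hF using Submodule.span_induction with
  | zero => exact fun s => ⟨0, fun l => by simp⟩
  | add A B _ _ hA hB =>
    intro s
    obtain ⟨z, hz⟩ := hA s
    obtain ⟨w, hw⟩ := hB s
    exact ⟨z + w, fun l => by rw [Matrix.mul_add, Matrix.add_mulVec, hz, hw, add_smul]⟩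
  | smul a A _ hA =>
    intro s
    obtain ⟨z, hz⟩ := hA s
    exact ⟨a * z, fun l => by
      rw [Matrix.mul_smul, Matrix.smul_mulVec, hz, smul_smul]⟩
  | mem _ h₀ =>
    obtain ⟨P, hP, rfl⟩ := h₀
    exact h q P fun i hi => hP i (by simpa using hi)

end Decoding

/-! ### Circuits and propagation of faults -/

section Faults

variable {ι : Type} [Fintype ι] [DecidableEq ι]

theorem Circuit.eval_append (c₁ c₂ : Circuit ι) :
    Circuit.eval (c₁ ++ c₂) = Circuit.eval c₂ * Circuit.eval c₁ := by
  induction c₁ with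
  | nil => simp [Circuit.eval]
  | cons g c ih => rw [List.cons_append, Circuit.eval, ih, Circuit.eval, Matrix.mul_assoc]

theorem inv_sqrt_two_mul_self :
    ((Real.sqrt 2 : ℝ) : ℂ)⁻¹ * ((Real.sqrt 2 : ℝ) : ℂ)⁻¹ = 1 / 2 := by
  rw [← mul_inv, ← Complex.ofReal_mul, Real.mul_self_sqrt (by norm_num)]; norm_num

theorem hMat_mul_self : hMat * hMat = 1 := by
  ext a b
  fin_cases a <;> fin_cases b <;>
    simp [hMat, Matrix.mul_apply, Fin.sum_univ_two, inv_sqrt_two_mul_self] <;> norm_num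

theorem phaseMat_mul (θ η : ℝ) : phaseMat θ * phaseMat η = phaseMat (θ + η) := by
  ext a b
  fin_cases a <;> fin_cases b <;>
    simp [phaseMat, Matrix.mul_apply, Fin.sum_univ_two, ← Complex.exp_add, add_mul]

theorem phaseMat_zero : phaseMat 0 = 1 := by
  ext a b
  fin_cases a <;> fin_cases b <;> simp [phaseMat]

theorem ctrlPhase_mul (k : ℕ) (θ η : ℝ) :
    ctrlPhase k θ * ctrlPhase k η = ctrlPhase k (θ + η) := by
  rw [ctrlPhase, ctrlPhase, Matrix.diagonal_mul_diagonal, ctrlPhase]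
  congr 1
  ext x
  split_ifs <;> simp [← Complex.exp_add, add_mul]

theorem ctrlPhase_zero (k : ℕ) : ctrlPhase k 0 = 1 := by
  simp [ctrlPhase]

theorem localOp_inverse {A B : Matrix (Fin 2) (Fin 2) ℂ} (h : B * A = 1) :
    (localOp fun _ : ι => B) * (localOp fun _ : ι => A) = 1 := by
  rw [localOp_mul, h, localOp_one]

theorem cnotOp_mul_self : cnotOp * cnotOp = 1 := by
  have h : ∀ x z : Fin 2 → Fin 2, (∑ y : Fin 2 → Fin 2, (if x 0 = y 0 ∧ x 1 = y 1 + y 0 then 1 else 0) *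
      (if y 0 = z 0 ∧ y 1 = z 1 + z 0 then 1 else 0)) = (if x = z then 1 else 0 : ℤ) := by decide
  ext x z
  rw [Matrix.mul_apply, Matrix.one_apply]
  simp only [cnotOp]
  exact_mod_cast h x z

theorem Gate.exists_inverse {k : ℕ} (g : Gate k) : ∃ V : Op (Fin k), V * g.op = 1 := by
  cases g
  case X => exact ⟨_, localOp_inverse (Pauli.mat_sq .X)⟩
  case Y => exact ⟨_, localOp_inverse (Pauli.mat_sq .Y)⟩
  case Z => exact ⟨_, localOp_inverse (Pauli.mat_sq .Z)⟩
  case H => exact ⟨_, localOp_inverse hMat_mul_self⟩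
  case K =>
    refine ⟨_, localOp_inverse (B := hMat * phaseMat (-(Real.pi / 2))) ?_⟩
    rw [kMat, Matrix.mul_assoc, ← Matrix.mul_assoc (phaseMat _), phaseMat_mul, neg_add_cancel,
      phaseMat_zero, Matrix.one_mul, hMat_mul_self]
  case CNOT => exact ⟨_, cnotOp_mul_self⟩
  all_goals exact ⟨ctrlPhase _ (-_), by
    rw [Gate.op, ctrlPhase_mul, neg_add_cancel, ctrlPhase_zero]⟩

theorem Gate.arity_pos {k : ℕ} (g : Gate k) : 0 < k := by
  cases g <;> norm_num

/-- A circuit each of whose gates acts within a single fibre of `f`. -/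
def Circuit.IsLocal {κ : Type*} (f : ι → κ) (c : Circuit ι) : Prop :=
  ∀ g ∈ c, ∀ a b, f (g.wires a) = f (g.wires b)

/-- Errors confined to a fibre stay in it when they are moved past gates that act within fibres. -/
theorem exists_propagated {κ : Type*} {f : ι → κ} {c : Circuit ι} (hc : c.IsLocal f) (k : κ)
    {F : Op ι} (hF : F ∈ pauliSpan (f ⁻¹' {k})) :
    ∃ W ∈ pauliSpan (f ⁻¹' {k}), c.eval * F = W * c.eval := by
  induction c generalizing F with
  | nil => exact ⟨F, hF, by simp [Circuit.eval]⟩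
  | cons g c ih =>
    have ih := fun {F : Op ι} => @ih (fun g' hg' => hc g' (List.mem_cons_of_mem _ hg')) F
    obtain ⟨F', hF', h⟩ : ∃ F' ∈ pauliSpan (f ⁻¹' {k}), g.op * F = F' * g.op := by
      by_cases hg : ∃ a, f (g.wires a) = k
      · obtain ⟨a, ha⟩ := hg
        have hr : Set.range g.wires ⊆ f ⁻¹' {k} := by
          rintro _ ⟨b, rfl⟩
          rw [Set.mem_preimage, hc g List.mem_cons_self b a, ha]; rfl
        obtain ⟨V, hV⟩ := g.gate.exists_inverse
        refine ⟨g.op * F * applyAt g.wires V, pauliSpan_mul_mem (pauliSpan_mul_mem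
          (pauliSpan_mono hr (applyAt_mem_pauliSpan _ _)) hF)
          (pauliSpan_mono hr (applyAt_mem_pauliSpan _ _)), ?_⟩
        rw [Matrix.mul_assoc (g.op * F), PlacedGate.op, ← applyAt_mul, hV, applyAt_one,
          Matrix.mul_one]
      · refine ⟨F, hF, (commute_of_mem_pauliSpan hF (pauliSpan_mono ?_
          (applyAt_mem_pauliSpan g.wires g.gate.op))).eq.symm⟩
        rintro _ ⟨b, rfl⟩ hb
        exact hg ⟨b, hb⟩
    obtain ⟨W, hW, h'⟩ := ih hF'
    refine ⟨W, hW, ?_⟩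
    rw [Circuit.eval, Matrix.mul_assoc, h, ← Matrix.mul_assoc, h', Matrix.mul_assoc]

theorem IsFault.exists_mem_pauliSpan {κ : Type*} {f : ι → κ} {c : Circuit ι} (hc : c.IsLocal f)
    {F : Op ι} (hF : IsFault c F) : ∃ k, F ∈ pauliSpan (f ⁻¹' {k}) := by
  rcases hF with ⟨q, hq⟩ | ⟨g, hg, hF⟩
  · exact ⟨f q, pauliSpan_mono (by simp) hq.mem_pauliSpan⟩
  · refine ⟨f (g.wires ⟨0, g.gate.arity_pos⟩), pauliSpan_mono ?_ hF.mem_pauliSpan⟩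
    intro i hi
    obtain ⟨a, _, rfl⟩ := Finset.mem_map.1 (Finset.mem_coe.1 hi)
    exact hc g (List.mem_of_getLast? hg) a _

/-- The logical basis of a code as the columns of a matrix. -/
def encMat (C : Enc ι) : Matrix (ι → Fin 2) (Fin 2) ℂ := fun x l => C l x

theorem mul_encMat_eq_iff (C C' : Enc ι) (V : Op ι) (z : ℂ) :
    V * encMat C = z • encMat C' ↔ ∀ l, V *ᵥ C l = z • C' l := by
  constructor
  · intro h l
    ext x
    exact congrFun (congrFun h x) l
  · intro h
    ext x l
    exact congrFun (h l) x

/-- A circuit that is local with respect to a partition of the qubits is fault tolerant if the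
procedure corrects the Pauli strings supported on the parts. -/
theorem Decoder.ftImplements_of_isLocal {C : Enc ι} (D : Decoder C) {m : ℕ}
    {c : Circuit (Fin m × ι)} {G : Op (Fin m)} (hG : Implements C c.eval G) {κ : Type*}
    {f : Fin m × ι → κ} (hc : c.IsLocal f)
    (hf : ∀ (k : κ) (P : Fin m × ι → Pauli), (∀ x, f x ≠ k → P x = 1) →
      ∀ j, D.Corrects (pauliOp fun i => P (j, i))) : D.FTImplements c G := by
  refine ⟨hG, fun c₁ c₂ hcc F hF s => ?_⟩
  subst hcc
  obtain ⟨k, hk⟩ := hF.exists_mem_pauliSpan (f := f) fun g hg => hc g (List.mem_append_left _ hg)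
  obtain ⟨W, hW, h⟩ := exists_propagated (c := c₂) (fun g hg => hc g (List.mem_append_right _ hg))
    k hk
  have hrec : ∃ z : ℂ, blockOp (fun j => D.recover (s j)) * W * blockEnc m C =
      z • blockEnc m C := by
    clear h
    induction hW using Submodule.span_induction with
    | zero => exact ⟨0, by simp⟩
    | add A B _ _ hA hB =>
      obtain ⟨z, hz⟩ := hA
      obtain ⟨w, hw⟩ := hB
      exact ⟨z + w, by rw [Matrix.mul_add, Matrix.add_mul, hz, hw, add_smul]⟩
    | smul a A _ hA =>
      obtain ⟨z, hz⟩ := hA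
      exact ⟨a * z, by rw [Matrix.mul_smul, Matrix.smul_mul, hz, smul_smul]⟩
    | mem _ h₀ =>
      obtain ⟨P, hP, rfl⟩ := h₀
      choose z hz using fun j => hf k P (fun x hx => hP x hx) j (s j)
      refine ⟨∏ j, z j, ?_⟩
      let φ := Equiv.sigmaEquivProd (Fin m) ι
      have h₁ : pauliOp P = opOn φ fun j => pauliOp fun i => P (j, i) :=
        localOp_eq_opOn φ fun x => (P x).mat
      have h₂ : blockEnc m C = tensorOn φ fun _ => encMat C := rfl
      have h₃ : blockOp (fun j => D.recover (s j)) = opOn φ fun j => D.recover (s j) := rfl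
      rw [h₁, h₂, h₃, opOn_mul, opOn_mul_tensorOn, ← tensorOn_smul]
      congr 1
      funext j
      exact (mul_encMat_eq_iff _ _ _ _).2 (hz j)
  obtain ⟨z, hz⟩ := hrec
  obtain ⟨w, -, hw⟩ := hG
  refine ⟨w * z, ?_⟩
  rw [Circuit.eval_append] at hw
  rw [h]
  calc _ = blockOp (fun j => D.recover (s j)) * W * (c₂.eval * c₁.eval * blockEnc m C) := by
        simp only [Matrix.mul_assoc]
    _ = w • (blockOp (fun j => D.recover (s j)) * W * blockEnc m C * G) := by
        rw [hw, Matrix.mul_smul, Matrix.mul_assoc _ (blockEnc m C)]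
    _ = _ := by rw [hz, Matrix.smul_mul, smul_smul]

end Faults

/-! ### Amplitudes in the Gaussian integers -/

section Gaussian

variable {ι : Type} [Fintype ι] [DecidableEq ι]

/-- A state whose amplitudes are Gaussian integers. -/
noncomputable def gaussState (g : (ι → Fin 2) → GaussianInt) : State ι := fun x => (g x : ℂ)

/-- The action of a Pauli string on amplitudes. -/
def pauliAct (P : ι → Pauli) (g : (ι → Fin 2) → GaussianInt) (x : ι → Fin 2) : GaussianInt :=
  (∏ i, (P i).phase (x i)) * g fun i => x i + (P i).flip

/-- The action of a tensor product of single-qubit operators on amplitudes. -/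
def localAct (a : ι → Matrix (Fin 2) (Fin 2) GaussianInt) (g : (ι → Fin 2) → GaussianInt)
    (x : ι → Fin 2) : GaussianInt :=
  ∑ y, (∏ i, a i (x i) (y i)) * g y

/-- The action of `1 + P`, for a Pauli string `P`, on amplitudes. -/
def projAct (P : ι → Pauli) (g : (ι → Fin 2) → GaussianInt) : (ι → Fin 2) → GaussianInt :=
  g + pauliAct P g

theorem pauliOp_mulVec_gaussState (P : ι → Pauli) (g : (ι → Fin 2) → GaussianInt) :
    pauliOp P *ᵥ gaussState g = gaussState (pauliAct P g) := by
  ext x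
  rw [pauliOp_mulVec_apply]
  simp [gaussState, pauliAct]

theorem localOp_mulVec_gaussState (A : ι → Matrix (Fin 2) (Fin 2) ℂ) (c : ι → ℂ)
    (a : ι → Matrix (Fin 2) (Fin 2) GaussianInt)
    (hA : ∀ i, A i = c i • (a i).map GaussianInt.toComplex) (g : (ι → Fin 2) → GaussianInt) :
    localOp A *ᵥ gaussState g = (∏ i, c i) • gaussState (localAct a g) := by
  have : A = fun i => c i • (a i).map GaussianInt.toComplex := funext hA
  rw [this, localOp_smul, Matrix.smul_mulVec]
  congr 1
  ext x
  simp [Matrix.mulVec, dotProduct, localOp, gaussState, localAct]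

theorem pauliProj_mulVec_smul_gaussState {n : ℕ} (P : Fin n → Pauli) (z : ℂ)
    (g : (Fin n → Fin 2) → GaussianInt) :
    pauliProj P *ᵥ (z • gaussState g) = (z / 2) • gaussState (projAct P g) := by
  rw [pauliProj, Matrix.smul_mulVec, Matrix.add_mulVec, Matrix.one_mulVec, Matrix.mulVec_smul,
    pauliOp_mulVec_gaussState, ← smul_add, smul_smul]
  congr 1
  · ring
  · ext x
    simp [gaussState, projAct]

theorem star_gaussState_dotProduct (g h : (ι → Fin 2) → GaussianInt) :
    star (gaussState g) ⬝ᵥ gaussState h = ((∑ x, star (g x) * h x : GaussianInt) : ℂ) := by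
  simp [dotProduct, gaussState, GaussianInt.toComplex_star]

theorem stabilizes_of_pauliAct {C : Enc ι} {z : ℂ} {g : Fin 2 → (ι → Fin 2) → GaussianInt}
    (hC : ∀ l, C l = z • gaussState (g l)) {σ : ℤˣ} {P : ι → Pauli}
    (h : ∀ l x, (σ : ℤ) * pauliAct P (g l) x = g l x) : Stabilizes C σ P := by
  intro l
  rw [hC, Matrix.smul_mulVec, Matrix.mulVec_smul, pauliOp_mulVec_gaussState, smul_comm]
  congr 1
  ext x
  have := congrArg GaussianInt.toComplex (h l x)
  simpa [gaussState] using this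

end Gaussian

/-! ### Controlled gates in a register -/

section Controlled

variable {ι κ : Type} [Fintype ι] [DecidableEq ι] [Fintype κ] [DecidableEq κ]

theorem applyAt_diagonal (e : κ ↪ ι) (d : (κ → Fin 2) → ℂ) :
    applyAt e (Matrix.diagonal d) = Matrix.diagonal fun x => d (x ∘ e) := by
  ext x y
  have h := congrFun (congrFun (applyAt_one e) x) y
  simp only [applyAt, Matrix.diagonal_apply, Matrix.one_apply, ← ite_and] at h ⊢
  by_cases hxy : x = y
  · subst hxy; simp
  · rw [if_neg hxy] at h ⊢
    rw [if_neg]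
    intro hc
    rw [if_pos hc] at h
    exact one_ne_zero h

theorem applyAt_ctrlPhase {k : ℕ} (e : Fin (k + 1) ↪ ι) (θ : ℝ) :
    applyAt e (ctrlPhase k θ) = Matrix.diagonal fun x =>
      if ∀ j, x (e j) = 1 then Complex.exp (θ * Complex.I) else 1 :=
  applyAt_diagonal e _

theorem applyAt_cnotOp_mul_apply {α : Type*} (e : Fin 2 ↪ ι) (M : Matrix (ι → Fin 2) α ℂ)
    (x : ι → Fin 2) (a : α) :
    (applyAt e cnotOp * M) x a = M (Function.update x (e 1) (x (e 1) + x (e 0))) a := by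
  rw [applyAt_mul_apply, Finset.sum_eq_single ![x (e 0), x (e 1) + x (e 0)]]
  · have h : cnotOp (x ∘ e) ![x (e 0), x (e 1) + x (e 0)] = 1 := by
      have : ∀ a b : Fin 2, b = b + a + a := by decide
      simp only [cnotOp, Function.comp]
      rw [if_pos ⟨rfl, this _ _⟩]
    rw [h, one_mul]
    congr 1
    ext i
    by_cases hi : ∃ k, e k = i
    · obtain ⟨k, rfl⟩ := hi
      rw [e.injective.extend_apply]
      fin_cases k
      · simp
      · simp
    · rw [Function.extend_apply' _ _ _ hi, Function.update_of_ne]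
      rintro rfl
      exact hi ⟨1, rfl⟩
  · intro u _ hu
    have : cnotOp (x ∘ e) u = 0 := by
      have h : ∀ a b c d : Fin 2, a = c ∧ b = d + c → c = a ∧ d = b + a := by decide
      refine if_neg fun hc => hu ?_
      obtain ⟨h₁, h₂⟩ := h _ _ _ _ hc
      ext i
      fin_cases i
      · exact congrArg _ h₁
      · exact congrArg _ h₂
    rw [this, zero_mul]
  · simp

theorem applyAt_cnotOp_mul_self (e : Fin 2 ↪ ι) : applyAt e cnotOp * applyAt e cnotOp = 1 := by
  rw [← applyAt_mul, cnotOp_mul_self, applyAt_one]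

end Controlled

/-! ### The `5'`-qubit code -/

/-- The nonzero amplitudes of the `5`-qubit code, up to the factor `1 / 4`. -/
def fiveAmp (l : Fin 2) (x : Fin 5 → Fin 2) : GaussianInt :=
  if ∑ i, x i = l then (-1) ^ ((l : ℕ) + ∑ i, (x i : ℕ) * (x (i + 1) : ℕ)) else 0

/-- The nonzero amplitudes of the `5'`-qubit code, up to the factor `1 / 4`: powers of `i` given
by a quadratic form, on the states in which the qubits `1, 3, 5` have parity `l`. -/
def fivePrimeAmp (l : Fin 2) (x : Fin 5 → Fin 2) : GaussianInt :=
  if x 0 + x 2 + x 4 = l then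
    ⟨0, 1⟩ ^ (3 + 3 * (x 0 : ℕ) + 2 * x 1 + 2 * x 3 + 3 * x 4 + 2 * (x 1 * x 2 + x 0 * x 3 +
      x 1 * x 3 + x 2 * x 3 + x 0 * x 4 + x 1 * x 4 : ℕ))
  else 0

/-- The logical basis of the `5`-qubit code. -/
noncomputable def fiveEnc : Enc (Fin 5) := fiveCode.ket

/-- The logical basis of the `5'`-qubit code. -/
noncomputable def fivePrimeEnc : Enc (Fin 5) := fivePrimeCode.ket

theorem fiveEnc_eq (l : Fin 2) : fiveEnc l = (1 / 4 : ℂ) • gaussState (fiveAmp l) := by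
  have h₀ : (Pi.single 0 1 : State (Fin 5)) =
      (1 : ℂ) • gaussState (fun x => if x = 0 then 1 else 0) := by
    ext x
    by_cases hx : x = 0 <;> simp [gaussState, hx]
  have h : fiveEnc l = (localOp fun _ : Fin 5 => xMat ^ (l : ℕ)) *ᵥ
      (((4 : ℂ) • (pauliProj ![.X, .Z, .Z, .X, .I] * pauliProj ![.I, .X, .Z, .Z, .X] *
        pauliProj ![.X, .I, .X, .Z, .Z] * pauliProj ![.Z, .X, .I, .X, .Z])) *ᵥ
          (Pi.single 0 1 : State (Fin 5))) := rfl
  have key : ∀ l : Fin 2, localAct (fun _ => !![0, 1; 1, 0] ^ (l : ℕ)) (fiveAmp 0) =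
      fiveAmp l := by
    intro l
    funext x
    revert l x
    decide +kernel
  have key' : projAct ![.X, .Z, .Z, .X, .I] (projAct ![.I, .X, .Z, .Z, .X]
      (projAct ![.X, .I, .X, .Z, .Z] (projAct ![.Z, .X, .I, .X, .Z]
        (fun x : Fin 5 → Fin 2 => if x = 0 then 1 else 0)))) = fiveAmp 0 := by
    funext x
    revert x
    decide +kernel
  rw [h, h₀, Matrix.smul_mulVec]
  simp only [← Matrix.mulVec_mulVec, pauliProj_mulVec_smul_gaussState, smul_smul]
  rw [key', Matrix.mulVec_smul,
    localOp_mulVec_gaussState _ (fun _ => 1) (fun _ => !![0, 1; 1, 0] ^ (l : ℕ)), key, smul_smul]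
  · norm_num
  · intro i
    fin_cases l <;> ext a b <;> fin_cases a <;> fin_cases b <;> simp [xMat]

/-- The matrix of `√2 K`. -/
def kGauss : Matrix (Fin 2) (Fin 2) GaussianInt := !![1, 1; ⟨0, 1⟩, -⟨0, 1⟩]

theorem kMat_eq : kMat = ((1 / Real.sqrt 2 : ℝ) : ℂ) • kGauss.map GaussianInt.toComplex := by
  have h : Complex.exp ((Real.pi : ℂ) / 2 * Complex.I) = Complex.I := Complex.exp_pi_div_two_mul_I
  ext a b
  fin_cases a <;> fin_cases b <;>
    simp [kMat, kGauss, phaseMat, hMat, h, GaussianInt.toComplex_def, mul_comm Complex.I]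

theorem fivePrimeEnc_eq (l : Fin 2) :
    fivePrimeEnc l = (1 / 4 : ℂ) • gaussState (fivePrimeAmp l) := by
  have h : fivePrimeEnc l = localOp ![kMat, 1, yMat, 1, kMat] *ᵥ fiveEnc l := rfl
  have key : ∀ l x, localAct ![kGauss, 1, !![0, -⟨0, 1⟩; ⟨0, 1⟩, 0], 1, kGauss] (fiveAmp l) x =
      2 * fivePrimeAmp l x := by decide +kernel
  rw [h, fiveEnc_eq, Matrix.mulVec_smul, localOp_mulVec_gaussState _
    ![((1 / Real.sqrt 2 : ℝ) : ℂ), 1, 1, 1, ((1 / Real.sqrt 2 : ℝ) : ℂ)]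
    ![kGauss, 1, !![0, -⟨0, 1⟩; ⟨0, 1⟩, 0], 1, kGauss], smul_smul]
  · ext x
    simp only [Pi.smul_apply, gaussState, key, map_mul, smul_eq_mul, map_ofNat]
    simp [Fin.prod_univ_succ, inv_sqrt_two_mul_self]
    ring
  · intro i
    fin_cases i
    · exact kMat_eq
    · simp
    · ext a b
      fin_cases a <;> fin_cases b <;> simp [yMat, GaussianInt.toComplex_def]
    · simp
    · exact kMat_eq

theorem fivePrimeEnc_isEncoding : IsEncoding fivePrimeEnc := by
  have key : ∀ l l', ∑ x, star (fivePrimeAmp l x) * fivePrimeAmp l' x =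
      if l = l' then 16 else 0 := by decide +kernel
  intro l l'
  rw [fivePrimeEnc_eq, fivePrimeEnc_eq, star_smul, smul_dotProduct, dotProduct_smul,
    star_gaussState_dotProduct, key]
  split_ifs <;> norm_num [map_ofNat GaussianInt.toComplex 16]

/-- The signed stabilizer generators of the `5'`-qubit code. -/
def fivePrimeGen : Fin 4 → ℤˣ × (Fin 5 → Pauli) :=
  ![(-1, ![.Z, .Z, .Z, .X, .I]), (-1, ![.I, .X, .Z, .Z, .Z]), (-1, ![.Z, .I, .X, .Z, .Y]),
    (1, ![.Y, .X, .I, .X, .Y])]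

theorem fivePrimeGen_stabilizes (i : Fin 4) :
    Stabilizes fivePrimeEnc (fivePrimeGen i).1 (fivePrimeGen i).2 := by
  refine stabilizes_of_pauliAct fivePrimeEnc_eq ?_
  revert i
  decide +kernel

/-- The `5'`-qubit code has distance at least `3`. -/
theorem fivePrimeEnc_eq_one (P : Fin 5 → Pauli) (hP : InNormalizer fivePrimeEnc P)
    (q q' : Fin 5) (h : ∀ i, i ≠ q → i ≠ q' → P i = 1) : P = 1 := by
  have key : ∀ q q' : Fin 5, ∀ a b : Pauli,
      (∀ i, commSign (fivePrimeGen i).2 (Function.update (Function.update (1 : Fin 5 → Pauli) q a) q' b) = 1) →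
      ∀ j, Function.update (Function.update (1 : Fin 5 → Pauli) q a) q' b j = 1 := by
    decide +kernel
  have hPe : P = Function.update (Function.update (1 : Fin 5 → Pauli) q (P q)) q' (P q') := by
    funext i
    by_cases h₁ : i = q'
    · subst h₁; simp
    · by_cases h₂ : i = q
      · subst h₂; simp [h₁]
      · simp [h₁, h₂, h i h₂ h₁]
  rw [hPe]
  exact funext (key q q' (P q) (P q') fun i => by
    rw [← hPe]; exact hP _ _ (fivePrimeGen_stabilizes i))

/-! ### Logical gates of the `5'`-qubit code -/

section Logical

variable {ι : Type} [Fintype ι] [DecidableEq ι]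

/-- The partition of `m` blocks into the single blocks. -/
def blockEquiv (m : ℕ) (ι : Type) : (Σ _ : Fin m, ι) ≃ Fin m × ι := Equiv.sigmaEquivProd (Fin m) ι

theorem blockEnc_eq_tensorOn (m : ℕ) (C : Enc ι) :
    blockEnc m C = tensorOn (blockEquiv m ι) fun _ => encMat C := rfl

theorem blockOp_eq_opOn {m : ℕ} (A : Fin m → Op ι) : blockOp A = opOn (blockEquiv m ι) A := rfl

theorem implements_blockOp {C : Enc ι} {A : Op ι} {M : Matrix (Fin 2) (Fin 2) ℂ} {z : ℂ}
    (hz : ‖z‖ = 1) (h : A * encMat C = z • (encMat C * M)) (m : ℕ) :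
    Implements C (blockOp fun _ : Fin m => A) (localOp fun _ => M) := by
  refine ⟨∏ _ : Fin m, z, by simp [hz], ?_⟩
  rw [blockEnc_eq_tensorOn, blockOp_eq_opOn, opOn_mul_tensorOn, h]
  refine (tensorOn_smul _ (fun _ => z) _).trans (congrArg _ ?_)
  exact (tensorOn_mul_tensor (blockEquiv m ι) (fun _ => encMat C) fun _ => M).symm

end Logical

/-- The bitwise operator acts as the logical `K` times the phase `-i`; the amplitudes are compared
in the Gaussian integers. -/
theorem fivePrimeEnc_implements_K : Implements fivePrimeEnc
    (blockOp fun _ : Fin 1 => localOp ![kMat, kMat, zMat * kMat, kMat, kMat]) Gate.K.op := by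
  have key : ∀ l x, localAct ![kGauss, kGauss, !![1, 1; -⟨0, 1⟩, ⟨0, 1⟩], kGauss, kGauss]
      (fivePrimeAmp l) x =
      4 * -⟨0, 1⟩ * ∑ l', fivePrimeAmp l' x * kGauss l' l := by decide +kernel
  have h₂ : (((Real.sqrt 2 : ℝ) : ℂ))⁻¹ ^ 2 = 1 / 2 := by
    rw [inv_pow, ← Complex.ofReal_pow, Real.sq_sqrt (by norm_num)]; norm_num
  refine implements_blockOp (z := -Complex.I) (by simp) ?_ 1
  ext x l
  have h : (localOp ![kMat, kMat, zMat * kMat, kMat, kMat] * encMat fivePrimeEnc) x l =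
      (localOp ![kMat, kMat, zMat * kMat, kMat, kMat] *ᵥ fivePrimeEnc l) x := rfl
  rw [h, fivePrimeEnc_eq, Matrix.mulVec_smul, localOp_mulVec_gaussState _
    (fun _ => ((1 / Real.sqrt 2 : ℝ) : ℂ))
    ![kGauss, kGauss, !![1, 1; -⟨0, 1⟩, ⟨0, 1⟩], kGauss, kGauss]]
  · simp only [Matrix.smul_apply, Matrix.mul_apply, encMat, fivePrimeEnc_eq, Pi.smul_apply,
      gaussState, key, smul_eq_mul, Finset.prod_const, Finset.card_univ, Fintype.card_fin,
      kMat_eq, Matrix.map_apply, map_mul, map_add, map_ofNat, map_neg, Fin.sum_univ_two]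
    have h₃ : (GaussianInt.toComplex ⟨0, 1⟩) = Complex.I := by simp [GaussianInt.toComplex_def]
    rw [h₃]
    push_cast
    rw [one_div (((Real.sqrt 2 : ℝ) : ℂ))]
    linear_combination (-Complex.I * ((GaussianInt.toComplex (fivePrimeAmp 0 x)) *
      GaussianInt.toComplex (kGauss 0 l) + GaussianInt.toComplex (fivePrimeAmp 1 x) *
      GaussianInt.toComplex (kGauss 1 l)) * (((Real.sqrt 2 : ℝ) : ℂ))⁻¹) *
      ((((Real.sqrt 2 : ℝ) : ℂ))⁻¹ ^ 2 + 1 / 2) * h₂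
  · have hz : zMat * kMat = ((1 / Real.sqrt 2 : ℝ) : ℂ) •
        (!![1, 1; -⟨0, 1⟩, ⟨0, 1⟩] : Matrix (Fin 2) (Fin 2) GaussianInt).map
          GaussianInt.toComplex := by
      rw [kMat_eq]
      ext a b
      fin_cases a <;> fin_cases b <;>
        simp [zMat, kGauss, GaussianInt.toComplex_def, Matrix.mul_apply, Fin.sum_univ_two]
    intro i
    fin_cases i
    · exact kMat_eq
    · exact kMat_eq
    · exact hz
    · exact kMat_eq
    · exact kMat_eq

/-- The logical bit is the parity of the qubits `1, 3, 5`. -/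
theorem fivePrimeEnc_eq_zero (l : Fin 2) (x : Fin 5 → Fin 2) (h : x 0 + x 2 + x 4 ≠ l) :
    fivePrimeEnc l x = 0 := by
  simp [fivePrimeEnc_eq, gaussState, fivePrimeAmp, h]

theorem staircaseInv_mul_staircase : staircaseInv * staircase = 1 := by
  simp only [staircaseInv, staircase, cnotFive]
  have h : ∀ A B : Op (Fin 5), A * A = 1 → B * B = 1 → A * B * (B * A) = 1 := by
    intro A B hA hB
    rw [Matrix.mul_assoc, ← Matrix.mul_assoc B, hB, Matrix.one_mul, hA]
  exact h _ _ (applyAt_cnotOp_mul_self _) (applyAt_cnotOp_mul_self _)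

/-- After the staircase, the fifth qubit of an encoded basis state carries the logical bit. -/
theorem staircase_mul_encMat_eq_zero (l : Fin 2) (x : Fin 5 → Fin 2) (h : x 4 ≠ l) :
    (staircase * encMat fivePrimeEnc) x l = 0 := by
  rw [staircase, Matrix.mul_assoc]
  simp only [cnotFive]
  rw [applyAt_cnotOp_mul_apply, applyAt_cnotOp_mul_apply]
  refine fivePrimeEnc_eq_zero _ _ fun h' => h ?_
  rw [← h']
  have : ∀ a b c : Fin 2, c = a + (b + a) + (c + b) := by decide
  simp only [Function.Embedding.coeFn_mk, Matrix.cons_val_one, Matrix.cons_val_zero,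
    Matrix.cons_val_fin_one, Function.update_apply]
  simp only [Fin.reduceEq, if_true, if_false]
  exact this _ _ _

/-- A diagonal phase gate on one qubit of each block acts on a family of states as a logical phase
gate if those qubits carry the logical bits. -/
theorem applyAt_ctrlPhase_mul_tensorOn {k : ℕ} (θ : ℝ)
    (F : Matrix (Fin 5 → Fin 2) (Fin 2) ℂ) (hF : ∀ x l, x 4 ≠ l → F x l = 0) :
    applyAt (lastQubits (k + 1)) (ctrlPhase k θ) * tensorOn (blockEquiv (k + 1) (Fin 5)) (fun _ => F)
      = tensorOn (blockEquiv (k + 1) (Fin 5)) (fun _ => F) * ctrlPhase k θ := by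
  rw [applyAt_ctrlPhase]
  ext x l
  rw [Matrix.diagonal_mul, ctrlPhase, Matrix.mul_diagonal]
  by_cases h : ∀ j, x (j, 4) = l j
  · rw [mul_comm]
    congr 1
    have h' : ∀ j, x (lastQubits (k + 1) j) = l j := h
    simp only [h']
  · obtain ⟨j, hj⟩ := not_forall.1 h
    have : tensorOn (blockEquiv (k + 1) (Fin 5)) (fun _ => F) x l = 0 :=
      Finset.prod_eq_zero (Finset.mem_univ j) (hF _ _ hj)
    rw [this, mul_zero, zero_mul]

theorem fivePrimeEnc_implements_phaseCircuit (k : ℕ) (θ : ℝ) :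
    Implements fivePrimeEnc (phaseCircuit k θ) (ctrlPhase k θ) := by
  refine ⟨1, by simp, ?_⟩
  rw [one_smul, phaseCircuit, Matrix.mul_assoc, Matrix.mul_assoc, blockOp_eq_opOn, blockOp_eq_opOn,
    blockEnc_eq_tensorOn, opOn_mul_tensorOn, applyAt_ctrlPhase_mul_tensorOn _ _ fun x l h =>
      staircase_mul_encMat_eq_zero l x h, ← Matrix.mul_assoc, opOn_mul_tensorOn]
  simp only [← Matrix.mul_assoc, staircaseInv_mul_staircase, Matrix.one_mul]

/-! ### The Reed–Muller code -/

/-- Whether a Pauli operator changes the relative sign of the basis states. -/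
def Pauli.zBit : Pauli → Fin 2
  | I => 0
  | X => 0
  | Y => 1
  | Z => 1

section ReedMuller

open scoped Fin.CommRing

/-- The generators of the classical code: the all-ones word and the words `v₀, …, v₃`. -/
def rmBasis (p : Fin 5) (j : Fin 15) : Fin 2 :=
  Fin.cases 1 (fun i => ((((j : ℕ) + 1) / 2 ^ (i : ℕ) % 2 : ℕ) : Fin 2)) p

/-- The word with the given coefficients; the coefficient of the all-ones word comes first. -/
def rmWord (c : Fin 5 → Fin 2) : Fin 15 → Fin 2 := fun j => ∑ p, c p * rmBasis p j

/-- The logical basis of the Reed–Muller code. -/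
noncomputable def rmEnc : Enc (Fin 15) := rmCode.ket

theorem rmWord_add (c d : Fin 5 → Fin 2) : rmWord (c + d) = rmWord c + rmWord d := by
  ext j
  simp [rmWord, add_mul, Finset.sum_add_distrib]

/-- The coefficients of a word, read off from its entries at five positions. -/
def rmCoeff (x : Fin 15 → Fin 2) : Fin 5 → Fin 2 :=
  ![x 0 + x 1 + x 2, x 1 + x 2, x 0 + x 2, x 0 + x 1 + x 2 + x 3, x 0 + x 1 + x 2 + x 7]

theorem rmCoeff_rmWord (c : Fin 5 → Fin 2) : rmCoeff (rmWord c) = c := by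
  revert c; decide +kernel

theorem rmWord_injective : Function.Injective rmWord :=
  Function.LeftInverse.injective rmCoeff_rmWord

theorem rmEnc_apply (l : Fin 2) (x : Fin 15 → Fin 2) :
    rmEnc l x = if ∃ c, c 0 = l ∧ x = rmWord c then 1 / 4 else 0 := by
  have h : rmEnc l x = if ∃ a : Fin 4 → Fin 2, ∀ j : Fin 15,
      (x j : ℕ) = ((l : ℕ) + ∑ i : Fin 4, (a i : ℕ) * (((j : ℕ) + 1) / 2 ^ (i : ℕ) % 2)) % 2
    then 1 / 4 else 0 := rfl
  rw [h]
  have h₁ : ∀ (a : Fin 4 → Fin 2) (j : Fin 15),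
      ((x j : ℕ) = ((l : ℕ) + ∑ i : Fin 4, (a i : ℕ) * (((j : ℕ) + 1) / 2 ^ (i : ℕ) % 2)) % 2) ↔
        x j = rmWord (Fin.cons l a) j := by
    intro a j
    rw [Fin.ext_iff (a := x j)]
    have : rmWord (Fin.cons l a) j =
        (((l : ℕ) + ∑ i : Fin 4, (a i : ℕ) * (((j : ℕ) + 1) / 2 ^ (i : ℕ) % 2) : ℕ) : Fin 2) := by
      rw [rmWord, Fin.sum_univ_succ]
      simp [rmBasis]
    rw [this, Fin.val_natCast]
  have h₂ : (∃ a : Fin 4 → Fin 2, ∀ j : Fin 15,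
      (x j : ℕ) = ((l : ℕ) + ∑ i : Fin 4, (a i : ℕ) * (((j : ℕ) + 1) / 2 ^ (i : ℕ) % 2)) % 2) ↔
      ∃ c, c 0 = l ∧ x = rmWord c := by
    simp only [h₁, ← funext_iff (f := x)]
    constructor
    · rintro ⟨a, ha⟩
      exact ⟨Fin.cons l a, rfl, ha⟩
    · rintro ⟨c, rfl, hc⟩
      exact ⟨Fin.tail c, by rw [hc, Fin.cons_self_tail]⟩
  simp only [h₂]

theorem rmEnc_rmWord (l : Fin 2) (c : Fin 5 → Fin 2) :
    rmEnc l (rmWord c) = if c 0 = l then 1 / 4 else 0 := by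
  rw [rmEnc_apply]
  congr 1
  simp only [eq_iff_iff]
  constructor
  · rintro ⟨d, hd, h⟩
    rw [rmWord_injective h, hd]
  · intro h
    exact ⟨c, h, rfl⟩

theorem rmEnc_eq_zero {l : Fin 2} {x : Fin 15 → Fin 2}
    (h : ¬∃ c, c 0 = l ∧ x = rmWord c) : rmEnc l x = 0 := by
  rw [rmEnc_apply, if_neg h]

theorem rmEnc_add_rmWord (l : Fin 2) (x : Fin 15 → Fin 2) (c : Fin 5 → Fin 2) :
    rmEnc l (x + rmWord c) = rmEnc (l + c 0) x := by
  have hc : ∀ d : Fin 5 → Fin 2, d + d = 0 := by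
    intro d
    have : ∀ a : Fin 2, a + a = 0 := by decide
    ext i; exact congrArg _ (this _)
  have hc' : rmWord c + rmWord c = 0 := by
    rw [← rmWord_add, hc]; ext j; simp [rmWord]
  have h2 : ∀ a b : Fin 2, a + b + b = a := by decide
  rw [rmEnc_apply, rmEnc_apply]
  congr 1
  simp only [eq_iff_iff]
  constructor
  · rintro ⟨d, rfl, h⟩
    refine ⟨d + c, rfl, ?_⟩
    rw [rmWord_add, ← h, add_assoc, hc', add_zero]
  · rintro ⟨d, hd, rfl⟩
    refine ⟨d + c, ?_, by rw [rmWord_add]⟩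
    rw [Pi.add_apply, hd, h2]

theorem rmEnc_isEncoding : IsEncoding rmEnc := by
  intro l l'
  have h : star (rmEnc l) ⬝ᵥ rmEnc l' = ∑ c, star (rmEnc l (rmWord c)) * rmEnc l' (rmWord c) := by
    rw [dotProduct, ← Finset.sum_image (s := Finset.univ) (g := rmWord)
      (f := fun x => star (rmEnc l x) * rmEnc l' x) (fun a _ b _ h => rmWord_injective h)]
    refine (Finset.sum_subset (Finset.subset_univ _) fun x _ hx => ?_).symm
    rw [Pi.star_apply, rmEnc_eq_zero, star_zero, zero_mul]
    rintro ⟨c, -, rfl⟩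
    exact hx (Finset.mem_image_of_mem _ (Finset.mem_univ _))
  have key : ∀ l l' : Fin 2, (∑ c : Fin 5 → Fin 2,
      (if c 0 = l then 1 else 0) * (if c 0 = l' then 1 else 0)) = (if l = l' then 16 else 0 : ℤ) := by
    decide +kernel
  have key' : (∑ c : Fin 5 → Fin 2, (if c 0 = l then 1 else 0) * (if c 0 = l' then 1 else 0)) =
      (if l = l' then 16 else 0 : ℂ) := by exact_mod_cast key l l'
  have h' : ∀ c : Fin 5 → Fin 2, star (rmEnc l (rmWord c)) * rmEnc l' (rmWord c) =
      (1 / 16) * ((if c 0 = l then 1 else 0) * (if c 0 = l' then 1 else 0)) := by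
    intro c
    rw [rmEnc_rmWord, rmEnc_rmWord]
    split_ifs <;> norm_num
  simp only [h, h']
  rw [← Finset.mul_sum, key']
  split_ifs <;> norm_num

/-- The `X`-type Pauli string with support `x`. -/
def xString (x : Fin 15 → Fin 2) : Fin 15 → Pauli := fun j => if x j = 1 then .X else 1

/-- The `Z`-type Pauli string with support `x`. -/
def zString (x : Fin 15 → Fin 2) : Fin 15 → Pauli := fun j => if x j = 1 then .Z else 1

/-- The sign `(-1) ^ a`. -/
def bitSign (a : Fin 2) : ℤˣ := (-1) ^ (a : ℕ)

theorem bitSign_add (a b : Fin 2) : bitSign (a + b) = bitSign a * bitSign b := by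
  revert a b; decide

theorem bitSign_sum {α : Type*} (s : Finset α) (f : α → Fin 2) :
    bitSign (∑ i ∈ s, f i) = ∏ i ∈ s, bitSign (f i) := by
  classical
  induction s using Finset.induction_on with
  | empty => rfl
  | insert a s ha ih => rw [Finset.sum_insert ha, Finset.prod_insert ha, bitSign_add, ih]

theorem eq_zero_of_bitSign {a : Fin 2} (h : bitSign a = 1) : a = 0 := by
  revert a; decide

theorem commSign_zString (w : Fin 15 → Fin 2) (P : Fin 15 → Pauli) :
    commSign (zString w) P = bitSign (∑ j, w j * (P j).flip) := by
  rw [bitSign_sum]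
  refine Finset.prod_congr rfl fun j _ => ?_
  have : ∀ (a : Fin 2) (p : Pauli), Pauli.commSign (if a = 1 then .Z else 1) p =
    bitSign (a * p.flip) := by decide
  exact this _ _

theorem commSign_xString (w : Fin 15 → Fin 2) (P : Fin 15 → Pauli) :
    commSign (xString w) P = bitSign (∑ j, w j * (P j).zBit) := by
  rw [bitSign_sum]
  refine Finset.prod_congr rfl fun j _ => ?_
  have : ∀ (a : Fin 2) (p : Pauli), Pauli.commSign (if a = 1 then .X else 1) p =
    bitSign (a * p.zBit) := by decide
  exact this _ _

theorem pauliOp_xString_mulVec (w : Fin 15 → Fin 2) (v : State (Fin 15)) (x : Fin 15 → Fin 2) :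
    (pauliOp (xString w) *ᵥ v) x = v (x + w) := by
  have h : ∀ a b : Fin 2, Pauli.phase (if a = 1 then .X else 1) b = 1 ∧
      Pauli.flip (if a = 1 then .X else 1) = a := by decide
  rw [pauliOp_mulVec_apply]
  simp only [xString, (h _ _).1, (h _ 0).2, map_one, Finset.prod_const_one, one_mul]
  rfl

theorem pauliOp_zString_mulVec (w : Fin 15 → Fin 2) (v : State (Fin 15)) (x : Fin 15 → Fin 2) :
    (pauliOp (zString w) *ᵥ v) x = ((bitSign (∑ j, w j * x j) : ℤ) : ℂ) * v x := by
  have h : ∀ a b : Fin 2, Pauli.phase (if a = 1 then .Z else 1) b = ((bitSign (a * b) : ℤ)) ∧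
      Pauli.flip (if a = 1 then .Z else 1) = 0 := by decide
  rw [pauliOp_mulVec_apply, bitSign_sum]
  simp only [zString, (h _ _).1, (h _ 0).2, map_intCast, add_zero]
  push_cast
  rfl

theorem stabilizes_xString {c : Fin 5 → Fin 2} (hc : c 0 = 0) :
    Stabilizes rmEnc 1 (xString (rmWord c)) := by
  intro l
  ext x
  rw [Matrix.smul_mulVec, Pi.smul_apply, pauliOp_xString_mulVec, rmEnc_add_rmWord, hc, add_zero]
  simp

theorem stabilizes_zString {w : Fin 15 → Fin 2} (hw : ∀ c, ∑ j, w j * rmWord c j = 0) :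
    Stabilizes rmEnc 1 (zString w) := by
  intro l
  ext x
  rw [Matrix.smul_mulVec, Pi.smul_apply, pauliOp_zString_mulVec]
  by_cases h : ∃ c, c 0 = l ∧ x = rmWord c
  · obtain ⟨c, -, rfl⟩ := h
    rw [hw, bitSign]
    simp
  · rw [rmEnc_eq_zero h]; simp

/-- Sums over the positions of products of three words: the products of at most three of
`v₀, …, v₃` have even weight. -/
theorem sum_rmWord_mul_mul (c d e : Fin 5 → Fin 2) :
    ∑ j, rmWord c j * rmWord d j * rmWord e j = c 0 * d 0 * e 0 := by
  have key : ∀ p q r : Fin 5, ∑ j, rmBasis p j * rmBasis q j * rmBasis r j =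
      if p = 0 ∧ q = 0 ∧ r = 0 then 1 else 0 := by decide +kernel
  have h : ∀ j, rmWord c j * rmWord d j * rmWord e j =
      ∑ p, ∑ q, ∑ r, c p * d q * e r * (rmBasis p j * rmBasis q j * rmBasis r j) := by
    intro j
    rw [rmWord, rmWord, rmWord, Finset.sum_mul_sum, Finset.sum_mul]
    refine Finset.sum_congr rfl fun p _ => ?_
    rw [Finset.sum_mul_sum]
    exact Finset.sum_congr rfl fun q _ => Finset.sum_congr rfl fun r _ => by ring
  simp only [h]
  rw [Finset.sum_comm]
  have h' : ∀ p, ∑ j, ∑ q, ∑ r, c p * d q * e r * (rmBasis p j * rmBasis q j * rmBasis r j) =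
      ∑ q, ∑ r, c p * d q * e r * if p = 0 ∧ q = 0 ∧ r = 0 then 1 else 0 := by
    intro p
    rw [Finset.sum_comm]
    refine Finset.sum_congr rfl fun q _ => ?_
    rw [Finset.sum_comm]
    refine Finset.sum_congr rfl fun r _ => ?_
    rw [← Finset.mul_sum, key]
  simp only [h']
  rw [Finset.sum_eq_single 0, Finset.sum_eq_single 0, Finset.sum_eq_single 0]
  all_goals simp +contextual

theorem rmWord_ones : rmWord (Pi.single 0 1) = fun _ => 1 := by
  funext j; revert j; decide +kernel

theorem sum_rmWord_mul (c d : Fin 5 → Fin 2) : ∑ j, rmWord c j * rmWord d j = c 0 * d 0 := by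
  have := sum_rmWord_mul_mul c d (Pi.single 0 1)
  simpa [rmWord_ones] using this

theorem sum_rmWord (c : Fin 5 → Fin 2) : ∑ j, rmWord c j = c 0 := by
  have := sum_rmWord_mul c (Pi.single 0 1)
  simpa [rmWord_ones] using this

/-- A word orthogonal to the dual of the classical code belongs to the code: the checks are those
that express each entry by the five entries from which the coefficients are read off. -/
theorem eq_rmWord_of_forall_dual (f : Fin 15 → Fin 2)
    (hf : ∀ w : Fin 15 → Fin 2, (∀ c, ∑ j, w j * rmWord c j = 0) → ∑ j, w j * f j = 0) :
    f = rmWord (rmCoeff f) := by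
  obtain ⟨L, hL₀⟩ : ∃ L : (Fin 15 → Fin 2) →ₗ[Fin 2] (Fin 15 → Fin 2),
      ∀ x, L x = x - rmWord (rmCoeff x) := by
    refine ⟨{ toFun := fun x => x - rmWord (rmCoeff x), map_add' := ?_, map_smul' := ?_ },
      fun _ => rfl⟩
    · intro x y
      have : rmCoeff (x + y) = rmCoeff x + rmCoeff y := by
        ext p; fin_cases p <;> simp [rmCoeff] <;> ring_nf
      rw [this, rmWord_add]; abel
    · intro a x
      have h₁ : rmCoeff (a • x) = a • rmCoeff x := by
        ext p; fin_cases p <;> simp [rmCoeff] <;> ring_nf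
      have h₂ : ∀ c, rmWord (a • c) = a • rmWord c := by
        intro c; ext j
        simp only [rmWord, Pi.smul_apply, smul_eq_mul, Finset.mul_sum, mul_assoc]
      rw [h₁, h₂, smul_sub]; rfl
  have hL : ∀ x j, ∑ i, L (Pi.single i 1) j * x i = L x j := by
    intro x j
    have hx : x = ∑ i, x i • Pi.single i (1 : Fin 2) := by
      funext k; simp [Finset.sum_apply, Pi.single_apply]
    conv_rhs => rw [hx, map_sum]
    simp only [Finset.sum_apply, map_smul, Pi.smul_apply, smul_eq_mul, mul_comm]
  funext j
  have h := hf (fun i => L (Pi.single i 1) j) fun c => by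
    rw [hL, hL₀, rmCoeff_rmWord, sub_self]; rfl
  rw [hL, hL₀] at h
  exact sub_eq_zero.1 h

/-- The classical code generated by `v₀, …, v₃` is dual to a code of distance `3`. -/
theorem eq_zero_of_sum_rmBasis (f : Fin 15 → Fin 2) (q q' : Fin 15)
    (h : ∀ i, i ≠ q → i ≠ q' → f i = 0)
    (hf : ∀ c : Fin 5 → Fin 2, c 0 = 0 → ∑ j, rmWord c j * f j = 0) : f = 0 := by
  have key : ∀ q q' : Fin 15, ∀ a b : Fin 2, (q = q' → a = b) →
      (∀ i : Fin 4, (if q = q' then rmBasis i.succ q * a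
        else rmBasis i.succ q * a + rmBasis i.succ q' * b) = 0) → a = 0 ∧ b = 0 := by
    decide +kernel
  have hb : ∀ p j, rmWord (Pi.single p 1) j = rmBasis p j := by
    intro p j; simp [rmWord, Pi.single_apply]
  have := key q q' (f q) (f q') (fun h => by rw [h]) fun i => by
    have h₁ := hf (Pi.single i.succ 1) (by simp)
    simp only [hb] at h₁
    rw [← Finset.sum_subset (Finset.subset_univ {q, q'}) fun j _ hj => by
      simp only [Finset.mem_insert, Finset.mem_singleton, not_or] at hj
      rw [h j hj.1 hj.2, mul_zero]] at h₁
    split_ifs with hq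
    · subst hq; simpa using h₁
    · rwa [Finset.sum_pair hq] at h₁
  funext i
  by_cases h₁ : i = q
  · rw [h₁]; exact this.1
  · by_cases h₂ : i = q'
    · rw [h₂]; exact this.2
    · exact h i h₁ h₂

theorem InNormalizer.sum_zBit {P : Fin 15 → Pauli} (hP : InNormalizer rmEnc P)
    {c : Fin 5 → Fin 2} (hc : c 0 = 0) : ∑ j, rmWord c j * (P j).zBit = 0 :=
  eq_zero_of_bitSign ((commSign_xString _ _).symm.trans (hP _ _ (stabilizes_xString hc)))

theorem InNormalizer.sum_flip {P : Fin 15 → Pauli} (hP : InNormalizer rmEnc P)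
    {w : Fin 15 → Fin 2} (hw : ∀ c, ∑ j, w j * rmWord c j = 0) : ∑ j, w j * (P j).flip = 0 :=
  eq_zero_of_bitSign ((commSign_zString _ _).symm.trans (hP _ _ (stabilizes_zString hw)))

/-- The Reed–Muller code has distance at least `3`. -/
theorem rmEnc_eq_one (P : Fin 15 → Pauli) (hP : InNormalizer rmEnc P)
    (q q' : Fin 15) (h : ∀ i, i ≠ q → i ≠ q' → P i = 1) : P = 1 := by
  have h₁ := eq_zero_of_sum_rmBasis (fun j => (P j).flip) q q'
    (fun i hi hi' => by rw [h i hi hi']; rfl) fun c hc => hP.sum_flip fun d => by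
      rw [sum_rmWord_mul, hc, zero_mul]
  have h₂ := eq_zero_of_sum_rmBasis (fun j => (P j).zBit) q q'
    (fun i hi hi' => by rw [h i hi hi']; rfl) fun c hc => hP.sum_zBit hc
  have h₃ : ∀ p : Pauli, p.flip = 0 → p.zBit = 0 → p = 1 := by decide
  exact funext fun i => h₃ _ (congrFun h₁ i) (congrFun h₂ i)

/-- The signs with which the transversal Pauli operators act as the logical ones: transversal `Y`
acts as `-Y`, since `i ^ 15 = -i`. -/
def rmLogicalSign (L : Pauli) : ℤˣ := if L = .Y then -1 else 1

theorem rmEnc_mulVec_apply (P : Fin 15 → Pauli) (c : Fin 5 → Fin 2)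
    (hflip : (fun j => (P j).flip) = rmWord c) (l : Fin 2) (x : Fin 15 → Fin 2) :
    (pauliOp P *ᵥ rmEnc l) x =
      ((∏ j, (P j).phase (x j) : GaussianInt) : ℂ) * rmEnc (l + c 0) x := by
  rw [pauliOp_mulVec_apply, map_prod, ← rmEnc_add_rmWord, ← hflip]
  rfl

theorem mulVec_bit_apply (L : Pauli) (l : Fin 2) {ι : Type} (C : Enc ι) (x : ι → Fin 2) :
    (∑ b, L.mat b l • C b) x =
      ((L.phase (l + L.flip) : GaussianInt) : ℂ) * C (l + L.flip) x := by
  have h : ∀ a b c : Fin 2, a = b + c ↔ b = a + c := by decide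
  rw [Finset.sum_apply]
  simp only [Pi.smul_apply, Pauli.mat_apply, h l, smul_eq_mul, ite_mul, zero_mul,
    Finset.sum_ite_eq', Finset.mem_univ, if_true]

theorem rmEnc_transversal_pauli (L : Pauli) (l : Fin 2) :
    pauliOp (fun _ => L) *ᵥ rmEnc l =
      ((rmLogicalSign L : ℤ) : ℂ) • ∑ b, L.mat b l • rmEnc b := by
  have hw : (fun _ : Fin 15 => L.flip) = rmWord (Pi.single 0 L.flip) := by
    funext j; revert L j; decide +kernel
  ext x
  rw [rmEnc_mulVec_apply (fun _ => L) _ hw, Pi.smul_apply, mulVec_bit_apply, Pi.single_eq_same,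
    smul_eq_mul, ← mul_assoc]
  by_cases h : ∃ c, c 0 = l + L.flip ∧ x = rmWord c
  · obtain ⟨c, hc, rfl⟩ := h
    have key : ∀ (L : Pauli) (c : Fin 5 → Fin 2), ∏ j, L.phase (rmWord c j) =
        (rmLogicalSign L : ℤ) * L.phase (c 0) := by decide +kernel
    rw [key, hc]
    simp
  · rw [rmEnc_eq_zero h]; simp

/-- Pauli strings commuting with the stabilizer act on the code as logical Pauli operators. -/
theorem InNormalizer.exists_logical {P : Fin 15 → Pauli} (hP : InNormalizer rmEnc P) :
    ∃ (L : Pauli) (z : ℂ), ∀ l, pauliOp P *ᵥ rmEnc l = z • ∑ b, L.mat b l • rmEnc b := by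
  have hflip := eq_rmWord_of_forall_dual (fun j => (P j).flip) fun w hw => hP.sum_flip hw
  set c := rmCoeff fun j => (P j).flip
  have hL : ∀ f s : Fin 2, ∃ L : Pauli, L.flip = f ∧ L.zBit = s := by decide
  obtain ⟨L, hL₁, hL₂⟩ := hL (c 0) (∑ j, (P j).zBit)
  have hphase : ∀ (p : Pauli) (a : Fin 2), p.phase a = (bitSign (a * p.zBit) : ℤ) * p.phase 0 := by
    decide
  have hunit : ∀ p : Pauli, star (p.phase 0) * p.phase 0 = 1 := by decide
  refine ⟨L, ((star (L.phase 0) * ∏ j, (P j).phase 0 : GaussianInt) : ℂ), fun l => ?_⟩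
  ext x
  rw [rmEnc_mulVec_apply P c hflip, Pi.smul_apply, mulVec_bit_apply, smul_eq_mul, ← mul_assoc,
    ← map_mul, hL₁]
  by_cases h : ∃ d, d 0 = l + c 0 ∧ x = rmWord d
  · obtain ⟨d, hd, rfl⟩ := h
    congr 2
    have h₁ : ∑ j, rmWord d j * (P j).zBit = d 0 * ∑ j, (P j).zBit := by
      have hsplit : d = Function.update d 0 0 + Pi.single 0 (d 0) := by
        ext p
        refine Fin.cases ?_ (fun i => ?_) p <;> simp
      have hones : rmWord (Pi.single 0 (d 0)) = fun _ => d 0 := by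
        funext j; generalize d 0 = a; revert a j; decide +kernel
      have h₀ := hP.sum_zBit (c := Function.update d 0 0) (by simp)
      conv_lhs => rw [hsplit, rmWord_add, hones]
      simp only [Pi.add_apply, add_mul, Finset.sum_add_distrib, h₀, zero_add, Finset.mul_sum]
    simp only [hphase _ (rmWord d _), Finset.prod_mul_distrib]
    rw [hphase L (l + c 0), ← hd, hL₂, ← h₁, bitSign_sum]
    push_cast
    linear_combination (-(∏ j, ((bitSign (rmWord d j * (P j).zBit) : ℤ) : GaussianInt)) *
      ∏ j, (P j).phase 0) * hunit L
  · rw [rmEnc_eq_zero h]; simp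

end ReedMuller

/-! ### Circuits on the parts of a register -/

section Pieces

variable {ι κ : Type} [Fintype ι] [DecidableEq ι] [Fintype κ] [DecidableEq κ]

/-- A gate applied to a part of a register. -/
def PlacedGate.map (e : κ ↪ ι) (g : PlacedGate κ) : PlacedGate ι := ⟨g.arity, g.gate, g.wires.trans e⟩

/-- A circuit applied to a part of a register. -/
def Circuit.map (e : κ ↪ ι) (c : Circuit κ) : Circuit ι := List.map (PlacedGate.map e) c

theorem Circuit.eval_map (e : κ ↪ ι) (c : Circuit κ) :
    (Circuit.map e c).eval = applyAt e c.eval := by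
  induction c with
  | nil => exact (applyAt_one e).symm
  | cons g c ih =>
    have h : Circuit.map e (g :: c) = g.map e :: Circuit.map e c := rfl
    rw [h, Circuit.eval, ih, Circuit.eval, applyAt_mul]
    congr 1
    exact (applyAt_applyAt e g.wires g.gate.op).symm

variable {Q : Type*} [Fintype Q] [DecidableEq Q] {R : Q → Type} [∀ q, Fintype (R q)]
  [∀ q, DecidableEq (R q)]

/-- Circuits run on all the pieces of a partitioned register. -/
noncomputable def Circuit.onPieces (φ : (Σ q, R q) ≃ ι) (c : ∀ q, Circuit (R q)) : Circuit ι :=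
  Finset.univ.toList.flatMap fun q => (c q).map (piece φ q)

theorem Circuit.eval_onPieces (φ : (Σ q, R q) ≃ ι) (c : ∀ q, Circuit (R q)) :
    (Circuit.onPieces φ c).eval = opOn φ fun q => (c q).eval := by
  have h : ∀ L : List Q, L.Nodup → Circuit.eval (L.flatMap fun q => (c q).map (piece φ q)) =
      opOn φ fun q => if q ∈ L then (c q).eval else 1 := by
    intro L hL
    induction L with
    | nil => simp [Circuit.eval, opOn_one]
    | cons q L ih =>
      rw [List.flatMap_cons, Circuit.eval_append, ih hL.of_cons, Circuit.eval_map, applyAt_piece,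
        opOn_mul]
      congr 1
      funext q'
      by_cases hq : q' = q
      · subst hq
        rw [if_neg (List.nodup_cons.1 hL).1, if_pos List.mem_cons_self, Function.update_self,
          Matrix.one_mul]
      · rw [Function.update_of_ne hq, Matrix.mul_one]
        simp [hq]
  rw [Circuit.onPieces, h _ (Finset.nodup_toList _)]
  simp

theorem Circuit.mem_onPieces {φ : (Σ q, R q) ≃ ι} {c : ∀ q, Circuit (R q)} {g : PlacedGate ι}
    (hg : g ∈ Circuit.onPieces φ c) : ∃ q, ∃ g' ∈ c q, g = g'.map (piece φ q) := by
  obtain ⟨q, -, hq⟩ := List.mem_flatMap.1 hg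
  obtain ⟨g', hg', rfl⟩ := List.mem_map.1 hq
  exact ⟨q, g', hg', rfl⟩

theorem applyAt_refl (G : Op ι) : applyAt (Function.Embedding.refl ι) G = G := by
  ext x y
  simp [applyAt]
  rfl

/-- The partition of `m` blocks according to the position of the qubits in the blocks. -/
def columnEquiv (m : ℕ) (ι : Type) : (Σ _ : ι, Fin m) ≃ Fin m × ι :=
  (Equiv.sigmaEquivProd ι (Fin m)).trans (Equiv.prodComm _ _)

/-- The bitwise application of a gate to the corresponding qubits of the blocks. -/
noncomputable def bitwise (ι : Type) [Fintype ι] [DecidableEq ι] {k : ℕ} (g : Gate k) :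
    Circuit (Fin k × ι) :=
  Circuit.onPieces (columnEquiv k ι) fun _ => [⟨k, g, Function.Embedding.refl _⟩]

theorem eval_bitwise {k : ℕ} (g : Gate k) :
    (bitwise ι g).eval = opOn (columnEquiv k ι) fun _ => g.op := by
  rw [bitwise, Circuit.eval_onPieces]
  congr 1
  funext q
  simp [Circuit.eval, PlacedGate.op, applyAt_refl]

theorem bitwise_isLocal {k : ℕ} (g : Gate k) : (bitwise ι g).IsLocal Prod.snd := by
  intro g' hg' a b
  obtain ⟨q, g'', hg'', rfl⟩ := Circuit.mem_onPieces hg'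
  rfl

theorem transversal_opOn {k : ℕ} (A : ι → Op (Fin k)) : Transversal (opOn (columnEquiv k ι) A) :=
  ⟨A, rfl⟩

theorem opOn_diagonal (φ : (Σ q, R q) ≃ ι) (d : ∀ q, (R q → Fin 2) → ℂ) :
    opOn φ (fun q => Matrix.diagonal (d q)) =
      Matrix.diagonal fun x => ∏ q, d q fun r => x (φ ⟨q, r⟩) := by
  ext x y
  simp only [opOn, tensor, Matrix.submatrix_apply, Matrix.diagonal_apply, Finset.prod_ite_zero]
  by_cases h : x = y
  · subst h; simp; rfl
  · rw [if_neg h, if_neg]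
    intro h'
    exact h ((split φ).injective (funext fun q => h' q (Finset.mem_univ q)))

/-- A circuit on one block of a code, as an implementation of a logical single-qubit gate. -/
theorem implements_singleBlock {C : Enc ι} {c : Circuit ι} {M : Matrix (Fin 2) (Fin 2) ℂ}
    (h : c.eval * encMat C = encMat C * M) :
    Implements C (Circuit.onPieces (blockEquiv 1 ι) fun _ => c).eval (localOp fun _ => M) := by
  rw [Circuit.eval_onPieces]
  exact implements_blockOp (z := 1) (by simp) (by rw [h, one_smul]) 1

end Pieces

/-! ### Logical gates of the Reed–Muller code -/

section RMGates

open scoped Fin.CommRing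

theorem blockEnc_rmEnc_eq_zero {m : ℕ} {x : Fin m × Fin 15 → Fin 2} {l : Fin m → Fin 2}
    (h : ¬∃ c : Fin m → Fin 5 → Fin 2, (∀ j, c j 0 = l j) ∧ ∀ j i, x (j, i) = rmWord (c j) i) :
    blockEnc m rmEnc x l = 0 := by
  have : ∃ j, ¬∃ c, c 0 = l j ∧ (fun i => x (j, i)) = rmWord c := by
    by_contra! hc
    choose c hc hc' using hc
    exact h ⟨c, hc, fun j i => congrFun (hc' j) i⟩
  obtain ⟨j, hj⟩ := this
  exact Finset.prod_eq_zero (Finset.mem_univ j) (rmEnc_eq_zero hj)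

/-- The code consists of superpositions of words, so a bitwise diagonal gate implements the diagonal
gate that gives the same phases to the logical bits. -/
theorem rmEnc_implements_ctrlPhase {k : ℕ} {θ η : ℝ}
    (h : ∀ c : Fin (k + 1) → Fin 5 → Fin 2,
      (∏ i, if ∀ j, rmWord (c j) i = 1 then Complex.exp (θ * Complex.I) else 1) =
        if ∀ j, c j 0 = 1 then Complex.exp (η * Complex.I) else 1) :
    Implements rmEnc (opOn (columnEquiv (k + 1) (Fin 15)) fun _ => ctrlPhase k θ)
      (ctrlPhase k η) := by
  refine ⟨1, by simp, ?_⟩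
  simp only [ctrlPhase]
  rw [one_smul, opOn_diagonal]
  ext x l
  rw [Matrix.diagonal_mul, Matrix.mul_diagonal]
  by_cases hx : ∃ c : Fin (k + 1) → Fin 5 → Fin 2,
      (∀ j, c j 0 = l j) ∧ ∀ j i, x (j, i) = rmWord (c j) i
  · obtain ⟨c, hc, hx⟩ := hx
    have h' := h c
    simp only [hc, ← hx] at h'
    rw [← h', mul_comm]
    rfl
  · rw [blockEnc_rmEnc_eq_zero hx]; simp

/-- The words of `|l⟩` have weight `-l` modulo `8`. -/
theorem rmEnc_implements_phase {θ : ℝ} (hθ : Complex.exp (θ * Complex.I) ^ 8 = 1) :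
    Implements rmEnc (opOn (columnEquiv 1 (Fin 15)) fun _ => ctrlPhase 0 (-θ)) (ctrlPhase 0 θ) := by
  refine rmEnc_implements_ctrlPhase fun c => ?_
  have key : ∀ c : Fin 5 → Fin 2, ∃ n : Fin 3, (∑ i, (rmWord c i : ℕ)) + (c 0 : ℕ) = 8 * n := by
    decide +kernel
  obtain ⟨n, hn⟩ := key (c 0)
  have h₁ : ∀ (a : Fin 2) (z : ℂ), (if a = 1 then z else 1) = z ^ (a : ℕ) := by
    intro a z; fin_cases a <;> simp
  have h₀ : ∀ p : Fin (0 + 1) → Prop, (∀ j, p j) ↔ p 0 := fun p => Fin.forall_fin_one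
  simp only [h₀, h₁]
  rw [Finset.prod_pow_eq_pow_sum]
  have h₂ : Complex.exp (((-θ : ℝ) : ℂ) * Complex.I) * Complex.exp (θ * Complex.I) = 1 := by
    rw [← Complex.exp_add]; push_cast; simp
  have h₃ : Complex.exp (((-θ : ℝ) : ℂ) * Complex.I) ^ 8 = 1 := by
    have := congrArg (· ^ 8) h₂
    simpa only [mul_pow, hθ, mul_one, one_pow] using this
  have h₄ := congrArg (Complex.exp (((-θ : ℝ) : ℂ) * Complex.I) ^ ·) hn
  simp only [pow_add, pow_mul, h₃, one_pow] at h₄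
  calc _ = Complex.exp (((-θ : ℝ) : ℂ) * Complex.I) ^ (∑ i, (rmWord (c 0) i : ℕ)) *
        (Complex.exp (((-θ : ℝ) : ℂ) * Complex.I) * Complex.exp (θ * Complex.I)) ^ (c 0 0 : ℕ) := by
        rw [h₂, one_pow, mul_one]
    _ = _ := by rw [mul_pow, ← mul_assoc, h₄, one_mul]

/-- Controlled signs can be applied bitwise if the products of `k + 1` words have the parity of the
product of their logical bits. -/
theorem rmEnc_implements_sign {k : ℕ} (h : ∀ c : Fin (k + 1) → Fin 5 → Fin 2,
    ∑ i, ∏ j, rmWord (c j) i = ∏ j, c j 0) :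
    Implements rmEnc (opOn (columnEquiv (k + 1) (Fin 15)) fun _ => ctrlPhase k Real.pi)
      (ctrlPhase k Real.pi) := by
  refine rmEnc_implements_ctrlPhase fun c => ?_
  have h₁ : ∀ a : Fin (k + 1) → Fin 2,
      (if ∀ j, a j = 1 then Complex.exp (Real.pi * Complex.I) else 1) =
        ((bitSign (∏ j, a j) : ℤ) : ℂ) := by
    intro a
    rw [Complex.exp_pi_mul_I]
    split_ifs with ha
    · simp [ha, bitSign]
    · obtain ⟨j, hj⟩ := not_forall.1 ha
      have : a j = 0 := by
        generalize a j = b at hj; revert b; decide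
      rw [Finset.prod_eq_zero (Finset.mem_univ j) this]
      simp [bitSign]
  simp only [h₁]
  rw [← h c, bitSign_sum]
  push_cast
  rfl

theorem rmEnc_implements_bitwise_T :
    Implements rmEnc (bitwise (Fin 15) Gate.Tdg).eval Gate.T.op := by
  rw [eval_bitwise]
  refine rmEnc_implements_phase ?_
  rw [← Complex.exp_nat_mul, ← Complex.exp_two_pi_mul_I]
  push_cast
  ring_nf

theorem rmEnc_implements_bitwise_S :
    Implements rmEnc (bitwise (Fin 15) Gate.Sdg).eval Gate.S.op := by
  rw [eval_bitwise]
  refine rmEnc_implements_phase ?_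
  rw [← Complex.exp_nat_mul, Complex.exp_eq_one_iff]
  exact ⟨2, by push_cast; ring⟩

theorem rmEnc_implements_bitwise_CZ :
    Implements rmEnc (bitwise (Fin 15) Gate.CZ).eval Gate.CZ.op := by
  rw [eval_bitwise]
  refine rmEnc_implements_sign fun c => ?_
  simpa [Fin.prod_univ_succ] using sum_rmWord_mul (c 0) (c 1)

theorem rmEnc_implements_bitwise_CCZ :
    Implements rmEnc (bitwise (Fin 15) Gate.CCZ).eval Gate.CCZ.op := by
  rw [eval_bitwise]
  refine rmEnc_implements_sign fun c => ?_
  simpa [Fin.prod_univ_succ, mul_assoc] using sum_rmWord_mul_mul (c 0) (c 1) (c 2)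

theorem rmEnc_implements_bitwise_CNOT :
    Implements rmEnc (bitwise (Fin 15) Gate.CNOT).eval Gate.CNOT.op := by
  rw [eval_bitwise]
  refine ⟨1, by simp, ?_⟩
  rw [one_smul]
  ext x l
  have h2 : ∀ a b : Fin 2, a = a + b + b := by decide
  have h3 : ∀ a b c d : Fin 2, (a = b ∧ c = d + b) ↔ (b = a ∧ d = c + a) := by decide
  -- both sides reduce to one term, since `CNOT` permutes the basis states
  have hV : ∀ y, (opOn (columnEquiv 2 (Fin 15)) fun _ => Gate.CNOT.op) x y =
      ∏ i, cnotOp (fun j => x (j, i)) (fun j => y (j, i)) := fun _ => rfl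
  have hl : ((opOn (columnEquiv 2 (Fin 15)) fun _ => Gate.CNOT.op) * blockEnc 2 rmEnc) x l =
      blockEnc 2 rmEnc (fun p => if p.1 = 0 then x (0, p.2) else x (1, p.2) + x (0, p.2)) l := by
    rw [Matrix.mul_apply, Finset.sum_eq_single
      (fun p => if p.1 = 0 then x (0, p.2) else x (1, p.2) + x (0, p.2))]
    · convert one_mul _
      rw [hV]
      refine Finset.prod_eq_one fun i _ => if_pos ⟨rfl, ?_⟩
      exact h2 _ _
    · intro y _ hy
      convert zero_mul _
      by_contra hne
      refine hy ?_
      have hy' : ∀ i, y (0, i) = x (0, i) ∧ y (1, i) = x (1, i) + x (0, i) := by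
        intro i
        by_contra hi
        refine hne ((hV y).trans <| Finset.prod_eq_zero (Finset.mem_univ i) (if_neg fun hc => hi ?_))
        exact (h3 _ _ _ _).1 hc
      funext ⟨j, i⟩
      fin_cases j
      · exact (hy' i).1
      · exact (hy' i).2
    · simp
  have hr : (blockEnc 2 rmEnc * Gate.CNOT.op) x l = blockEnc 2 rmEnc x ![l 0, l 1 + l 0] := by
    rw [Matrix.mul_apply, Finset.sum_eq_single ![l 0, l 1 + l 0]]
    · convert mul_one _
      exact if_pos ⟨rfl, rfl⟩
    · intro y _ hy
      convert mul_zero _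
      refine if_neg fun hc => hy ?_
      funext j
      fin_cases j
      · exact hc.1
      · exact hc.2.trans (by rfl)
    · simp
  rw [hl, hr]
  simp only [blockEnc, Fin.prod_univ_two]
  simp only [if_true, one_ne_zero, if_false, Matrix.cons_val_zero, Matrix.cons_val_one]
  by_cases h : ∃ c, c 0 = l 0 ∧ (fun i => x (0, i)) = rmWord c
  · obtain ⟨c, hc, hx⟩ := h
    rw [← hc, ← rmEnc_add_rmWord, ← hx]
    refine congrArg (rmEnc (c 0) _ * rmEnc (l 1) ·) ?_
    funext i
    rfl
  · rw [rmEnc_eq_zero h, zero_mul, zero_mul]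

end RMGates

/-! ### Decoding circuits for the Reed–Muller code -/

section Decode

theorem Circuit.eval_reverse_mul {ι : Type} [Fintype ι] [DecidableEq ι] {c : Circuit ι}
    (h : ∀ g ∈ c, g.op * g.op = 1) : Circuit.eval c.reverse * c.eval = 1 := by
  induction c with
  | nil => simp [Circuit.eval]
  | cons g c ih =>
    have ih := ih fun g' hg' => h g' (List.mem_cons_of_mem _ hg')
    rw [List.reverse_cons, Circuit.eval_append]
    have h₁ : Circuit.eval [g] = g.op := by simp [Circuit.eval]
    rw [h₁, Circuit.eval, Matrix.mul_assoc, ← Matrix.mul_assoc (Circuit.eval c.reverse), ih, Matrix.one_mul,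
      h g List.mem_cons_self]

open scoped Fin.CommRing

variable {n : ℕ}

/-- Two distinct qubits of a register. -/
def wirePair {ι : Type} (a b : ι) (h : a ≠ b) : Fin 2 ↪ ι :=
  ⟨![a, b], by intro i j; fin_cases i <;> fin_cases j <;> simp [h, h.symm]⟩

theorem wirePair_zero {ι : Type} {a b : ι} (h : a ≠ b) : wirePair a b h 0 = a := rfl

theorem wirePair_one {ι : Type} {a b : ι} (h : a ≠ b) : wirePair a b h 1 = b := rfl

/-- Controlled-NOT gates from qubit `0` to the other qubits of a list. -/
def fanOut (L : List (Fin n)) : Circuit (Fin (n + 1)) :=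
  L.map fun t => ⟨2, .CNOT, wirePair 0 t.succ (Fin.succ_ne_zero t).symm⟩

/-- Controlled-NOT gates from the qubits of a list to qubit `0`. -/
def fanIn (L : List (Fin n)) : Circuit (Fin (n + 1)) :=
  L.map fun t => ⟨2, .CNOT, wirePair t.succ 0 (Fin.succ_ne_zero t)⟩

theorem eval_fanOut_mul_apply {α : Type*} {L : List (Fin n)} (hL : L.Nodup)
    (M : Matrix (Fin (n + 1) → Fin 2) α ℂ) (x : Fin (n + 1) → Fin 2) (a : α) :
    ((fanOut L).eval * M) x a =
      M (Fin.cons (x 0) fun t => if t ∈ L then x t.succ + x 0 else x t.succ) a := by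
  induction L generalizing M with
  | nil =>
    simp only [fanOut, List.map_nil, Circuit.eval, Matrix.one_mul, List.not_mem_nil, if_false]
    congr 1
    exact (Fin.cons_self_tail x).symm
  | cons t L ih =>
    rw [fanOut, List.map_cons, Circuit.eval, Matrix.mul_assoc]
    refine (ih hL.of_cons _).trans ?_
    refine (applyAt_cnotOp_mul_apply _ _ _ _).trans ?_
    congr 1
    rw [wirePair_zero, wirePair_one]
    have ht := (List.nodup_cons.1 hL).1
    funext j
    refine Fin.cases ?_ (fun i => ?_) j
    · rw [Function.update_of_ne (Fin.succ_ne_zero t).symm]; rfl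
    · by_cases hi : i = t
      · subst hi; simp [ht]
      · simp [hi]

theorem eval_fanIn_mul_apply {α : Type*} (L : List (Fin n))
    (M : Matrix (Fin (n + 1) → Fin 2) α ℂ) (x : Fin (n + 1) → Fin 2) (a : α) :
    ((fanIn L).eval * M) x a = M (Function.update x 0 (x 0 + (L.map fun t => x t.succ).sum)) a := by
  induction L generalizing M with
  | nil => simp [fanIn, Circuit.eval]
  | cons t L ih =>
    rw [fanIn, List.map_cons, Circuit.eval, Matrix.mul_assoc]
    refine (ih _).trans ?_
    refine (applyAt_cnotOp_mul_apply _ _ _ _).trans ?_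
    congr 1
    rw [wirePair_zero, wirePair_one, Function.update_idem, Function.update_self,
      Function.update_of_ne (Fin.succ_ne_zero t), List.map_cons, List.sum_cons, add_assoc,
      add_comm (x t.succ)]

/-- A circuit that moves the logical qubit of the Reed–Muller code to qubit `0`. -/
def rmDecode : Circuit (Fin 15) := fanOut (List.finRange 14) ++ fanIn (List.finRange 14)

theorem rmDecode_involutive (g : PlacedGate (Fin 15)) (hg : g ∈ rmDecode) : g.op * g.op = 1 := by
  rcases List.mem_append.1 hg with h | h <;> obtain ⟨t, -, rfl⟩ := List.mem_map.1 h <;>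
    exact applyAt_cnotOp_mul_self _

/-- The state of the remaining qubits after decoding. -/
noncomputable def rmRest (y : Fin 14 → Fin 2) : ℂ :=
  rmEnc 0 (Fin.cons (∑ t, y t) fun t => y t + ∑ t, y t)

/-- Decoding leaves the logical qubit at qubit `0`, in a product with a fixed state. -/
theorem rmDecode_mul_encMat (x : Fin 15 → Fin 2) (l : Fin 2) :
    (rmDecode.eval * encMat rmEnc) x l = if x 0 = l then rmRest fun t => x t.succ else 0 := by
  rw [rmDecode, Circuit.eval_append, Matrix.mul_assoc, eval_fanIn_mul_apply,
    eval_fanOut_mul_apply (List.nodup_finRange _)]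
  have hs : ((List.finRange 14).map fun t => x t.succ).sum = ∑ t : Fin 14, x t.succ := by
    rw [← List.ofFn_eq_map, List.sum_ofFn]
  set S := ∑ t : Fin 14, x t.succ with hS
  set y₀ : Fin 15 → Fin 2 := Fin.cons S fun t => x t.succ + S with hy₀
  have hones : rmWord (Pi.single 0 (x 0)) = fun _ => x 0 := by
    funext j; generalize x 0 = a; revert a j; decide +kernel
  have hy : (Fin.cons (Function.update x 0 (x 0 + S) 0) fun t : Fin 14 =>
      if t ∈ List.finRange 14 then
        Function.update x 0 (x 0 + S) t.succ + Function.update x 0 (x 0 + S) 0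
      else Function.update x 0 (x 0 + S) t.succ) = y₀ + rmWord (Pi.single 0 (x 0)) := by
    rw [hones]
    funext j
    refine Fin.cases ?_ (fun i => ?_) j
    · simp [hy₀, add_comm]
    · simp [hy₀, add_left_comm, add_comm]
  rw [hs, hy]
  change rmEnc l _ = _
  rw [rmEnc_add_rmWord, Pi.single_eq_same]
  have h₀ : ∀ a b : Fin 2, a + b = if b = a then 0 else 1 := by decide
  rw [h₀]
  split_ifs with h
  · rfl
  · refine rmEnc_eq_zero ?_
    rintro ⟨c, hc, hc'⟩
    have h₁ := sum_rmWord c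
    rw [hc, ← hc', hy₀, Fin.sum_univ_succ] at h₁
    simp only [Fin.cons_zero, Fin.cons_succ, Finset.sum_add_distrib, ← hS] at h₁
    have h₂ : ∀ a : Fin 2, a + (a + ∑ _ : Fin 14, a) ≠ 1 := by decide
    exact h₂ _ h₁

/-- Every single-qubit gate has an implementation on the Reed–Muller code: decode, apply the gate,
and encode. -/
theorem rmEnc_exists_circuit (g : Gate 1) {M : Matrix (Fin 2) (Fin 2) ℂ}
    (hg : g.op = localOp fun _ => M) :
    ∃ c : Circuit (Fin 15), c.eval * encMat rmEnc = encMat rmEnc * M := by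
  obtain ⟨e, he⟩ : ∃ e : Fin 1 ↪ Fin 15, ∀ k, e k = 0 :=
    ⟨⟨fun _ => 0, fun _ _ _ => Subsingleton.elim _ _⟩, fun _ => rfl⟩
  refine ⟨rmDecode ++ ([⟨1, g, e⟩] ++ rmDecode.reverse), ?_⟩
  have h : applyAt e g.op * (rmDecode.eval * encMat rmEnc) =
      rmDecode.eval * encMat rmEnc * M := by
    ext x l
    rw [applyAt_mul_apply, Matrix.mul_apply, Finset.sum_eq_single (fun _ => l),
      Finset.sum_eq_single (x 0)]
    · have h₀ : Function.extend e (fun _ => l) x 0 = l := by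
        rw [← he 0, e.injective.extend_apply]
      have h₁ : (fun t : Fin 14 => Function.extend e (fun _ => l) x t.succ) =
          fun t => x t.succ := by
        funext t
        rw [Function.extend_apply']
        rintro ⟨k, hk⟩
        exact Fin.succ_ne_zero t (hk.symm.trans (he k))
      have h₂ : g.op (x ∘ e) (fun _ => l) = M (x 0) l := by
        rw [hg]
        simp [localOp, he]
      rw [rmDecode_mul_encMat, rmDecode_mul_encMat, if_pos rfl, if_pos h₀, h₁, h₂, mul_comm]
    · intro b _ hb
      rw [rmDecode_mul_encMat, if_neg hb.symm, zero_mul]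
    · simp
    · intro u _ hu
      rw [rmDecode_mul_encMat, if_neg, mul_zero]
      intro h
      refine hu (funext fun k => ?_)
      rw [← h, Subsingleton.elim k 0, ← he 0, e.injective.extend_apply]
    · simp
  have h₁ : Circuit.eval [(⟨1, g, e⟩ : PlacedGate (Fin 15))] = applyAt e g.op := by
    simp [Circuit.eval, PlacedGate.op]
  rw [Circuit.eval_append, Circuit.eval_append, h₁, Matrix.mul_assoc, Matrix.mul_assoc, h,
    Matrix.mul_assoc, ← Matrix.mul_assoc, Circuit.eval_reverse_mul rmDecode_involutive,
    Matrix.one_mul]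

end Decode

/-! ### Concatenated codes -/

section Enc

variable {ι : Type} [Fintype ι] [DecidableEq ι]

theorem isEncoding_iff {C : Enc ι} : IsEncoding C ↔ (encMat C)ᴴ * encMat C = 1 := by
  constructor
  · intro h
    ext l l'
    rw [Matrix.one_apply, ← h l l']
    rfl
  · intro h l l'
    rw [← Matrix.one_apply, ← h]
    rfl

theorem Stabilizes.mul_encMat {C : Enc ι} {σ : ℤˣ} {P : ι → Pauli} (h : Stabilizes C σ P) :
    pauliOp P * encMat C = ((σ : ℤ) : ℂ) • encMat C :=
  (mul_encMat_eq_iff _ _ _ _).2 h.mulVec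

theorem stabilizes_of_mul_encMat {C : Enc ι} {σ : ℤˣ} {P : ι → Pauli}
    (h : pauliOp P * encMat C = ((σ : ℤ) : ℂ) • encMat C) : Stabilizes C σ P := by
  intro l
  rw [Matrix.smul_mulVec, (mul_encMat_eq_iff _ _ _ _).1 h l, smul_smul, units_mul_self_cast,
    one_smul]

/-- A code on which the transversal Pauli operators act as the logical ones, up to signs, and on
which every Pauli string commuting with the stabilizer acts as a logical Pauli operator. -/
structure HasLogicalPaulis (C : Enc ι) (s : Pauli → ℤˣ) : Prop where
  isEncoding : IsEncoding C
  transversal : ∀ L : Pauli, pauliOp (fun _ : ι => L) * encMat C = ((s L : ℤ) : ℂ) • (encMat C * L.mat)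
  logical : ∀ P, InNormalizer C P → ∃ (L : Pauli) (z : ℂ), pauliOp P * encMat C =
    z • (encMat C * L.mat)

/-- Every nontrivial Pauli string that acts on at most two qubits is detected by the stabilizer. -/
def DetectsPairs (C : Enc ι) : Prop :=
  ∀ P, InNormalizer C P → ∀ q q', (∀ i, i ≠ q → i ≠ q' → P i = 1) → P = 1

/-- A Pauli string and the logical operator by which it acts have the same commutation relations
with the transversal Pauli operators. -/
theorem HasLogicalPaulis.commSign_eq {C : Enc ι} {s : Pauli → ℤˣ} (hC : HasLogicalPaulis C s)
    {P : ι → Pauli} {L : Pauli} {z : ℂ} (h : pauliOp P * encMat C = z • (encMat C * L.mat))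
    (K : Pauli) : commSign (fun _ => K) P = Pauli.commSign K L := by
  have hE := isEncoding_iff.1 hC.isEncoding
  have hz : z ≠ 0 := by
    rintro rfl
    rw [zero_smul] at h
    have h₁ : (encMat C)ᴴ * (pauliOp P * (pauliOp P * encMat C)) = 1 := by
      rw [← Matrix.mul_assoc (pauliOp P), pauliOp_sq, Matrix.one_mul, hE]
    rw [h, Matrix.mul_zero, Matrix.mul_zero] at h₁
    exact zero_ne_one h₁
  have hs : (((s K : ℤˣ) : ℤ) : ℂ) ≠ 0 := by simp
  have h₁ : pauliOp (fun _ : ι => K) * pauliOp P * encMat C =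
      (z * ((s K : ℤ) : ℂ) * ((Pauli.commSign K L : ℤ) : ℂ)) • (encMat C * (L.mat * K.mat)) := by
    rw [Matrix.mul_assoc, h, Matrix.mul_smul, ← Matrix.mul_assoc, hC.transversal, Matrix.smul_mul,
      Matrix.mul_assoc, Pauli.mat_comm K L, Matrix.mul_smul, smul_smul, smul_smul, mul_assoc]
  have h₂ : pauliOp P * pauliOp (fun _ : ι => K) * encMat C =
      (z * ((s K : ℤ) : ℂ)) • (encMat C * (L.mat * K.mat)) := by
    rw [Matrix.mul_assoc, hC.transversal, Matrix.mul_smul, ← Matrix.mul_assoc, h, Matrix.smul_mul,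
      Matrix.mul_assoc, smul_smul, mul_comm z]
  rw [pauliOp_comm, Matrix.smul_mul, h₂, smul_smul] at h₁
  have h₃ := congrArg (fun M => (encMat C)ᴴ * M * (K.mat * L.mat)) h₁
  have h₄ : (encMat C)ᴴ * (encMat C * (L.mat * K.mat)) * (K.mat * L.mat) = 1 := by
    rw [← Matrix.mul_assoc _ (encMat C), hE, Matrix.one_mul, Matrix.mul_assoc,
      ← Matrix.mul_assoc K.mat, Pauli.mat_sq, Matrix.one_mul, Pauli.mat_sq]
  simp only [Matrix.mul_smul, Matrix.smul_mul, h₄] at h₃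
  have h₅ := congrFun (congrFun h₃ 0) 0
  simp only [Matrix.smul_apply, Matrix.one_apply_eq, smul_eq_mul, mul_one] at h₅
  have h₆ : ((commSign (fun _ : ι => K) P : ℤ) : ℂ) = ((Pauli.commSign K L : ℤ) : ℂ) :=
    mul_right_cancel₀ (mul_ne_zero hz hs) (h₅.trans (mul_comm _ _))
  exact Units.ext (by exact_mod_cast h₆)

end Enc

section Concat

variable {C : Code} {c : Fin C.n → Code}

/-- The partition of a concatenated code into the inner codes. -/
def innerEquiv (C : Code) (c : Fin C.n → Code) : (Σ q, Fin (c q).n) ≃ ConcatReg C c := Equiv.refl _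

theorem encMat_concat (C : Code) (c : Fin C.n → Code) : encMat (concat C c) =
    tensorOn (innerEquiv C c) (fun q => encMat (c q).ket) * encMat C.ket := by
  ext x l
  rw [Matrix.mul_apply]
  exact Finset.sum_congr rfl fun y _ => mul_comm _ _

theorem isEncoding_concat (hC : IsEncoding C.ket) (hc : ∀ q, IsEncoding (c q).ket) :
    IsEncoding (concat C c) := by
  rw [isEncoding_iff] at hC ⊢
  rw [encMat_concat, Matrix.conjTranspose_mul, Matrix.mul_assoc, ← Matrix.mul_assoc _ _ (encMat _),
    tensorOn_conjTranspose_mul]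
  simp only [fun q => isEncoding_iff.1 (hc q)]
  rw [tensor_one, Matrix.one_mul, hC]

theorem pauliOp_mul_inner (P : ConcatReg C c → Pauli) :
    pauliOp P * tensorOn (innerEquiv C c) (fun q => encMat (c q).ket) =
      tensorOn (innerEquiv C c) fun q => pauliOp (fun i => P ⟨q, i⟩) * encMat (c q).ket := by
  have h : pauliOp P = opOn (innerEquiv C c) fun q => pauliOp fun i => P ⟨q, i⟩ :=
    localOp_eq_opOn (innerEquiv C c) fun x => (P x).mat
  rw [h, opOn_mul_tensorOn]

theorem commSign_concat (P P' : ConcatReg C c → Pauli) :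
    commSign P P' = ∏ q, commSign (fun i => P ⟨q, i⟩) (fun i => P' ⟨q, i⟩) :=
  Fintype.prod_sigma _

/-- The stabilizer of an inner code belongs to the stabilizer of the concatenated code. -/
theorem stabilizes_concat_inner {q : Fin C.n} {σ : ℤˣ} {P : Fin (c q).n → Pauli}
    (h : Stabilizes (c q).ket σ P) :
    Stabilizes (concat C c) σ fun x =>
      Function.update (fun q (_ : Fin (c q).n) => (1 : Pauli)) q P x.1 x.2 := by
  refine stabilizes_of_mul_encMat ?_
  rw [encMat_concat, ← Matrix.mul_assoc, pauliOp_mul_inner, ← Matrix.smul_mul]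
  congr 1
  have h₁ : ∏ q', (if q' = q then ((σ : ℤ) : ℂ) else 1) = ((σ : ℤ) : ℂ) := by simp
  rw [← h₁, ← tensorOn_smul]
  congr 1
  funext q'
  by_cases hq : q' = q
  · subst hq
    simp only [Function.update_self, if_true]
    exact h.mul_encMat
  · simp only [Function.update_of_ne hq, if_neg hq, one_smul]
    exact (congrArg (· * encMat (c q').ket) pauliOp_one).trans (Matrix.one_mul _)

theorem InNormalizer.inner {E : ConcatReg C c → Pauli} (hE : InNormalizer (concat C c) E)
    (q : Fin C.n) : InNormalizer (c q).ket fun i => E ⟨q, i⟩ := by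
  intro σ P hP
  have := hE _ _ (stabilizes_concat_inner hP)
  rw [commSign_concat, Finset.prod_eq_single q] at this
  · simpa only [Function.update_self] using this
  · intro q' _ hq
    simp only [Function.update_of_ne hq]
    exact Finset.prod_eq_one fun _ _ => by simp [Pauli.commSign]
  · simp

variable {s : Fin C.n → Pauli → ℤˣ}

theorem inner_transversal (hc : ∀ q, HasLogicalPaulis (c q).ket (s q)) (P : Fin C.n → Pauli) :
    pauliOp (fun x : ConcatReg C c => P x.1) *
        tensorOn (innerEquiv C c) (fun q => encMat (c q).ket) =
      (∏ q, ((s q (P q) : ℤ) : ℂ)) •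
        (tensorOn (innerEquiv C c) (fun q => encMat (c q).ket) * pauliOp P) := by
  rw [pauliOp_mul_inner]
  simp only [fun q => (hc q).transversal (P q)]
  refine (tensorOn_smul _ (fun q => ((s q (P q) : ℤ) : ℂ)) _).trans (congrArg _ ?_)
  exact (tensorOn_mul_tensor _ (fun q => encMat (c q).ket) fun q => (P q).mat).symm

/-- The stabilizer of the outer code, encoded by transversal Pauli operators of the inner codes,
belongs to the stabilizer of the concatenated code. -/
theorem stabilizes_concat_outer (hc : ∀ q, HasLogicalPaulis (c q).ket (s q)) {σ : ℤˣ}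
    {P : Fin C.n → Pauli} (h : Stabilizes C.ket σ P) :
    Stabilizes (concat C c) ((∏ q, s q (P q)) * σ) fun x => P x.1 := by
  refine stabilizes_of_mul_encMat ?_
  rw [encMat_concat, ← Matrix.mul_assoc, inner_transversal hc, Matrix.smul_mul, Matrix.mul_assoc,
    h.mul_encMat, Matrix.mul_smul, smul_smul]
  push_cast
  rfl

/-- Errors confined to two of the inner codes that are not detected act trivially: they act as a
logical Pauli operator on each of the two inner codes, and the outer code detects these. -/
theorem exists_scalar_concat (hC : DetectsPairs C.ket)
    (hc : ∀ q, HasLogicalPaulis (c q).ket (s q)) {E : ConcatReg C c → Pauli}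
    (hE : InNormalizer (concat C c) E) {q₁ q₂ : Fin C.n}
    (hq : ∀ q, q ≠ q₁ → q ≠ q₂ → ∀ i, E ⟨q, i⟩ = 1) :
    ∃ z : ℂ, ∀ l, pauliOp E *ᵥ concat C c l = z • concat C c l := by
  have h : ∀ q, ∃ (L : Pauli) (z : ℂ), pauliOp (fun i => E ⟨q, i⟩) * encMat (c q).ket =
      z • (encMat (c q).ket * L.mat) ∧ (q ≠ q₁ → q ≠ q₂ → L = 1) := by
    intro q
    by_cases h : q ≠ q₁ ∧ q ≠ q₂
    · refine ⟨1, 1, ?_, fun _ _ => rfl⟩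
      have : (fun i => E ⟨q, i⟩) = 1 := funext (hq q h.1 h.2)
      rw [this, pauliOp_one, Pauli.mat_one, Matrix.one_mul, Matrix.mul_one, one_smul]
    · obtain ⟨L, z, hL⟩ := (hc q).logical _ (hE.inner q)
      exact ⟨L, z, hL, fun h₁ h₂ => absurd ⟨h₁, h₂⟩ h⟩
  choose L z hL hL' using h
  have hn : InNormalizer C.ket L := by
    intro σ P hP
    have h₁ := hE _ _ (stabilizes_concat_outer hc hP)
    rw [commSign_concat] at h₁
    rw [← h₁]
    exact Finset.prod_congr rfl fun q _ => ((hc q).commSign_eq (hL q) (P q)).symm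
  have hL₁ : L = 1 := hC L hn q₁ q₂ hL'
  refine ⟨∏ q, z q, (mul_encMat_eq_iff _ _ _ _).1 ?_⟩
  rw [encMat_concat, ← Matrix.mul_assoc, pauliOp_mul_inner, ← Matrix.smul_mul, ← tensorOn_smul]
  congr 2
  funext q
  rw [hL, hL₁, Pi.one_apply, Pauli.mat_one, Matrix.mul_one]

/-- The Pauli errors that are arbitrary on one of the inner codes, act on at most one qubit of each
of the other inner codes at the places in `T`, and are trivial on the remaining inner codes. -/
def concatErrors (C : Code) (c : Fin C.n → Code) (T : Set (Fin C.n)) :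
    Set (ConcatReg C c → Pauli) :=
  {E | ∃ q₀, ∀ q, q ≠ q₀ →
    (∃ i₀, ∀ i, i ≠ i₀ → E ⟨q, i⟩ = 1) ∧ (q ∉ T → ∀ i, E ⟨q, i⟩ = 1)}

theorem exists_decoder_concat (hC : IsEncoding C.ket) (hC' : DetectsPairs C.ket)
    (hc : ∀ q, HasLogicalPaulis (c q).ket (s q)) {T : Set (Fin C.n)}
    (hT : ∀ q ∈ T, DetectsPairs (c q).ket) :
    ∃ D : Decoder (concat C c), ∀ E ∈ concatErrors C c T, D.Corrects (pauliOp E) := by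
  refine exists_decoder (isEncoding_concat hC fun q => (hc q).isEncoding) _ ?_
  rintro E ⟨q₁, h₁⟩ E' ⟨q₂, h₂⟩ hn
  refine exists_scalar_concat hC' hc hn (q₁ := q₁) (q₂ := q₂) fun q hq hq' => ?_
  obtain ⟨⟨i₁, hi₁⟩, h₁⟩ := h₁ q hq
  obtain ⟨⟨i₂, hi₂⟩, h₂⟩ := h₂ q hq'
  by_cases hqT : q ∈ T
  · refine congrFun (hT q hqT _ (hn.inner q) i₁ i₂ fun i h h' => ?_)
    rw [Pi.mul_apply, hi₁ i h, hi₂ i h']; rfl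
  · intro i
    rw [Pi.mul_apply, h₁ hqT i, h₂ hqT i]; rfl

/-- A code that detects the errors on pairs of qubits corrects the errors on single qubits. -/
theorem DetectsPairs.exists_decoder {ι : Type} [Fintype ι] [DecidableEq ι] {C : Enc ι}
    (hC : IsEncoding C) (h : DetectsPairs C) : ∃ D : Decoder C, D.CorrectsSingleErrors := by
  obtain ⟨D, hD⟩ := ConcatFT.exists_decoder hC {E | ∃ q, ∀ i, i ≠ q → E i = 1} (by
    rintro E ⟨q, hq⟩ E' ⟨q', hq'⟩ hn
    refine ⟨1, fun l => ?_⟩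
    rw [h _ hn q q' fun i hi hi' => by rw [Pi.mul_apply, hq i hi, hq' i hi']; rfl, pauliOp_one,
      Matrix.one_mulVec, one_smul])
  exact ⟨D, D.correctsSingleErrors fun q P hP => hD P ⟨q, hP⟩⟩

end Concat

section Instances

theorem rmEnc_hasLogicalPaulis : HasLogicalPaulis rmEnc rmLogicalSign := by
  have h (L : Pauli) : encMat rmEnc * L.mat = encMat fun l => ∑ b, L.mat b l • rmEnc b := by
    ext x l
    rw [Matrix.mul_apply, encMat, Finset.sum_apply]
    exact Finset.sum_congr rfl fun b _ => mul_comm _ _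
  refine ⟨rmEnc_isEncoding, fun L => ?_, fun P hP => ?_⟩
  · rw [h, mul_encMat_eq_iff]
    exact rmEnc_transversal_pauli L
  · obtain ⟨L, z, hL⟩ := hP.exists_logical
    exact ⟨L, z, by rw [h, mul_encMat_eq_iff]; exact hL⟩

/-- The logical basis of a bare qubit. -/
noncomputable def bareEnc : Enc (Fin 1) := bareQubit.ket

theorem encMat_bareEnc (x : Fin 1 → Fin 2) (l : Fin 2) :
    encMat bareEnc x l = if x 0 = l then 1 else 0 := by
  change (Pi.single (fun _ => l) 1 : State (Fin 1)) x = _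
  rw [Pi.single_apply]
  congr 1
  simp only [funext_iff, Fin.forall_fin_one]

theorem localOp_mul_encMat_bareEnc (A : Fin 1 → Matrix (Fin 2) (Fin 2) ℂ) :
    localOp A * encMat bareEnc = encMat bareEnc * A 0 := by
  ext x l
  rw [Matrix.mul_apply, Matrix.mul_apply, Finset.sum_eq_single (fun _ => l),
    Finset.sum_eq_single (x 0)]
  · simp [encMat_bareEnc, localOp]
  · intro b _ hb
    rw [encMat_bareEnc, if_neg hb.symm, zero_mul]
  · simp
  · intro y _ hy
    rw [encMat_bareEnc, if_neg, mul_zero]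
    intro h
    exact hy (funext fun k => by rw [Subsingleton.elim k 0, h])
  · simp

theorem bareEnc_isEncoding : IsEncoding bareEnc := by
  rw [isEncoding_iff]
  ext l l'
  rw [Matrix.mul_apply, Finset.sum_eq_single (fun _ => l)]
  · simp [Matrix.conjTranspose_apply, encMat_bareEnc, Matrix.one_apply]
  · intro y _ hy
    rw [Matrix.conjTranspose_apply, encMat_bareEnc, if_neg, star_zero, zero_mul]
    intro h
    exact hy (funext fun k => by rw [Subsingleton.elim k 0, h])
  · simp

theorem bareEnc_hasLogicalPaulis : HasLogicalPaulis bareEnc 1 := by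
  refine ⟨bareEnc_isEncoding, fun L => ?_, fun P _ => ⟨P 0, 1, ?_⟩⟩
  · rw [Pi.one_apply, Units.val_one, Int.cast_one, one_smul]
    exact localOp_mul_encMat_bareEnc fun _ => L.mat
  · rw [one_smul]
    exact localOp_mul_encMat_bareEnc fun i => (P i).mat

end Instances

/-! ### Circuits on blocks of a concatenated code -/

section Lift

variable {C : Code} {c : Fin C.n → Code} {m : ℕ}

/-- The partition of `m` blocks of a concatenated code into the inner codes. -/
def innersEquiv (C : Code) (c : Fin C.n → Code) (m : ℕ) :
    (Σ p : Fin m × Fin C.n, Fin (c p.2).n) ≃ Fin m × ConcatReg C c where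
  toFun x := (x.1.1, ⟨x.1.2, x.2⟩)
  invFun y := ⟨(y.1, y.2.1), y.2.2⟩
  left_inv _ := rfl
  right_inv _ := rfl

/-- The encoding of all the qubits of `m` blocks of the outer code by the inner codes. -/
noncomputable def innerEnc (C : Code) (c : Fin C.n → Code) (m : ℕ) :
    Matrix (Fin m × ConcatReg C c → Fin 2) (Fin m × Fin C.n → Fin 2) ℂ :=
  tensorOn (innersEquiv C c m) fun p => encMat (c p.2).ket

theorem blockEnc_concat : blockEnc m (concat C c) = innerEnc C c m * blockEnc m C.ket := by
  have h₁ : blockEnc m (concat C c) =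
      tensorOn (blockEquiv m (ConcatReg C c)) (fun _ : Fin m => tensorOn (innerEquiv C c)
        fun q => encMat (c q).ket) * tensor fun _ : Fin m => encMat C.ket := by
    rw [tensorOn_mul_tensor, blockEnc_eq_tensorOn]
    simp only [encMat_concat]
  have h₂ : innerEnc C c m = (tensorOn (blockEquiv m (ConcatReg C c)) (fun _ : Fin m =>
      tensorOn (innerEquiv C c) fun q => encMat (c q).ket)).submatrix id
        (split (blockEquiv m (Fin C.n))) := by
    ext x y
    exact Fintype.prod_prod_type _
  have h₃ : blockEnc m C.ket = (tensor fun _ : Fin m => encMat C.ket).submatrix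
      (split (blockEquiv m (Fin C.n))) id := rfl
  rw [h₁, h₂, h₃, Matrix.submatrix_mul_equiv, Matrix.submatrix_id_id]

/-- The basis states of equal codes, along the identification of their registers. -/
theorem ket_cast {D B : Code} (h : D = B) (b : Fin 2) (f : Fin D.n → Fin 2) :
    D.ket b f = B.ket b fun i => f (Fin.cast (congrArg Code.n h.symm) i) := by
  subst h; rfl

variable {κ : Type} [Fintype κ] [DecidableEq κ] {B : Code}

/-- The qubits of the inner codes at the places `p a`, all of which are copies of `B`. -/
def liftWires (p : κ ↪ Fin m × Fin C.n) (h : ∀ a, c (p a).2 = B) :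
    κ × Fin B.n ↪ Fin m × ConcatReg C c where
  toFun x := innersEquiv C c m ⟨p x.1, Fin.cast (congrArg Code.n (h x.1).symm) x.2⟩
  inj' := by
    rintro ⟨a, i⟩ ⟨a', i'⟩ hx
    have h₁ := (innersEquiv C c m).injective hx
    have h₂ : a = a' := p.injective (congrArg Sigma.fst h₁)
    subst h₂
    have h₃ := eq_of_heq (Sigma.mk.inj h₁).2
    rw [Fin.cast_inj] at h₃
    exact Prod.ext rfl h₃

theorem innerEnc_apply {k : ℕ} (p : Fin k ↪ Fin m × Fin C.n) (h : ∀ a, c (p a).2 = B)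
    (x : Fin m × ConcatReg C c → Fin 2) (y : Fin m × Fin C.n → Fin 2) :
    innerEnc C c m x y = blockEnc k B.ket (x ∘ liftWires p h) (y ∘ p) *
      ∏ q ∈ (Finset.univ.map p)ᶜ,
        (c q.2).ket (y q) fun i => x (innersEquiv C c m ⟨q, i⟩) := by
  have h₁ : innerEnc C c m x y =
      ∏ q, (c q.2).ket (y q) fun i => x (innersEquiv C c m ⟨q, i⟩) := rfl
  rw [h₁, ← Finset.prod_mul_prod_compl (Finset.univ.map p), Finset.prod_map]
  congr 1
  exact Finset.prod_congr rfl fun a _ => ket_cast (h a) _ _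

/-- Logical operators of the inner codes, on some of the qubits of the outer code. -/
theorem applyAt_liftWires_mul_innerEnc {k : ℕ} (p : Fin k ↪ Fin m × Fin C.n)
    (h : ∀ a, c (p a).2 = B) {V : Op (Fin k × Fin B.n)} {G : Op (Fin k)} {z : ℂ}
    (hV : V * blockEnc k B.ket = z • (blockEnc k B.ket * G)) :
    applyAt (liftWires p h) V * innerEnc C c m = z • (innerEnc C c m * applyAt p G) := by
  ext x y
  set r := ∏ q ∈ (Finset.univ.map p)ᶜ,
    (c q.2).ket (y q) fun i => x (innersEquiv C c m ⟨q, i⟩) with hr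
  have h₁ (u : Fin k × Fin B.n → Fin 2) :
      innerEnc C c m (Function.extend (liftWires p h) u x) y = blockEnc k B.ket u (y ∘ p) * r := by
    rw [innerEnc_apply p h, extend_comp_embedding, hr]
    congr 1
    refine Finset.prod_congr rfl fun q hq => congrArg _ (funext fun i => ?_)
    rw [Function.extend_apply']
    rintro ⟨⟨a, j⟩, hj⟩
    have h₂ := (innersEquiv C c m).injective hj
    simp only [Finset.mem_compl, Finset.mem_map, Finset.mem_univ, true_and, not_exists] at hq
    exact hq a (congrArg Sigma.fst h₂)
  have h₂ (w : Fin k → Fin 2) :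
      innerEnc C c m x (Function.extend p w y) =
        blockEnc k B.ket (x ∘ liftWires p h) w * r := by
    rw [innerEnc_apply p h, extend_comp_embedding, hr]
    congr 1
    refine Finset.prod_congr rfl fun q hq => ?_
    rw [Function.extend_apply']
    simpa using hq
  rw [applyAt_mul_apply, Matrix.smul_apply, mul_applyAt_apply]
  simp only [h₁, h₂]
  have h₃ := congrFun (congrFun hV (x ∘ liftWires p h)) (y ∘ p)
  rw [Matrix.smul_apply, Matrix.mul_apply, Matrix.mul_apply] at h₃
  simp only [← mul_assoc, ← Finset.sum_mul, h₃]
  simp only [smul_eq_mul, Finset.mul_sum, Finset.sum_mul]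
  exact Finset.sum_congr rfl fun _ _ => by ring

/-- A circuit on the qubits of the inner codes acts as an operator on the qubits of the outer
code. -/
def InnerImplements (d : Circuit (Fin m × ConcatReg C c)) (A : Op (Fin m × Fin C.n)) : Prop :=
  ∃ z : ℂ, ‖z‖ = 1 ∧ d.eval * innerEnc C c m = z • (innerEnc C c m * A)

theorem InnerImplements.implements {d : Circuit (Fin m × ConcatReg C c)} {A : Op (Fin m × Fin C.n)}
    (hd : InnerImplements d A) {G : Op (Fin m)} (hA : Implements C.ket A G) :
    Implements (concat C c) d.eval G := by
  obtain ⟨z, hz, hd⟩ := hd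
  obtain ⟨w, hw, hA⟩ := hA
  refine ⟨z * w, by rw [norm_mul, hz, hw, one_mul], ?_⟩
  rw [blockEnc_concat, ← Matrix.mul_assoc, hd, Matrix.smul_mul, Matrix.mul_assoc, hA,
    Matrix.mul_smul, smul_smul, Matrix.mul_assoc]

/-- Circuits on the outer code can be encoded gate by gate. -/
theorem exists_innerImplements {κ' : Type*} {f : Fin m × ConcatReg C c → κ'}
    (co : Circuit (Fin m × Fin C.n))
    (h : ∀ g ∈ co, ∃ d, InnerImplements (c := c) d g.op ∧ d.IsLocal f) :
    ∃ d, InnerImplements (c := c) d co.eval ∧ d.IsLocal f := by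
  induction co with
  | nil => exact ⟨[], ⟨1, by simp, by simp [Circuit.eval]⟩, fun g hg => by simp at hg⟩
  | cons g co ih =>
    obtain ⟨d₁, ⟨z₁, hz₁, h₁⟩, hl₁⟩ := h g List.mem_cons_self
    obtain ⟨d₂, ⟨z₂, hz₂, h₂⟩, hl₂⟩ := ih fun g' hg' => h g' (List.mem_cons_of_mem _ hg')
    refine ⟨d₁ ++ d₂, ⟨z₁ * z₂, by rw [norm_mul, hz₁, hz₂, one_mul], ?_⟩, fun g' hg' =>
      (List.mem_append.1 hg').elim (hl₁ g') (hl₂ g')⟩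
    rw [Circuit.eval_append, Matrix.mul_assoc, h₁, Matrix.mul_smul, ← Matrix.mul_assoc, h₂,
      Matrix.smul_mul, smul_smul, Matrix.mul_assoc, Circuit.eval]

theorem exists_innerImplements_gate {κ' : Type*} {f : Fin m × ConcatReg C c → κ'}
    (g : PlacedGate (Fin m × Fin C.n)) (h : ∀ a, c (g.wires a).2 = B)
    {d : Circuit (Fin g.arity × Fin B.n)} (hd : Implements B.ket d.eval g.gate.op)
    (hl : d.IsLocal fun x => f (liftWires g.wires h x)) :
    ∃ d, InnerImplements (c := c) d g.op ∧ d.IsLocal f := by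
  obtain ⟨z, hz, hd⟩ := hd
  refine ⟨d.map (liftWires g.wires h), ⟨z, hz, ?_⟩, ?_⟩
  · rw [Circuit.eval_map]
    exact applyAt_liftWires_mul_innerEnc g.wires h hd
  · intro g' hg' a b
    obtain ⟨g'', hg'', rfl⟩ := List.mem_map.1 hg'
    exact hl g'' hg'' a b

end Lift

/-! ### Fault-tolerant gates of the concatenated codes -/

section FaultTolerance

/-- A single qubit of a register. -/
def wire {ι : Type} (i : ι) : Fin 1 ↪ ι := ⟨fun _ => i, fun _ _ _ => Subsingleton.elim _ _⟩

theorem applyAt_wire {ι : Type} [Fintype ι] [DecidableEq ι] (i : ι)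
    (M : Matrix (Fin 2) (Fin 2) ℂ) :
    applyAt (wire i) (localOp fun _ => M) = localOp (Function.update 1 i M) := by
  rw [applyAt_localOp]
  congr 1
  funext j
  by_cases h : j = i
  · subst h
    rw [Function.update_self]
    exact (wire j).injective.extend_apply (fun _ => M) 1 0
  · rw [Function.update_of_ne h, Function.extend_apply']
    rintro ⟨_, h'⟩
    exact h h'.symm

/-- The gates of the logical `K` on a block of the `5'`-qubit code. -/
def kBlock : Circuit (Fin 5) :=
  [⟨1, .K, wire 0⟩, ⟨1, .K, wire 1⟩, ⟨1, .K, wire 2⟩, ⟨1, .Z, wire 2⟩, ⟨1, .K, wire 3⟩,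
    ⟨1, .K, wire 4⟩]

theorem eval_kBlock : kBlock.eval = localOp ![kMat, kMat, zMat * kMat, kMat, kMat] := by
  simp only [kBlock, Circuit.eval, PlacedGate.op, Gate.op, applyAt_wire, localOp_mul,
    Matrix.one_mul]
  congr 1
  funext i
  fin_cases i <;> simp

/-- The staircase of controlled-NOT gates as a circuit. -/
def stairBlock : Circuit (Fin 5) :=
  [⟨2, .CNOT, ⟨![0, 2], by decide⟩⟩, ⟨2, .CNOT, ⟨![2, 4], by decide⟩⟩]

theorem eval_stairBlock : stairBlock.eval = staircase := by
  simp only [stairBlock, Circuit.eval, Matrix.one_mul]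
  rfl

theorem eval_stairBlock_reverse : Circuit.eval stairBlock.reverse = staircaseInv := by
  simp only [stairBlock, List.reverse_cons, List.reverse_nil, List.nil_append, List.cons_append,
    Circuit.eval, Matrix.one_mul]
  rfl

/-- The circuit `phaseCircuit`, with a gate of the library as the phase gate. -/
noncomputable def phaseGates {k : ℕ} (g : Gate (k + 1)) : Circuit (Fin (k + 1) × Fin 5) :=
  Circuit.onPieces (blockEquiv (k + 1) (Fin 5)) (fun _ => stairBlock) ++
    ([⟨k + 1, g, lastQubits (k + 1)⟩] ++
      Circuit.onPieces (blockEquiv (k + 1) (Fin 5)) fun _ => stairBlock.reverse)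

theorem eval_phaseGates {k : ℕ} {g : Gate (k + 1)} {θ : ℝ} (hg : g.op = ctrlPhase k θ) :
    (phaseGates g).eval = phaseCircuit k θ := by
  rw [phaseGates, Circuit.eval_append, Circuit.eval_append, Circuit.eval_onPieces,
    Circuit.eval_onPieces, eval_stairBlock, eval_stairBlock_reverse, phaseCircuit, ← hg]
  simp only [Circuit.eval, Matrix.one_mul]
  rfl

theorem phaseGates_mem {k : ℕ} {g : Gate (k + 1)} {g' : PlacedGate (Fin (k + 1) × Fin 5)}
    (h : g' ∈ phaseGates g) :
    (g' = ⟨k + 1, g, lastQubits (k + 1)⟩ ∨ ∃ e : Fin 2 ↪ Fin (k + 1) × Fin 5, g' = ⟨2, .CNOT, e⟩) ∧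
      ∀ a, (g'.wires a).2 = 0 ∨ (g'.wires a).2 = 2 ∨ (g'.wires a).2 = 4 := by
  have hs : ∀ g₀ ∈ stairBlock, (∃ e : Fin 2 ↪ Fin 5, g₀ = ⟨2, .CNOT, e⟩) ∧
      ∀ a, g₀.wires a = 0 ∨ g₀.wires a = 2 ∨ g₀.wires a = 4 := by
    intro g₀ h₀
    simp only [stairBlock, List.mem_cons, List.not_mem_nil, or_false] at h₀
    rcases h₀ with rfl | rfl
    · exact ⟨⟨_, rfl⟩, fun a => by revert a; decide⟩
    · exact ⟨⟨_, rfl⟩, fun a => by revert a; decide⟩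
  have key : ∀ (j : Fin (k + 1)), ∀ g₀ ∈ stairBlock,
      (∃ e, g₀.map (piece (blockEquiv (k + 1) (Fin 5)) j) = ⟨2, .CNOT, e⟩) ∧
      ∀ a, ((g₀.map (piece (blockEquiv (k + 1) (Fin 5)) j)).wires a).2 = 0 ∨
        ((g₀.map (piece (blockEquiv (k + 1) (Fin 5)) j)).wires a).2 = 2 ∨
        ((g₀.map (piece (blockEquiv (k + 1) (Fin 5)) j)).wires a).2 = 4 := by
    intro j g₀ h₀
    obtain ⟨⟨e, rfl⟩, ha⟩ := hs g₀ h₀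
    exact ⟨⟨_, rfl⟩, ha⟩
  rcases List.mem_append.1 h with h | h
  · obtain ⟨j, g₀, h₀, rfl⟩ := Circuit.mem_onPieces h
    exact ⟨Or.inr (key j g₀ h₀).1, (key j g₀ h₀).2⟩
  · rcases List.mem_append.1 h with h | h
    · rw [List.mem_singleton.1 h]
      exact ⟨Or.inl rfl, fun a => Or.inr (Or.inr rfl)⟩
    · obtain ⟨j, g₀, h₀, rfl⟩ := Circuit.mem_onPieces h
      have h₀ := List.mem_reverse.1 h₀
      exact ⟨Or.inr (key j g₀ h₀).1, (key j g₀ h₀).2⟩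

variable {c : Fin fivePrimeCode.n → Code}

/-- Single-qubit gates have implementations on each of the inner codes. -/
theorem exists_circuit_singleBlock {B : Code} (hB : B = rmCode ∨ B = bareQubit) (g : Gate 1)
    {M : Matrix (Fin 2) (Fin 2) ℂ} (hg : g.op = localOp fun _ => M) :
    ∃ d : Circuit (Fin 1 × Fin B.n), Implements B.ket d.eval g.op := by
  rcases hB with rfl | rfl
  · obtain ⟨d, hd⟩ := rmEnc_exists_circuit g hg
    rw [hg]
    exact ⟨_, implements_singleBlock hd⟩
  · rw [hg]
    refine ⟨_, implements_singleBlock (C := bareEnc) (c := [⟨1, g, wire 0⟩]) (M := M) ?_⟩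
    have h : Circuit.eval [(⟨1, g, wire 0⟩ : PlacedGate (Fin 1))] =
        localOp (Function.update 1 0 M) := by
      rw [← applyAt_wire, ← hg]
      simp [Circuit.eval, PlacedGate.op]
    rw [h, localOp_mul_encMat_bareEnc, Function.update_self]

theorem n_pos_of_eq {B : Code} (h : B = rmCode ∨ B = bareQubit) : 0 < B.n := by
  rcases h with rfl | rfl
  · exact Nat.succ_pos 14
  · exact Nat.one_pos

theorem kBlock_mem {g : PlacedGate (Fin 5)} (h : g ∈ kBlock) :
    ∃ (g₀ : Gate 1) (M : Matrix (Fin 2) (Fin 2) ℂ) (i : Fin 5),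
      g₀.op = (localOp fun _ => M) ∧ g = ⟨1, g₀, wire i⟩ := by
  simp only [kBlock, List.mem_cons, List.not_mem_nil, or_false] at h
  rcases h with rfl | rfl | rfl | rfl | rfl | rfl <;> exact ⟨_, _, _, rfl, rfl⟩

/-- The logical `K` acts within the inner codes, so that a fault damages only one of them. -/
theorem ftImplements_K (hc : ∀ q, c q = rmCode ∨ c q = bareQubit)
    (D : Decoder (concat fivePrimeCode c))
    (hD : ∀ E ∈ concatErrors fivePrimeCode c {q | c q = rmCode}, D.Corrects (pauliOp E)) :
    ∃ d : Circuit (Fin 1 × ConcatReg fivePrimeCode c), D.FTImplements d Gate.K.op := by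
  obtain ⟨d, hd, hl⟩ := exists_innerImplements (c := c) (m := 1)
    (f := fun x => (x.1, x.2.1)) (Circuit.onPieces (blockEquiv 1 (Fin 5)) fun _ => kBlock) (by
      intro g hg
      obtain ⟨j, g', hg', rfl⟩ := Circuit.mem_onPieces hg
      obtain ⟨g₀, M, i, hM, rfl⟩ := kBlock_mem hg'
      obtain ⟨d, hd⟩ := exists_circuit_singleBlock (hc i) g₀ hM
      refine exists_innerImplements_gate (B := c i) _ (fun _ => rfl) hd ?_
      intro g _ a b
      rfl)
  have hK : Implements fivePrimeEnc
      (Circuit.onPieces (blockEquiv 1 (Fin 5)) fun _ => kBlock).eval Gate.K.op := by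
    rw [Circuit.eval_onPieces, eval_kBlock]
    exact fivePrimeEnc_implements_K
  refine ⟨d, D.ftImplements_of_isLocal (hd.implements hK) hl ?_⟩
  · rintro ⟨j₀, q₀⟩ P hP j
    refine hD _ ⟨q₀, fun q hq => ?_⟩
    have h₁ : ∀ i, P (j, ⟨q, i⟩) = 1 := fun i => hP _ fun h => hq (Prod.ext_iff.1 h).2
    have hn := n_pos_of_eq (hc q)
    exact ⟨⟨⟨0, hn⟩, fun i _ => h₁ i⟩, fun _ => h₁⟩

/-- The logical phase gates act bitwise on the Reed–Muller codes, so that a fault damages at most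
one qubit of each of them. -/
theorem ftImplements_phase (hc : ∀ q, c q = rmCode ∨ c q = bareQubit)
    (hc' : ∀ q : Fin 5, q = 0 ∨ q = 2 ∨ q = 4 → c q = rmCode)
    (D : Decoder (concat fivePrimeCode c))
    (hD : ∀ E ∈ concatErrors fivePrimeCode c {q | c q = rmCode}, D.Corrects (pauliOp E))
    {k : ℕ} {g g' : Gate (k + 1)} {θ : ℝ} (hg : g.op = ctrlPhase k θ)
    (hg' : Implements rmEnc (bitwise (Fin 15) g').eval g.op) :
    ∃ d : Circuit (Fin (k + 1) × ConcatReg fivePrimeCode c), D.FTImplements d g.op := by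
  classical
  -- a part consists of the qubits at one position of all the Reed–Muller codes, or of a bare qubit
  let f : Fin (k + 1) × ConcatReg fivePrimeCode c → ℕ ⊕ (Fin (k + 1) × Fin 5) := fun x =>
    if c x.2.1 = rmCode then .inl x.2.2 else .inr (x.1, x.2.1)
  have hf {e : Fin (k + 1) × ConcatReg fivePrimeCode c} (h : c e.2.1 = rmCode) :
      f e = .inl (e.2.2 : ℕ) := if_pos h
  have hlocal {n : ℕ} (g₀ : Gate n) (p : Fin n ↪ Fin (k + 1) × Fin fivePrimeCode.n)
      (h : ∀ a, c (p a).2 = rmCode) :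
      (bitwise (Fin 15) g₀).IsLocal fun x => f (liftWires (B := rmCode) p h x) := by
    intro g₁ hg₁ a b
    have h₁ := bitwise_isLocal g₀ g₁ hg₁ a b
    refine (hf (e := liftWires p h (g₁.wires a)) (h _)).trans
      (Eq.trans ?_ (hf (e := liftWires p h (g₁.wires b)) (h _)).symm)
    exact congrArg (fun i : Fin 15 => Sum.inl (i : ℕ)) h₁
  obtain ⟨d, hd, hl⟩ := exists_innerImplements (c := c) (m := k + 1) (f := f) (phaseGates g) (by
      intro g₀ hg₀
      obtain ⟨h₁ | ⟨e, h₁⟩, h₂⟩ := phaseGates_mem hg₀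
      · subst h₁
        exact exists_innerImplements_gate (B := rmCode) _ (fun a => hc' _ (h₂ a)) hg'
          (hlocal g' _ _)
      · subst h₁
        exact exists_innerImplements_gate (B := rmCode) _ (fun a => hc' _ (h₂ a))
          rmEnc_implements_bitwise_CNOT (hlocal _ _ _))
  have hG : Implements fivePrimeEnc (phaseGates g).eval g.op := by
    rw [eval_phaseGates hg, hg]
    exact fivePrimeEnc_implements_phaseCircuit k θ
  refine ⟨d, D.ftImplements_of_isLocal (hd.implements hG) hl ?_⟩
  · intro b P hP j
    have hn (q : Fin 5) := n_pos_of_eq (hc q)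
    rcases b with v | ⟨j₀, q₀⟩
    · refine hD _ ⟨(0 : Fin 5), fun q _ => ⟨?_, fun hq i => hP _ ?_⟩⟩
      · by_cases hv : v < (c q).n
        · refine ⟨⟨v, hv⟩, fun i hi => hP _ fun h => ?_⟩
          simp only [f] at h
          split_ifs at h
          exact hi (Fin.ext (Sum.inl.inj h))
        · refine ⟨⟨0, hn q⟩, fun i _ => hP _ fun h => ?_⟩
          simp only [f] at h
          split_ifs at h
          exact hv (by rw [← Sum.inl.inj h]; exact i.2)
      · intro h
        simp only [f] at h
        split_ifs at h with h'
        exact hq h'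
    · refine hD _ ⟨q₀, fun q hq => ?_⟩
      have h₁ : ∀ i, P (j, ⟨q, i⟩) = 1 := fun i => hP _ fun h => by
        simp only [f] at h
        split_ifs at h
        exact hq (Prod.ext_iff.1 (Sum.inr.inj h)).2
      exact ⟨⟨⟨0, hn q⟩, fun i _ => h₁ i⟩, fun _ => h₁⟩

/-- The concatenation of the `5'`-qubit code with Reed–Muller codes and bare qubits, the qubits
`1, 3, 5` being encoded. -/
theorem concat_isEncoding_and_supportsFTLibrary
    (hc : ∀ q, c q = rmCode ∨ c q = bareQubit)
    (hc' : ∀ q : Fin 5, q = 0 ∨ q = 2 ∨ q = 4 → c q = rmCode) :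
    IsEncoding (concat fivePrimeCode c) ∧ SupportsFTLibrary (concat fivePrimeCode c) := by
  have hs : ∀ q, ∃ s, HasLogicalPaulis (c q).ket s := by
    intro q
    rcases hc q with h | h <;> rw [h]
    · exact ⟨_, rmEnc_hasLogicalPaulis⟩
    · exact ⟨_, bareEnc_hasLogicalPaulis⟩
  choose s hs using hs
  have hC : DetectsPairs fivePrimeCode.ket := fivePrimeEnc_eq_one
  obtain ⟨D, hD⟩ := exists_decoder_concat fivePrimeEnc_isEncoding hC hs
    (T := {q | c q = rmCode}) (by
      intro q (hq : c q = rmCode)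
      rw [hq]
      exact rmEnc_eq_one)
  refine ⟨isEncoding_concat fivePrimeEnc_isEncoding fun q => (hs q).isEncoding, D, ?_, ?_⟩
  · refine D.correctsSingleErrors fun ⟨q₀, i₀⟩ P hP => hD P ⟨q₀, fun q hq => ?_⟩
    have h₁ : ∀ i, P ⟨q, i⟩ = 1 := fun i => hP _ fun h => hq (congrArg Sigma.fst h)
    have hn := n_pos_of_eq (hc q)
    exact ⟨⟨⟨0, hn⟩, fun i _ => h₁ i⟩, fun _ => h₁⟩
  · intro m g hg
    cases g
    case K => exact ftImplements_K hc D hD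
    case T => exact ftImplements_phase hc hc' D hD rfl rmEnc_implements_bitwise_T
    case S => exact ftImplements_phase hc hc' D hD rfl rmEnc_implements_bitwise_S
    case CZ => exact ftImplements_phase hc hc' D hD rfl rmEnc_implements_bitwise_CZ
    case CCZ => exact ftImplements_phase hc hc' D hD rfl rmEnc_implements_bitwise_CCZ
    all_goals exact hg.elim

end FaultTolerance

/-! ### One-parameter groups in closed sets of unitaries -/

section OneParameter

open NormedSpace Filter Topology

variable {A : Type*} [CStarAlgebra A]

theorem norm_pow_sub_pow_le {a b : A} (ha : ‖a‖ ≤ 1) (hb : ‖b‖ ≤ 1) (m : ℕ) :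
    ‖a ^ m - b ^ m‖ ≤ m * ‖a - b‖ := by
  induction m with
  | zero => simp
  | succ m ih =>
    rcases subsingleton_or_nontrivial A with h | h
    · simp [Subsingleton.elim _ (0 : A)]
    have hp : ‖b ^ m‖ ≤ 1 := (norm_pow_le b m).trans (pow_le_one₀ (norm_nonneg b) hb)
    have h₁ : a ^ (m + 1) - b ^ (m + 1) = (a ^ m - b ^ m) * a + b ^ m * (a - b) := by
      rw [pow_succ, pow_succ]; noncomm_ring
    calc ‖a ^ (m + 1) - b ^ (m + 1)‖ ≤ ‖(a ^ m - b ^ m) * a‖ + ‖b ^ m * (a - b)‖ := by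
          rw [h₁]; exact norm_add_le _ _
      _ ≤ ‖a ^ m - b ^ m‖ * 1 + 1 * ‖a - b‖ := by
          refine add_le_add ((norm_mul_le _ _).trans ?_) ((norm_mul_le _ _).trans ?_) <;> gcongr
      _ ≤ (m + 1 : ℕ) * ‖a - b‖ := by push_cast; linarith

theorem norm_le_one_of_mem_unitary {u : A} (hu : u ∈ unitary A) : ‖u‖ ≤ 1 := by
  rcases subsingleton_or_nontrivial A with h | h
  · simp [Subsingleton.elim u 0]
  · exact (CStarRing.norm_of_mem_unitary hu).le

theorem exp_mem_unitary {X : A} (hX : star X = -X) : exp X ∈ unitary A := by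
  let +nondep : NormedAlgebra ℚ A := .restrictScalars ℚ ℂ A
  exact exp_mem_unitary_of_mem_skewAdjoint (skewAdjoint.mem_iff.2 hX)

theorem star_ofReal_smul {X : A} (hX : star X = -X) (t : ℝ) :
    star ((t : ℂ) • X) = -((t : ℂ) • X) := by
  rw [star_smul, hX, smul_neg, Complex.star_def, Complex.conj_ofReal]

/-- The Lie product formula for skew-adjoint elements: `exp (X + Y)` is the limit of
`(exp (X / m) * exp (Y / m)) ^ m`. -/
theorem tendsto_exp_mul_exp_pow {X Y : A} (hX : star X = -X) (hY : star Y = -Y) :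
    Tendsto (fun m : ℕ => (exp ((m : ℂ)⁻¹ • X) * exp ((m : ℂ)⁻¹ • Y)) ^ m) atTop
      (𝓝 (exp (X + Y))) := by
  let +nondep : NormedAlgebra ℚ A := .restrictScalars ℚ ℂ A
  have hd : HasDerivAt (fun s : ℂ => exp (s • X) * exp (s • Y) - exp (s • (X + Y))) 0 0 := by
    have h₁ := ((hasDerivAt_exp_smul_const X (0 : ℂ)).mul
      (hasDerivAt_exp_smul_const Y (0 : ℂ))).sub (hasDerivAt_exp_smul_const (X + Y) (0 : ℂ))
    simpa using! h₁
  have h₂ := (hasDerivAt_iff_isLittleO_nhds_zero.1 hd).comp_tendsto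
    (tendsto_inv_atTop_nhds_zero_nat (𝕜 := ℂ))
  simp only [zero_add, zero_smul, exp_zero, mul_one, sub_self, sub_zero, smul_zero] at h₂
  rw [tendsto_iff_norm_sub_tendsto_zero, Metric.tendsto_atTop]
  intro ε hε
  obtain ⟨N, hN⟩ := eventually_atTop.1 (Asymptotics.isLittleO_iff.1 h₂ (half_pos hε))
  refine ⟨N + 1, fun m hm => ?_⟩
  have hm₀ : (m : ℂ) ≠ 0 := Nat.cast_ne_zero.2 (by omega)
  have hm₁ : (0 : ℝ) < m := Nat.cast_pos.2 (by omega)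
  have h₃ := hN m (by omega)
  simp only [Function.comp_apply, norm_inv, Complex.norm_natCast] at h₃
  have hs (W : A) (hW : star W = -W) : ‖exp ((m : ℂ)⁻¹ • W)‖ ≤ 1 := by
    have := star_ofReal_smul hW (m : ℝ)⁻¹
    push_cast at this
    exact norm_le_one_of_mem_unitary (exp_mem_unitary this)
  have h₄ : exp (X + Y) = exp ((m : ℂ)⁻¹ • (X + Y)) ^ m := by
    rw [← NormedSpace.exp_nsmul, ← Nat.cast_smul_eq_nsmul ℂ, smul_smul, mul_inv_cancel₀ hm₀, one_smul]
  have h₅ := norm_pow_sub_pow_le (a := exp ((m : ℂ)⁻¹ • X) * exp ((m : ℂ)⁻¹ • Y))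
    (b := exp ((m : ℂ)⁻¹ • (X + Y)))
    ((norm_mul_le _ _).trans (mul_le_one₀ (hs X hX) (norm_nonneg _) (hs Y hY)))
    (hs _ (by rw [star_add, hX, hY, neg_add])) m
  rw [← h₄] at h₅
  rw [Real.dist_eq, sub_zero, abs_of_nonneg (norm_nonneg _)]
  calc _ ≤ m * (ε / 2 * (m : ℝ)⁻¹) := h₅.trans (by gcongr)
    _ = ε / 2 := by field_simp
    _ < ε := half_lt_self hε

/-- A closed set of unitaries that is a group. -/
structure IsClosedUnitaryGroup (S : Submonoid A) : Prop where
  isClosed : IsClosed (S : Set A)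
  le_unitary : S ≤ unitary A
  star_mem : ∀ u ∈ S, star u ∈ S

/-- The Lie algebra of a closed group of unitaries. -/
def lieSpace (S : Submonoid A) : Set A := {X | star X = -X ∧ ∀ t : ℝ, exp ((t : ℂ) • X) ∈ S}

variable {S : Submonoid A} {X Y : A}

theorem zero_mem_lieSpace : (0 : A) ∈ lieSpace S :=
  ⟨by simp, fun t => by rw [smul_zero, exp_zero]; exact S.one_mem⟩

theorem smul_mem_lieSpace (hX : X ∈ lieSpace S) (r : ℝ) : (r : ℂ) • X ∈ lieSpace S :=
  ⟨star_ofReal_smul hX.1 r, fun t => by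
    rw [smul_smul, ← Complex.ofReal_mul]; exact hX.2 (t * r)⟩

theorem IsClosedUnitaryGroup.add_mem (hS : IsClosedUnitaryGroup S) (hX : X ∈ lieSpace S)
    (hY : Y ∈ lieSpace S) : X + Y ∈ lieSpace S := by
  refine ⟨by rw [star_add, hX.1, hY.1, neg_add], fun t => ?_⟩
  rw [smul_add]
  refine hS.isClosed.mem_of_tendsto
    (tendsto_exp_mul_exp_pow (star_ofReal_smul hX.1 t) (star_ofReal_smul hY.1 t))
    (Eventually.of_forall fun m => S.pow_mem (S.mul_mem ?_ ?_) m)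
  · have := (smul_mem_lieSpace hX t).2 (m : ℝ)⁻¹
    push_cast at this
    exact this
  · have := (smul_mem_lieSpace hY t).2 (m : ℝ)⁻¹
    push_cast at this
    exact this

theorem IsClosedUnitaryGroup.conj_mem (hS : IsClosedUnitaryGroup S) {u : A} (hu : u ∈ S)
    (hX : X ∈ lieSpace S) : u * X * star u ∈ lieSpace S := by
  let +nondep : NormedAlgebra ℚ A := .restrictScalars ℚ ℂ A
  obtain ⟨h₁, h₂⟩ := Unitary.mem_iff.1 (hS.le_unitary hu)
  refine ⟨by simp only [star_mul, star_star, hX.1, mul_assoc, neg_mul, mul_neg], fun t => ?_⟩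
  have h₃ : SemiconjBy u ((t : ℂ) • X) ((t : ℂ) • (u * X * star u)) := by
    rw [SemiconjBy, smul_mul_assoc, mul_assoc _ (star u), h₁, mul_one, mul_smul_comm]
  have h₄ : exp ((t : ℂ) • (u * X * star u)) = u * exp ((t : ℂ) • X) * star u := by
    rw [h₃.exp_right.eq, mul_assoc _ u, h₂, mul_one]
  rw [h₄]
  exact S.mul_mem (S.mul_mem hu (hX.2 t)) (hS.star_mem u hu)

/-- The exponential of a multiple of an involution. -/
theorem exp_smul_involution {N : A} (hN : N * N = 1) (t : ℝ) :
    exp ((t : ℂ) • (Complex.I • N)) = (Real.cos t : ℂ) • (1 : A) + (Real.sin t * Complex.I) • N := by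
  let +nondep : NormedAlgebra ℚ A := .restrictScalars ℚ ℂ A
  -- `N` is the difference of the projections onto its eigenspaces
  set P : A := (1 / 2 : ℂ) • (1 + N) with hP
  set Q : A := (1 / 2 : ℂ) • (1 - N) with hQ
  have hNP : N * P = P := by rw [hP, mul_smul_comm, mul_add, hN, mul_one, add_comm]
  have hNQ : N * Q = -Q := by
    rw [hQ, mul_smul_comm, mul_sub, hN, mul_one, ← smul_neg, neg_sub]
  have hPQ : P + Q = 1 := by rw [hP, hQ]; module
  have hpow (k : ℕ) : ((t : ℂ) • (Complex.I • N)) ^ k =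
      (t * Complex.I) ^ k • P + (-(t * Complex.I)) ^ k • Q := by
    induction k with
    | zero => simp [hPQ]
    | succ k ih =>
      rw [pow_succ', ih, smul_smul, mul_add, smul_mul_assoc, smul_mul_assoc,
        mul_smul_comm (_ ^ k) N P, mul_smul_comm (_ ^ k) N Q, hNP, hNQ]
      module
  have h₁ := exp_series_hasSum_exp' (𝕂 := ℂ) ((t : ℂ) • (Complex.I • N))
  have h₂ (z : ℂ) (R : A) : HasSum (fun k : ℕ => ((k.factorial : ℂ)⁻¹ • z ^ k) • R)
      (Complex.exp z • R) := by
    rw [Complex.exp_eq_exp_ℂ]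
    exact (exp_series_hasSum_exp' (𝕂 := ℂ) z).smul_const R
  have h₃ := h₁.unique (((h₂ (t * Complex.I) P).add (h₂ (-(t * Complex.I)) Q)).congr_fun
    fun k => by rw [hpow, smul_add, smul_assoc, smul_assoc])
  rw [h₃, Complex.exp_mul_I, ← neg_mul, Complex.exp_mul_I, Complex.cos_neg, Complex.sin_neg, hP, hQ]
  push_cast
  module

/-- A rotation by an angle that is an irrational multiple of `π` generates a dense subgroup of its
one-parameter group. -/
theorem IsClosedUnitaryGroup.mem_of_irrational (hS : IsClosedUnitaryGroup S) {N : A}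
    (hN : N * N = 1) (hN' : star N = N) {φ : ℝ} (hφ : Irrational (φ / (2 * Real.pi)))
    (h : (Real.cos φ : ℂ) • (1 : A) + (Real.sin φ * Complex.I) • N ∈ S) :
    Complex.I • N ∈ lieSpace S := by
  let +nondep : NormedAlgebra ℚ A := .restrictScalars ℚ ℂ A
  have hs : star (Complex.I • N) = -(Complex.I • N) := by
    rw [star_smul, hN', Complex.star_def, Complex.conj_I, neg_smul]
  refine ⟨hs, ?_⟩
  let T : AddSubgroup ℝ :=
    { carrier := {t | exp ((t : ℂ) • (Complex.I • N)) ∈ S}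
      zero_mem' := by simp [S.one_mem]
      add_mem' := fun {a b} ha hb => by
        rw [Set.mem_ofPred_eq, Complex.ofReal_add, add_smul,
          NormedSpace.exp_add_of_commute (((Commute.refl _).smul_left _).smul_right _)]
        exact S.mul_mem ha hb
      neg_mem' := fun {a} ha => by
        rw [Set.mem_ofPred_eq, Complex.ofReal_neg, neg_smul, ← star_ofReal_smul hs, ← star_exp]
        exact hS.star_mem _ ha }
  have hT : IsClosed (T : Set ℝ) := hS.isClosed.preimage
    (exp_continuous.comp (Complex.continuous_ofReal.smul continuous_const))
  have hle : AddSubgroup.closure {φ, 2 * Real.pi} ≤ T := by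
    rw [AddSubgroup.closure_le]
    rintro t (rfl | rfl)
    · change exp _ ∈ S
      rw [exp_smul_involution hN]
      exact h
    · change exp _ ∈ S
      rw [exp_smul_involution hN, Real.cos_two_pi, Real.sin_two_pi]
      simp [S.one_mem]
  have hd := dense_addSubgroupClosure_pair_iff.2 hφ
  exact fun t => hT.closure_subset_iff.2 hle (hd t)

/-- A closed group of unitaries whose Lie algebra contains all skew-adjoint elements contains all
unitaries with finite spectrum: after multiplication by a phase they have logarithms. -/
theorem IsClosedUnitaryGroup.mem_of_finite_spectrum (hS : IsClosedUnitaryGroup S)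
    (h : ∀ X : A, star X = -X → X ∈ lieSpace S) {u : A} (hu : u ∈ unitary A)
    (hf : (spectrum ℂ u).Finite) : u ∈ S := by
  let +nondep : NormedAlgebra ℚ A := .restrictScalars ℚ ℂ A
  have hexp (X : A) (hX : star X = -X) : exp X ∈ S := by
    have := (h X hX).2 1
    rwa [Complex.ofReal_one, one_smul] at this
  obtain ⟨θ, hθ⟩ : ∃ θ : ℝ, -Complex.exp (θ * Complex.I) ∉ spectrum ℂ u := by
    by_contra! hc
    refine (Set.Ioc_infinite (neg_lt_self Real.pi_pos)) (Set.Finite.of_finite_image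
      (f := fun θ : ℝ => -Complex.exp (θ * Complex.I))
      (hf.subset (by rintro _ ⟨z, -, rfl⟩; exact hc z)) fun a ha b hb hab => ?_)
    have h₁ := congrArg Complex.arg (neg_injective hab)
    rwa [Complex.arg_exp_mul_I, Complex.arg_exp_mul_I,
      (toIocMod_eq_self _).2 ⟨ha.1, by linarith [ha.2]⟩,
      (toIocMod_eq_self _).2 ⟨hb.1, by linarith [hb.2]⟩] at h₁
  have hz (a : ℝ) : Complex.exp (a * Complex.I) • (1 : A) ∈ S := by
    have h₁ := (h (Complex.I • 1) (by simp)).2 a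
    rw [exp_smul_involution (mul_one 1), ← add_smul] at h₁
    rwa [Complex.exp_mul_I, ← Complex.ofReal_cos, ← Complex.ofReal_sin]
  set v : A := Complex.exp ((-θ : ℝ) * Complex.I) • u with hv
  have hvu : v ∈ unitary A := by
    rw [hv, ← one_mul u, ← smul_mul_assoc]
    exact (unitary A).mul_mem (hS.le_unitary (hz (-θ))) hu
  have hv₁ : -1 ∉ spectrum ℂ v := by
    intro h₁
    refine hθ ((spectrum.smul_mem_smul_iff (r := Units.mk0 _ (Complex.exp_ne_zero
      ((-θ : ℝ) * Complex.I)))).1 ?_)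
    have h₂ : Complex.exp ((-θ : ℝ) * Complex.I) * -Complex.exp (θ * Complex.I) = -1 := by
      rw [mul_neg, ← Complex.exp_add, Complex.ofReal_neg, neg_mul, neg_add_cancel, Complex.exp_zero]
    change Complex.exp ((-θ : ℝ) * Complex.I) * -Complex.exp (θ * Complex.I) ∈ spectrum ℂ v
    rwa [h₂]
  have hv₂ : v ∈ S := by
    have h₁ := expUnitary_argSelfAdjoint (u := ⟨v, hvu⟩)
      ((Unitary.norm_sub_one_lt_two_iff hvu).2 hv₁)
    have h₂ := congrArg Subtype.val h₁
    rw [selfAdjoint.expUnitary_coe] at h₂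
    have h₃ := hexp (Complex.I • (Unitary.argSelfAdjoint ⟨v, hvu⟩ : A)) ?_
    · rwa [h₂] at h₃
    · rw [star_smul, (Unitary.argSelfAdjoint _).2.star_eq]
      simp
  have h₁ := S.mul_mem (hz θ) hv₂
  rwa [hv, smul_mul_smul_comm, ← Complex.exp_add, Complex.ofReal_neg, neg_mul, add_neg_cancel, Complex.exp_zero, one_mul,
    one_smul] at h₁

end OneParameter

/-! ### Universality of the gate library -/

section Universality

open scoped Matrix.Norms.L2Operator

variable {ι κ : Type} [Fintype ι] [DecidableEq ι] [Fintype κ] [DecidableEq κ]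

theorem applyAt_star (e : κ ↪ ι) (G : Op κ) : star (applyAt e G) = applyAt e (star G) := by
  ext x y
  simp only [Matrix.star_apply, applyAt, eq_comm (a := y _)]
  split_ifs <;> simp

theorem applyAt_pow (e : κ ↪ ι) (G : Op κ) (r : ℕ) : applyAt e (G ^ r) = applyAt e G ^ r := by
  induction r with
  | zero => rw [pow_zero, pow_zero, applyAt_one]
  | succ r ih => rw [pow_succ, pow_succ, applyAt_mul, ih]

theorem localOp_star (A : ι → Matrix (Fin 2) (Fin 2) ℂ) :
    star (localOp A) = localOp fun i => star (A i) := by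
  ext x y
  simp only [Matrix.star_apply, localOp, star_prod]

theorem ctrlPhase_pow (k : ℕ) (θ : ℝ) (r : ℕ) : ctrlPhase k θ ^ r = ctrlPhase k (r * θ) := by
  induction r with
  | zero => rw [pow_zero, Nat.cast_zero, zero_mul, ctrlPhase_zero]
  | succ r ih => rw [pow_succ, ih, ctrlPhase_mul, Nat.cast_succ, add_one_mul]

theorem ctrlPhase_two_pi (k : ℕ) : ctrlPhase k (2 * Real.pi) = 1 := by
  simp [ctrlPhase, Complex.exp_two_pi_mul_I]

theorem ctrlPhase_star (k : ℕ) (θ : ℝ) : star (ctrlPhase k θ) = ctrlPhase k (-θ) := by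
  rw [Matrix.star_eq_conjTranspose, ctrlPhase, Matrix.diagonal_conjTranspose, ctrlPhase]
  congr 1
  ext x
  rw [Pi.star_apply]
  split_ifs
  · rw [Complex.star_def, ← Complex.exp_conj]
    simp
  · simp

theorem hMat_star : star hMat = hMat := by
  ext a b
  fin_cases a <;> fin_cases b <;> simp [hMat]

theorem phaseMat_star (θ : ℝ) : star (phaseMat θ) = phaseMat (-θ) := by
  ext a b
  fin_cases a <;> fin_cases b <;> simp [phaseMat, ← Complex.exp_conj]

theorem kMat_star_mul : star kMat * kMat = 1 := by
  rw [kMat, star_mul, hMat_star, phaseMat_star, Matrix.mul_assoc, ← Matrix.mul_assoc (phaseMat _),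
    phaseMat_mul, neg_add_cancel, phaseMat_zero, Matrix.one_mul, hMat_mul_self]

theorem kMat_pow_three : kMat ^ 3 = Complex.exp ((Real.pi / 4 : ℝ) * Complex.I) • 1 := by
  have h : kGauss ^ 3 = !![⟨2, 2⟩, 0; 0, ⟨2, 2⟩] := by decide
  have h₁ : ((1 / Real.sqrt 2 : ℝ) : ℂ) ^ 3 * 2 = ((Real.sqrt 2 / 2 : ℝ) : ℂ) := by
    have h₂ : (1 / Real.sqrt 2) ^ 3 * 2 = Real.sqrt 2 / 2 := by
      have h₃ := Real.sq_sqrt (show (0 : ℝ) ≤ 2 by norm_num)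
      have h₄ : Real.sqrt 2 ≠ 0 := by positivity
      field_simp
      rw [show Real.sqrt 2 ^ 4 = (Real.sqrt 2 ^ 2) ^ 2 by ring, h₃]
    exact_mod_cast h₂
  have h₂ : Complex.exp ((Real.pi / 4 : ℝ) * Complex.I) =
      ((1 / Real.sqrt 2 : ℝ) : ℂ) ^ 3 * GaussianInt.toComplex ⟨2, 2⟩ := by
    rw [Complex.exp_mul_I, ← Complex.ofReal_cos, ← Complex.ofReal_sin, Real.cos_pi_div_four,
      Real.sin_pi_div_four, ← h₁, GaussianInt.toComplex_def]
    push_cast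
    ring
  have h₃ : kGauss.map GaussianInt.toComplex ^ 3 = (kGauss ^ 3).map GaussianInt.toComplex :=
    (map_pow GaussianInt.toComplex.mapMatrix kGauss 3).symm
  rw [kMat_eq, smul_pow, h₃, h, h₂, mul_smul]
  congr 1
  ext a b
  fin_cases a <;> fin_cases b <;> simp

/-- The library gates have finite order up to a phase. -/
theorem Gate.InLibrary.exists_pow {k : ℕ} {g : Gate k} (hg : g.InLibrary) :
    star g.op * g.op = 1 ∧ ∃ (r : ℕ) (z : ℂ), ‖z‖ = 1 ∧ g.op ^ (r + 1) = z • 1 := by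
  have hc (k r : ℕ) (θ : ℝ) (h : (r + 1 : ℕ) * θ = 2 * Real.pi) :
      star (ctrlPhase k θ) * ctrlPhase k θ = 1 ∧
        ∃ (r : ℕ) (z : ℂ), ‖z‖ = 1 ∧ ctrlPhase k θ ^ (r + 1) = z • 1 :=
    ⟨by rw [ctrlPhase_star, ctrlPhase_mul, neg_add_cancel, ctrlPhase_zero],
      r, 1, norm_one, by rw [ctrlPhase_pow, h, ctrlPhase_two_pi, one_smul]⟩
  cases g
  case K =>
    refine ⟨by rw [Gate.op, localOp_star, localOp_inverse kMat_star_mul], 2, _,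
      Complex.norm_exp_ofReal_mul_I (Real.pi / 4), ?_⟩
    have h : (localOp fun _ : Fin 1 => kMat) ^ 3 = localOp fun _ => kMat ^ 3 := by
      rw [pow_succ, pow_two, localOp_mul, localOp_mul]
      simp only [pow_succ, pow_zero, one_mul]
    rw [Gate.op, h, kMat_pow_three]
    ext x y
    simp [localOp, Matrix.one_apply, funext_iff]
  case T => exact hc 0 7 _ (by push_cast; ring)
  case S => exact hc 0 3 _ (by push_cast; ring)
  case CZ => exact hc 1 1 _ (by push_cast; ring)
  case CCZ => exact hc 2 1 _ (by push_cast; ring)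
  all_goals exact hg.elim

variable (ι) in
/-- The operators computed by circuits over the library, up to global phases. -/
def libraryMonoid : Submonoid (Op ι) where
  carrier := {V | ∃ (c : Circuit ι) (z : ℂ),
    (∀ g ∈ c, g.gate.InLibrary) ∧ ‖z‖ = 1 ∧ V = z • Circuit.eval c}
  one_mem' := ⟨[], 1, by simp, norm_one, by rw [one_smul]; rfl⟩
  mul_mem' := by
    rintro _ _ ⟨c, z, hc, hz, rfl⟩ ⟨d, w, hd, hw, rfl⟩
    refine ⟨d ++ c, z * w, fun g hg => (List.mem_append.1 hg).elim (hd g) (hc g),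
      by rw [norm_mul, hz, hw, one_mul], ?_⟩
    rw [Circuit.eval_append, smul_mul_smul_comm]

theorem smul_mem_libraryMonoid {V : Op ι} (hV : V ∈ libraryMonoid ι) {z : ℂ} (hz : ‖z‖ = 1) :
    z • V ∈ libraryMonoid ι := by
  obtain ⟨c, w, hc, hw, rfl⟩ := hV
  exact ⟨c, z * w, hc, by rw [norm_mul, hz, hw, one_mul], by rw [smul_smul]⟩

theorem applyAt_mem_libraryMonoid {k : ℕ} {g : Gate k} (hg : g.InLibrary) (e : Fin k ↪ ι) :
    applyAt e g.op ∈ libraryMonoid ι :=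
  ⟨[⟨k, g, e⟩], 1, by simpa using hg, norm_one, by
    rw [one_smul, Circuit.eval, Circuit.eval, Matrix.one_mul]; rfl⟩

/-- A set of operators that contains the library gates and is closed under products and phases
contains all circuits. -/
theorem libraryMonoid_induction {p : Op ι → Prop}
    (gate : ∀ {k : ℕ} {g : Gate k}, g.InLibrary → ∀ e : Fin k ↪ ι, p (applyAt e g.op))
    (one : p 1) (mul : ∀ U V, p U → p V → p (U * V)) (smul : ∀ (z : ℂ) U, ‖z‖ = 1 → p U → p (z • U))
    {V : Op ι} (hV : V ∈ libraryMonoid ι) : p V := by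
  obtain ⟨c, z, hc, hz, rfl⟩ := hV
  refine smul z _ hz ?_
  clear hz
  induction c with
  | nil => exact one
  | cons g c ih =>
    exact mul _ _ (ih fun g' hg' => hc g' (List.mem_cons_of_mem _ hg'))
      (gate (hc g List.mem_cons_self) g.wires)

theorem applyAt_star_mul {k : ℕ} {g : Gate k} (hg : g.InLibrary) (e : Fin k ↪ ι) :
    star (applyAt e g.op) * applyAt e g.op = 1 := by
  rw [applyAt_star, ← applyAt_mul, hg.exists_pow.1, applyAt_one]

theorem libraryMonoid_le_unitary : libraryMonoid ι ≤ unitary (Op ι) := by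
  intro V hV
  refine libraryMonoid_induction (p := fun V => V ∈ unitary (Op ι)) ?_ (one_mem _)
    (fun U V => mul_mem) ?_ hV
  · intro k g hg e
    have h := applyAt_star_mul hg e
    exact Unitary.mem_iff.2 ⟨h, mul_eq_one_comm.1 h⟩
  · intro z U hz hU
    have h : star z * z = 1 := by
      rw [Complex.star_def, ← Complex.normSq_eq_conj_mul_self, Complex.normSq_eq_norm_sq, hz]
      simp
    obtain ⟨h₁, h₂⟩ := Unitary.mem_iff.1 hU
    refine Unitary.mem_iff.2 ⟨?_, ?_⟩
    · rw [star_smul, smul_mul_smul_comm, h, h₁, one_smul]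
    · rw [star_smul, smul_mul_smul_comm, mul_comm, h, h₂, one_smul]

theorem star_mem_libraryMonoid {V : Op ι} (hV : V ∈ libraryMonoid ι) :
    star V ∈ libraryMonoid ι := by
  refine libraryMonoid_induction (p := fun V => star V ∈ libraryMonoid ι) ?_ ?_ ?_ ?_ hV
  · intro k g hg e
    obtain ⟨-, r, z, hz, hr⟩ := hg.exists_pow
    have h : applyAt e g.op ^ r = z • star (applyAt e g.op) := by
      have h₁ : applyAt e g.op ^ (r + 1) = z • 1 := by
        rw [← applyAt_pow, hr, applyAt_smul, applyAt_one]
      calc applyAt e g.op ^ r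
          = applyAt e g.op ^ r * (applyAt e g.op * star (applyAt e g.op)) := by
            rw [mul_eq_one_comm.1 (applyAt_star_mul hg e), mul_one]
        _ = z • star (applyAt e g.op) := by
            rw [← mul_assoc, ← pow_succ, h₁, smul_mul_assoc, one_mul]
    have h₂ : star (applyAt e g.op) = z⁻¹ • applyAt e g.op ^ r := by
      rw [h, smul_smul, inv_mul_cancel₀ (norm_ne_zero_iff.1 (hz ▸ one_ne_zero)), one_smul]
    rw [h₂]
    exact smul_mem_libraryMonoid (pow_mem (applyAt_mem_libraryMonoid hg e) r)
      (by rw [norm_inv, hz, inv_one])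
  · rw [star_one]; exact one_mem _
  · intro U V hU hV
    rw [star_mul]; exact mul_mem hV hU
  · intro z U hz hU
    rw [star_smul]; exact smul_mem_libraryMonoid hU (by rw [norm_star, hz])

variable (ι) in
/-- The operators that are limits of circuits over the library, up to global phases. -/
noncomputable def libraryGroup : Submonoid (Op ι) := (libraryMonoid ι).topologicalClosure

theorem libraryGroup_isClosedUnitaryGroup : IsClosedUnitaryGroup (libraryGroup ι) where
  isClosed := (libraryMonoid ι).isClosed_topologicalClosure
  le_unitary := (libraryMonoid ι).topologicalClosure_minimal libraryMonoid_le_unitary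
    isClosed_unitary
  star_mem _ hu := map_mem_closure continuous_star hu fun _ => star_mem_libraryMonoid

theorem mem_libraryGroup {V : Op ι} (hV : V ∈ libraryMonoid ι) : V ∈ libraryGroup ι :=
  (libraryMonoid ι).le_topologicalClosure hV

/-- A single-qubit operator, on the qubit `q` of a register. -/
noncomputable def qubitHom (q : ι) : Matrix (Fin 2) (Fin 2) ℂ →ₐ[ℂ] Op ι :=
  have h (M : Matrix (Fin 2) (Fin 2) ℂ) (x y : ι → Fin 2) :
      localOp (Function.update 1 q M) x y =
        M (x q) (y q) * ∏ i ∈ {q}ᶜ, (1 : Matrix (Fin 2) (Fin 2) ℂ) (x i) (y i) := by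
    rw [localOp, Fintype.prod_eq_mul_prod_compl q, Function.update_self]
    congr 1
    refine Finset.prod_congr rfl fun i hi => ?_
    rw [Function.update_of_ne (by simpa using hi)]; rfl
  AlgHom.ofLinearMap
    { toFun := fun M => localOp (Function.update 1 q M)
      map_add' := fun M N => by
        ext x y
        simp only [Matrix.add_apply, h, add_mul]
      map_smul' := fun z M => by
        ext x y
        simp only [Matrix.smul_apply, h, smul_eq_mul, mul_assoc, RingHom.id_apply] }
    (by
      change localOp (Function.update 1 q 1) = 1
      rw [← localOp_one]
      congr 1
      exact Function.update_eq_self q 1)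
    (fun M N => by
      change localOp _ = localOp _ * localOp _
      rw [localOp_mul]
      congr 1
      funext i
      by_cases hi : i = q
      · subst hi; simp
      · simp [Function.update_of_ne hi])

theorem qubitHom_apply (q : ι) (M : Matrix (Fin 2) (Fin 2) ℂ) :
    qubitHom q M = localOp (Function.update 1 q M) := rfl

theorem qubitHom_star (q : ι) (M : Matrix (Fin 2) (Fin 2) ℂ) :
    star (qubitHom q M) = qubitHom q (star M) := by
  rw [qubitHom_apply, qubitHom_apply, localOp_star]
  congr 1
  funext i
  by_cases hi : i = q
  · subst hi; simp
  · simp [Function.update_of_ne hi]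

theorem ctrlPhase_zero_eq_localOp (θ : ℝ) :
    ctrlPhase 0 θ = localOp fun _ => phaseMat θ := by
  ext x y
  have h : x = y ↔ x 0 = y 0 := funext_iff.trans Fin.forall_fin_one
  have h' : (∀ j, x j = 1) ↔ x 0 = 1 := Fin.forall_fin_one
  rw [ctrlPhase, Matrix.diagonal_apply, localOp, Fin.prod_univ_one]
  simp only [h, h']
  generalize x 0 = a
  generalize y 0 = b
  fin_cases a <;> fin_cases b <;> simp [phaseMat]

theorem qubitHom_eq_applyAt (q : ι) (M : Matrix (Fin 2) (Fin 2) ℂ) :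
    qubitHom q M = applyAt (wire q) (localOp fun _ => M) := (applyAt_wire q M).symm

theorem qubitHom_S_mem (q : ι) : qubitHom q (phaseMat (Real.pi / 2)) ∈ libraryMonoid ι := by
  rw [qubitHom_eq_applyAt, ← ctrlPhase_zero_eq_localOp]
  exact applyAt_mem_libraryMonoid (g := .S) trivial _

theorem qubitHom_T_mem (q : ι) : qubitHom q (phaseMat (Real.pi / 4)) ∈ libraryMonoid ι := by
  rw [qubitHom_eq_applyAt, ← ctrlPhase_zero_eq_localOp]
  exact applyAt_mem_libraryMonoid (g := .T) trivial _

theorem qubitHom_H_mem (q : ι) : qubitHom q hMat ∈ libraryMonoid ι := by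
  have h : hMat = star (phaseMat (Real.pi / 2)) * kMat := by
    rw [kMat, ← Matrix.mul_assoc, phaseMat_star, phaseMat_mul, neg_add_cancel, phaseMat_zero,
      Matrix.one_mul]
  rw [h, map_mul, ← qubitHom_star]
  refine mul_mem (star_mem_libraryMonoid (qubitHom_S_mem q)) ?_
  rw [qubitHom_eq_applyAt]
  exact applyAt_mem_libraryMonoid (g := .K) trivial _

/-- The angle of the rotation `T H T H`. -/
noncomputable def rotationAngle : ℝ := Real.arccos ((2 + Real.sqrt 2) / 4)

theorem sqrt_two_lt : Real.sqrt 2 < 2 := by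
  rw [Real.sqrt_lt' two_pos]; norm_num

theorem cos_rotationAngle : Real.cos rotationAngle = (2 + Real.sqrt 2) / 4 :=
  Real.cos_arccos (by linarith [Real.sqrt_nonneg 2]) (by linarith [sqrt_two_lt])

/-- Twice the cosine is `1 + √2 / 2`, which is not an algebraic integer. -/
theorem irrational_rotationAngle : Irrational (rotationAngle / (2 * Real.pi)) := by
  rintro ⟨q, hq⟩
  have h₁ : rotationAngle = ((2 * q : ℚ) : ℝ) * Real.pi := by
    push_cast
    rw [hq]
    field_simp
  have h₂ := Real.isIntegral_two_mul_cos_rat_mul_pi (2 * q)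
  rw [← h₁, cos_rotationAngle] at h₂
  have h₃ : IsIntegral ℤ (((1 / 2 : ℚ) : ℝ)) := by
    have h₄ := (h₂.sub isIntegral_one).pow 2
    have h₅ : (2 * ((2 + Real.sqrt 2) / 4) - 1) ^ 2 = ((1 / 2 : ℚ) : ℝ) := by
      have := Real.sq_sqrt (show (0 : ℝ) ≤ 2 by norm_num)
      push_cast
      nlinarith
    rwa [h₅] at h₄
  obtain ⟨k, hk⟩ := (IsIntegral.exists_int_iff_exists_rat h₃).1 ⟨_, rfl⟩
  have h₄ : (1 : ℝ) = ((2 * k : ℤ) : ℝ) := by push_cast; rw [← hk]; norm_num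
  have h₅ : (1 : ℤ) = 2 * k := by exact_mod_cast h₄
  omega

theorem phaseMat_eq (θ : ℝ) : phaseMat θ = Complex.exp ((θ / 2 : ℝ) * Complex.I) •
    ((Real.cos (θ / 2) : ℂ) • 1 - (Real.sin (θ / 2) * Complex.I) • zMat) := by
  have h₁ : Complex.exp ((θ / 2 : ℝ) * Complex.I) * (Real.cos (θ / 2) + Real.sin (θ / 2) * Complex.I) =
      Complex.exp (θ * Complex.I) := by
    rw [Complex.ofReal_cos, Complex.ofReal_sin, ← Complex.exp_mul_I, ← Complex.exp_add]
    congr 1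
    push_cast
    ring
  have h₂ : Complex.exp ((θ / 2 : ℝ) * Complex.I) * (Real.cos (θ / 2) - Real.sin (θ / 2) * Complex.I) =
      1 := by
    have h₃ := Complex.exp_mul_I (-(θ / 2 : ℝ))
    rw [Complex.cos_neg, Complex.sin_neg, neg_mul (Complex.sin _), ← sub_eq_add_neg, ← Complex.ofReal_cos,
      ← Complex.ofReal_sin] at h₃
    rw [← h₃, ← Complex.exp_add, neg_mul, add_neg_cancel, Complex.exp_zero]
  ext a b
  fin_cases a <;> fin_cases b
  · simpa [phaseMat, zMat] using h₂.symm
  · simp [phaseMat, zMat]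
  · simp [phaseMat, zMat]
  · simpa [phaseMat, zMat] using h₁.symm

theorem hMat_conj_zMat : hMat * zMat * hMat = xMat := by
  ext a b
  fin_cases a <;> fin_cases b <;>
    simp [hMat, zMat, xMat, Matrix.mul_apply, Fin.sum_univ_two, inv_sqrt_two_mul_self] <;> norm_num

/-- The axis of the rotation `T H T H`, which does not lie in the `XY`-plane. -/
theorem exists_rotationAxis : ∃ (N : Matrix (Fin 2) (Fin 2) ℂ) (r : ℝ), N * N = 1 ∧ star N = N ∧
    r ≠ 0 ∧ N + zMat * N * zMat = (r : ℂ) • zMat ∧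
    phaseMat (Real.pi / 4) * (hMat * phaseMat (Real.pi / 4) * hMat) =
      Complex.exp ((Real.pi / 4 : ℝ) * Complex.I) •
        ((Real.cos rotationAngle : ℂ) • 1 + (Real.sin rotationAngle * Complex.I) • N) := by
  set c := Real.cos (Real.pi / 4 / 2) with hc
  set s := Real.sin (Real.pi / 4 / 2) with hs
  set C := Real.cos rotationAngle with hC
  set S := Real.sin rotationAngle with hS
  have hcs : c ^ 2 + s ^ 2 = 1 := Real.cos_sq_add_sin_sq _
  have hCS : C ^ 2 + S ^ 2 = 1 := Real.cos_sq_add_sin_sq _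
  have hcC : c ^ 2 = C := by
    rw [hC, cos_rotationAngle, hc, Real.cos_sq, mul_div_cancel₀ _ two_ne_zero, Real.cos_pi_div_four]
    ring
  have hC₁ : C < 1 := by rw [hC, cos_rotationAngle]; linarith [sqrt_two_lt]
  have hC₀ : 0 < C := by rw [hC, cos_rotationAngle]; positivity
  have hS₀ : S ≠ 0 := by
    intro h
    rw [h] at hCS
    nlinarith
  have hs₀ : s ≠ 0 := by
    intro h
    rw [h] at hcs
    linarith
  have hc₀ : c ≠ 0 := by
    intro h
    rw [h] at hcC
    linarith
  set a := -(s * c / S) with ha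
  set b := -(s * s / S) with hb
  have hab : 2 * a ^ 2 + b ^ 2 = 1 := by
    rw [ha, hb]
    field_simp
    nlinarith
  have haS : S * a = -(s * c) := by rw [ha]; field_simp
  have hbS : S * b = -(s * s) := by rw [hb]; field_simp
  have hab' : 2 * (a : ℂ) ^ 2 + (b : ℂ) ^ 2 = 1 := by exact_mod_cast hab
  have haS' : (S : ℂ) * a = -(s * c) := by exact_mod_cast haS
  have hbS' : (S : ℂ) * b = -(s * s) := by exact_mod_cast hbS
  have hcC' : (c : ℂ) ^ 2 = C := by exact_mod_cast hcC
  have hI : Complex.I * Complex.I = -1 := Complex.I_mul_I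
  -- up to a phase the product is `(c - i s Z) (c - i s X)`, so the axis is `a X + b Y + a Z`
  refine ⟨!![(a : ℂ), a - b * Complex.I; a + b * Complex.I, -a], 2 * a, ?_, ?_, ?_, ?_, ?_⟩
  · ext i j
    fin_cases i <;> fin_cases j <;> simp [Matrix.mul_apply, Fin.sum_univ_two]
    · linear_combination hab' - (b : ℂ) ^ 2 * hI
    · ring
    · ring
    · linear_combination hab' - (b : ℂ) ^ 2 * hI
  · ext i j
    fin_cases i <;> fin_cases j <;> simp [sub_eq_add_neg]
  · exact mul_ne_zero two_ne_zero (neg_ne_zero.2 (div_ne_zero (mul_ne_zero hs₀ hc₀) hS₀))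
  · ext i j
    fin_cases i <;> fin_cases j <;> simp [zMat] <;> ring
  · have h₁ : hMat * phaseMat (Real.pi / 4) * hMat =
        Complex.exp ((Real.pi / 4 / 2 : ℝ) * Complex.I) •
          ((c : ℂ) • 1 - (s * Complex.I) • xMat) := by
      rw [phaseMat_eq, Matrix.mul_smul, Matrix.smul_mul, Matrix.mul_sub, Matrix.sub_mul,
        Matrix.mul_smul, Matrix.smul_mul, Matrix.mul_one, hMat_mul_self, Matrix.mul_smul,
        Matrix.smul_mul, hMat_conj_zMat]
    rw [h₁, phaseMat_eq, smul_mul_smul_comm, ← Complex.exp_add, ← add_mul, ← Complex.ofReal_add,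
      add_halves]
    congr 1
    ext i j
    fin_cases i <;> fin_cases j <;> simp [Matrix.mul_apply, Fin.sum_univ_two, zMat, xMat, ← hc, ← hs]
    · linear_combination hcC' - Complex.I * haS'
    · linear_combination (-Complex.I) * haS' + Complex.I ^ 2 * hbS'
    · linear_combination (-Complex.I) * haS' - Complex.I ^ 2 * hbS'
    · linear_combination hcC' + Complex.I * haS'

theorem I_smul_one_mem_lieSpace : Complex.I • (1 : Op ι) ∈ lieSpace (libraryGroup ι) := by
  refine ⟨by rw [star_smul, star_one, Complex.star_def, Complex.conj_I, neg_smul], fun t => ?_⟩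
  rw [exp_smul_involution (mul_one 1), ← add_smul, Complex.ofReal_cos, Complex.ofReal_sin,
    ← Complex.exp_mul_I]
  exact mem_libraryGroup (smul_mem_libraryMonoid (one_mem _) (Complex.norm_exp_ofReal_mul_I t))

theorem zMat_star : star zMat = zMat := by
  ext a b
  fin_cases a <;> fin_cases b <;> simp [zMat]

theorem qubitHom_Z_mem (q : ι) : qubitHom q zMat ∈ libraryMonoid ι := by
  have h : zMat = phaseMat (Real.pi / 2) * phaseMat (Real.pi / 2) := by
    rw [phaseMat_mul, add_halves]
    ext a b
    fin_cases a <;> fin_cases b <;> simp [phaseMat, zMat]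
  rw [h, map_mul]
  exact mul_mem (qubitHom_S_mem q) (qubitHom_S_mem q)

theorem qubitHom_Z_mem_lieSpace (q : ι) :
    Complex.I • qubitHom q zMat ∈ lieSpace (libraryGroup ι) := by
  obtain ⟨N, r, hN, hN', hr, hZ, h⟩ := exists_rotationAxis
  have h₁ : Complex.I • qubitHom q N ∈ lieSpace (libraryGroup ι) := by
    refine libraryGroup_isClosedUnitaryGroup.mem_of_irrational (by rw [← map_mul, hN, map_one])
      (by rw [qubitHom_star, hN']) irrational_rotationAngle ?_
    have h₂ := congrArg (qubitHom q) h
    simp only [map_mul, map_smul, map_add, map_one] at h₂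
    have h₃ := smul_mem_libraryMonoid (mul_mem (qubitHom_T_mem q) (mul_mem (mul_mem
      (qubitHom_H_mem q) (qubitHom_T_mem q)) (qubitHom_H_mem q)))
      (Complex.norm_exp_ofReal_mul_I (-(Real.pi / 4)))
    rw [h₂, smul_smul, ← Complex.exp_add, ← add_mul, ← Complex.ofReal_add, neg_add_cancel,
      Complex.ofReal_zero, zero_mul, Complex.exp_zero, one_smul] at h₃
    exact mem_libraryGroup h₃
  have h₂ := libraryGroup_isClosedUnitaryGroup.add_mem h₁
    (libraryGroup_isClosedUnitaryGroup.conj_mem (mem_libraryGroup (qubitHom_Z_mem q)) h₁)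
  rw [qubitHom_star, zMat_star, mul_smul_comm, smul_mul_assoc, ← smul_add, ← map_mul, ← map_mul,
    ← map_add, hZ, map_smul] at h₂
  have h₃ := smul_mem_lieSpace h₂ r⁻¹
  rwa [smul_comm, smul_smul ((r⁻¹ : ℝ) : ℂ), ← Complex.ofReal_mul, inv_mul_cancel₀ hr, Complex.ofReal_one,
    one_smul] at h₃

/-- Conjugation by single-qubit gates changes the labels of Pauli strings. -/
theorem pauliOp_update_mem_lieSpace {P : ι → Pauli} {q : ι} {M : Matrix (Fin 2) (Fin 2) ℂ}
    {B : Pauli} (hM : qubitHom q M ∈ libraryMonoid ι) (h : M * (P q).mat * star M = B.mat)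
    (hP : Complex.I • pauliOp P ∈ lieSpace (libraryGroup ι)) :
    Complex.I • pauliOp (Function.update P q B) ∈ lieSpace (libraryGroup ι) := by
  have h₁ := libraryGroup_isClosedUnitaryGroup.conj_mem (mem_libraryGroup hM) hP
  rw [mul_smul_comm, smul_mul_assoc, qubitHom_star, qubitHom_apply, qubitHom_apply, pauliOp,
    localOp_mul, localOp_mul] at h₁
  convert! h₁ using 2
  rw [pauliOp]
  congr 1
  funext i
  by_cases hi : i = q
  · subst hi; simp [h]
  · simp [Function.update_of_ne hi]

theorem pauliOp_update_mem_lieSpace_of_X {P : ι → Pauli} {q : ι} (hq : P q = .X) {B : Pauli}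
    (hB : B ≠ 1) (hP : Complex.I • pauliOp P ∈ lieSpace (libraryGroup ι)) :
    Complex.I • pauliOp (Function.update P q B) ∈ lieSpace (libraryGroup ι) := by
  have hZ : hMat * xMat * hMat = zMat := by
    rw [← hMat_conj_zMat, Matrix.mul_assoc, Matrix.mul_assoc, hMat_mul_self, Matrix.mul_one,
      ← Matrix.mul_assoc, hMat_mul_self, Matrix.one_mul]
  cases B with
  | I => exact absurd rfl hB
  | X => rwa [← hq, Function.update_eq_self]
  | Y =>
    refine pauliOp_update_mem_lieSpace (qubitHom_S_mem q) ?_ hP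
    · rw [hq, phaseMat_star]
      ext a b
      fin_cases a <;> fin_cases b <;>
        simp [Pauli.mat, phaseMat, xMat, yMat, Matrix.mul_apply, Fin.sum_univ_two, neg_mul,
          Complex.exp_neg, Complex.exp_pi_div_two_mul_I]
  | Z =>
    refine pauliOp_update_mem_lieSpace (qubitHom_H_mem q) ?_ hP
    · rw [hq, hMat_star]; exact hZ

theorem pauliOp_update_mem_lieSpace_of_Z {P : ι → Pauli} {q : ι} (hq : P q = .Z) {B : Pauli}
    (hB : B ≠ 1) (hP : Complex.I • pauliOp P ∈ lieSpace (libraryGroup ι)) :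
    Complex.I • pauliOp (Function.update P q B) ∈ lieSpace (libraryGroup ι) := by
  have h := pauliOp_update_mem_lieSpace (qubitHom_H_mem q) (B := .X)
    (by rw [hq, hMat_star]; exact hMat_conj_zMat) hP
  have h₁ := pauliOp_update_mem_lieSpace_of_X (Function.update_self q .X P) hB h
  rwa [Function.update_idem] at h₁

/-- A controlled-`Z` gate spreads a label `X` on one of its qubits to a label `Z` on the other. -/
theorem pauliOp_update_Z_mem_lieSpace {P : ι → Pauli} {q r : ι} (hqr : q ≠ r) (hq : P q = .X)
    (hr : P r = 1) (hP : Complex.I • pauliOp P ∈ lieSpace (libraryGroup ι)) :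
    Complex.I • pauliOp (Function.update P r .Z) ∈ lieSpace (libraryGroup ι) := by
  let e : Fin 2 ↪ ι := ⟨![q, r], by
    intro a b h
    fin_cases a <;> fin_cases b <;> simp_all [hqr.symm]⟩
  have h₁ := libraryGroup_isClosedUnitaryGroup.conj_mem
    (mem_libraryGroup (applyAt_mem_libraryMonoid (g := .CZ) trivial e)) hP
  rw [mul_smul_comm, smul_mul_assoc, applyAt_star] at h₁
  have h₂ : applyAt e Gate.CZ.op * pauliOp P * applyAt e (star Gate.CZ.op) =
      pauliOp (Function.update P r .Z) := by
    have h₃ : star Gate.CZ.op = Gate.CZ.op := by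
      rw [Gate.op, ctrlPhase_star, ctrlPhase, ctrlPhase]
      simp [Complex.exp_neg]
    have hp (x y : ι → Fin 2) (f : ι → Matrix (Fin 2) (Fin 2) ℂ) :
        localOp f x y = f q (x q) (y q) * (f r (x r) (y r) *
          ∏ i ∈ (Finset.univ.erase q).erase r, f i (x i) (y i)) := by
      rw [localOp, ← Finset.mul_prod_erase _ _ (Finset.mem_univ q),
        ← Finset.mul_prod_erase _ _ (Finset.mem_erase.2 ⟨hqr.symm, Finset.mem_univ r⟩)]
    rw [h₃, Gate.op, applyAt_ctrlPhase]
    ext x y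
    rw [Matrix.mul_diagonal, Matrix.diagonal_mul, pauliOp, pauliOp, hp, hp,
      Function.update_of_ne hqr, Function.update_self, hq, hr]
    have hu : ∏ i ∈ (Finset.univ.erase q).erase r, (Function.update P r .Z i).mat (x i) (y i) =
        ∏ i ∈ (Finset.univ.erase q).erase r, (P i).mat (x i) (y i) :=
      Finset.prod_congr rfl fun i hi => by
        rw [Function.update_of_ne (Finset.ne_of_mem_erase hi)]
    rw [hu]
    generalize (∏ i ∈ (Finset.univ.erase q).erase r, (P i).mat (x i) (y i)) = w
    have he (x : ι → Fin 2) : (∀ j, x (e j) = 1) ↔ x q = 1 ∧ x r = 1 := Fin.forall_fin_two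
    simp only [he]
    generalize x q = a, x r = b, y q = a', y r = b'
    fin_cases a <;> fin_cases b <;> fin_cases a' <;> fin_cases b' <;>
      simp [Pauli.mat, xMat, zMat]
  rwa [h₂] at h₁

/-- All Pauli strings lie in the Lie algebra, by induction on their support. -/
theorem pauliOp_mem_lieSpace (P : ι → Pauli) :
    Complex.I • pauliOp P ∈ lieSpace (libraryGroup ι) := by
  suffices h : ∀ (s : Finset ι) (P : ι → Pauli), (∀ i, i ∉ s → P i = 1) →
      Complex.I • pauliOp P ∈ lieSpace (libraryGroup ι) from
    h Finset.univ P fun i hi => absurd (Finset.mem_univ i) hi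
  intro s
  induction s using Finset.induction_on with
  | empty =>
    intro P hP
    rw [show P = 1 from funext fun i => hP i (Finset.notMem_empty i), pauliOp_one]
    exact I_smul_one_mem_lieSpace
  | insert r s hr ih =>
    intro P hP
    by_cases h₁ : P r = 1
    · refine ih P fun i hi => ?_
      by_cases hir : i = r
      · rw [hir, h₁]
      · exact hP i fun h => (Finset.mem_insert.1 h).elim hir hi
    have hP' (i : ι) (hi : i ∉ s) (hir : i ≠ r) : P i = 1 :=
      hP i fun h => (Finset.mem_insert.1 h).elim hir hi
    by_cases h₂ : ∃ q ∈ s, P q ≠ 1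
    · obtain ⟨q, hq, hPq⟩ := h₂
      have hqr : q ≠ r := fun h => hr (h ▸ hq)
      have h₃ := ih (Function.update (Function.update P r 1) q .X) fun i hi => by
        rw [Function.update_of_ne (ne_of_mem_of_not_mem hq hi).symm]
        by_cases hir : i = r
        · rw [hir, Function.update_self]
        · rw [Function.update_of_ne hir, hP' i hi hir]
      have h₄ := pauliOp_update_Z_mem_lieSpace hqr (Function.update_self _ _ _)
        (by rw [Function.update_of_ne hqr.symm, Function.update_self]) h₃
      have h₅ := pauliOp_update_mem_lieSpace_of_Z (Function.update_self _ _ _) h₁ h₄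
      have h₆ := pauliOp_update_mem_lieSpace_of_X (q := q)
        (by simp [Function.update_of_ne hqr]) hPq h₅
      convert! h₆ using 3
      funext i
      by_cases hiq : i = q
      · subst hiq; simp
      · by_cases hir : i = r
        · subst hir; simp [Function.update_of_ne hiq]
        · simp [Function.update_of_ne hiq, Function.update_of_ne hir]
    · push Not at h₂
      have h₃ := qubitHom_Z_mem_lieSpace r
      have h₄ : qubitHom r zMat = pauliOp (Function.update 1 r .Z) := by
        rw [qubitHom_apply, pauliOp]
        congr 1
        funext i
        by_cases hir : i = r
        · subst hir; simp [Pauli.mat]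
        · simp [Function.update_of_ne hir, Pauli.mat, show (1 : Pauli) = .I from rfl]
      rw [h₄] at h₃
      have h₅ := pauliOp_update_mem_lieSpace_of_Z (Function.update_self _ _ _) h₁ h₃
      convert! h₅ using 3
      funext i
      by_cases hir : i = r
      · subst hir; simp
      · rw [Function.update_of_ne hir, Function.update_of_ne hir]
        by_cases hi : i ∈ s
        · exact h₂ i hi
        · exact hP' i hi hir

theorem pauliOp_star (P : ι → Pauli) : star (pauliOp P) = pauliOp P := by
  rw [pauliOp, localOp_star]
  congr 1
  funext i
  cases P i
  · exact star_one _
  all_goals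
    ext a b
    fin_cases a <;> fin_cases b <;> simp [Pauli.mat, xMat, yMat, zMat]

/-- The Lie algebra consists of all skew-adjoint operators. -/
theorem mem_lieSpace_of_star_eq_neg {X : Op ι} (hX : star X = -X) :
    X ∈ lieSpace (libraryGroup ι) := by
  have h : ∀ Y ∈ pauliSpan (Set.univ : Set ι), ∀ z : ℂ,
      z • Y - star (z • Y) ∈ lieSpace (libraryGroup ι) := by
    intro Y hY
    induction hY using Submodule.span_induction with
    | zero => intro z; simpa using zero_mem_lieSpace
    | add Y Y' _ _ h h' =>
      intro z
      have h₁ := libraryGroup_isClosedUnitaryGroup.add_mem (h z) (h' z)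
      rwa [sub_add_sub_comm, ← star_add, ← smul_add] at h₁
    | smul w Y _ h =>
      intro z
      have h₁ := h (z * w)
      rwa [mul_smul] at h₁
    | mem Y hY =>
      obtain ⟨P, -, rfl⟩ := hY
      intro z
      have h₁ := smul_mem_lieSpace (pauliOp_mem_lieSpace P) (2 * z.im)
      rwa [smul_smul, show ((2 * z.im : ℝ) : ℂ) * Complex.I = z - star z by
        rw [Complex.star_def, Complex.sub_conj], sub_smul, ← pauliOp_star, ← star_smul,
        pauliOp_star] at h₁
  have h₁ : X ∈ pauliSpan (Set.univ : Set ι) := by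
    have h₂ := applyAt_mem_pauliSpan (Function.Embedding.refl ι) X
    rw [applyAt_refl] at h₂
    exact pauliSpan_mono (Set.subset_univ _) h₂
  have h₂ := h X h₁ (1 / 2)
  rw [star_smul, hX] at h₂
  convert! h₂ using 1
  simp only [star_div₀, star_one, star_ofNat]
  module

theorem libraryUniversal : LibraryUniversal := by
  intro n U hU
  exact libraryGroup_isClosedUnitaryGroup.mem_of_finite_spectrum
    (fun X hX => mem_lieSpace_of_star_eq_neg hX) hU U.finite_spectrum

end Universality

end ConcatFT

theorem mainTheorem3 :
    -- the gate library is universal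
    LibraryUniversal ∧
    -- both constituent codes are codes that correct an arbitrary single-qubit error
    (IsEncoding fivePrimeCode.ket ∧
      ∃ D : Decoder fivePrimeCode.ket, D.CorrectsSingleErrors) ∧
    (IsEncoding rmCode.ket ∧ ∃ D : Decoder rmCode.ket, D.CorrectsSingleErrors) ∧
    -- on the 5'-qubit code the bitwise operator `Z₃ K^{⊗5}` is the logical `K`
    Implements fivePrimeCode.ket
      (blockOp fun _ : Fin 1 => localOp ![kMat, kMat, zMat * kMat, kMat, kMat])
      Gate.K.op ∧
    -- on the 5'-qubit code, `C^k Z(θ)` is implemented by coupling only the qubits 1, 3, 5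
    (∀ (k : ℕ) (θ : ℝ), Implements fivePrimeCode.ket (phaseCircuit k θ) (ctrlPhase k θ)) ∧
    -- the gates of these circuits are transversal on the Reed–Muller code
    (HasTransversal rmCode.ket Gate.CNOT.op ∧ HasTransversal rmCode.ket Gate.T.op ∧
      HasTransversal rmCode.ket Gate.S.op ∧ HasTransversal rmCode.ket Gate.CZ.op ∧
      HasTransversal rmCode.ket Gate.CCZ.op) ∧
    -- the non-uniform concatenation
    (Fintype.card (ConcatReg fivePrimeCode nonUniformLevel) = 47 ∧
      IsEncoding (concat fivePrimeCode nonUniformLevel) ∧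
      SupportsFTLibrary (concat fivePrimeCode nonUniformLevel)) ∧
    -- the uniform concatenation
    (Fintype.card (ConcatReg fivePrimeCode uniformLevel) = 75 ∧
      IsEncoding (concat fivePrimeCode uniformLevel) ∧
      SupportsFTLibrary (concat fivePrimeCode uniformLevel)) := by
  have hT {m : ℕ} (g : Gate m) {G : Op (Fin m)}
      (h : Implements rmCode.ket (bitwise (Fin 15) g).eval G) : HasTransversal rmCode.ket G :=
    ⟨_, by rw [eval_bitwise]; exact transversal_opOn _, h⟩
  have hN (q : Fin 5) : nonUniformLevel q = rmCode ∨ nonUniformLevel q = bareQubit := by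
    fin_cases q
    exacts [Or.inl rfl, Or.inr rfl, Or.inl rfl, Or.inr rfl, Or.inl rfl]
  have hN' (q : Fin 5) (h : q = 0 ∨ q = 2 ∨ q = 4) : nonUniformLevel q = rmCode := by
    rcases h with rfl | rfl | rfl <;> rfl
  refine ⟨libraryUniversal,
    ⟨fivePrimeEnc_isEncoding, ?_⟩, ⟨rmEnc_isEncoding, ?_⟩,
    fivePrimeEnc_implements_K, fivePrimeEnc_implements_phaseCircuit,
    ⟨hT _ rmEnc_implements_bitwise_CNOT, hT _ rmEnc_implements_bitwise_T,
      hT _ rmEnc_implements_bitwise_S, hT _ rmEnc_implements_bitwise_CZ,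
      hT _ rmEnc_implements_bitwise_CCZ⟩,
    ⟨?_, concat_isEncoding_and_supportsFTLibrary hN hN'⟩,
    ⟨?_, concat_isEncoding_and_supportsFTLibrary (fun _ => Or.inl rfl) fun _ _ => rfl⟩⟩
  · exact DetectsPairs.exists_decoder fivePrimeEnc_isEncoding fivePrimeEnc_eq_one
  · exact DetectsPairs.exists_decoder rmEnc_isEncoding rmEnc_eq_one
  · rw [Fintype.card_sigma]
    rfl
  · rw [Fintype.card_sigma]
    rfl
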